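/- Let $1\le p<\infty$, let $X_1,X_2,\dots$ be i.i.d. real random variables with distribution function $F$ (not a point mass), with empirical distribution functions $\mathbb F_n$, and write $X$ for a variable with distribution function $F$. Let $\mathcal G=\{G(\theta):\theta\in\Theta\}$, $\Theta\subset\mathbb R^k$, be a family of distribution functions, with $\theta\mapsto G(t;\theta)$ measurable for every $t$, and let $\psi_\theta:\mathbb R\to\mathbb R^k$ satisfy $\int\psi_\theta\,dG(\theta)=0$ for all $\theta\in\Theta$. Let $\theta_F$ be an interior point of $\Theta$ which is the unique solution in $\Theta$ of $\mathrm E_F\psi_\theta(X)=0$, and suppose $F-G(\theta_F)\in L^p(\mathbb R)$. Let $\hat\theta_n$ be $\Theta$-valued estimators of $\theta_F$. Assume: 1. There is $\dot G:\mathbb R\to\mathbb R^k$ with components in $L^p(\mathbb R)$ such that $\|G(\theta_F+h)-G(\theta_F)-\dot G^{T}h\|_p=o(\|h\|)$ as $h\to0$. 2. The map $\theta\mapsto \mathrm E_F\psi_\theta(X)$ is (defined near $\theta_F$ and) differentiable at $\theta_F$ with nonsingular derivative $V$, $\mathrm E_F\|\psi_{\theta_F}(X)\|^2<\infty$, and $\sqrt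 n(\hat\theta_n-\theta_F)=-V^{-1}n^{-1/2}\sum_{i=1}^n\psi_{\theta_F}(X_i)+o_{\mathrm P}(1)$. 3. $\int_0^\infty \mathrm P(|X|>t)^{p/2}\,dt<\infty$. Put $l=-V^{-1}\psi_{\theta_F}$ and $M=\mathrm E_F[l(X)l(X)^T]$, and let $\mathbb G$ be a (jointly measurable) centered Gaussian process on $\mathbb R$ with covariance function $$K(x,y)=F(x\wedge y)-F(x)F(y)+\dot G(x)^TM\dot G(y)-\dot G(x)^T\mathrm E_F[l(X)1_{\{X\le y\}}]-\dot G(y)^T\mathrm E_F[l(X)1_{\{X\le x\}}].$$ Let $C=\{t: F(t)=G(t;\theta_F)\}$ be the contact set, and assume that the limit process does not degenerate on flat pieces of contact: $K(t,t)>0$ for almost every $t\in C$ with $0<F(t)<1$ such that $F$ is constant in a neighbourhood of $t$. (This is no restriction if $F$ is strictly increasing on $\{0<F<1\}$.) Then $\sqrt n\,(\|\mathbb F_n-G(\hat\theta_n)\|_p-\|F-G(\theta_F)\|_p)$ converges weakly to a random variable $T$, given by $$T=\int_C|\mathbb G|+\int_{\mathbb R\setminus C}\mathbb G\,\mathrm{sgn}(F-G(\theta_F))\quad\text{if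 }p=1,$$ and, if $1<p<\infty$, by $T=\|\mathbb G\|_p$ when $F=G(\theta_F)$ and $$T=\frac1{\|F-G(\theta_F)\|_p^{p-1}}\int\mathbb G\,|F-G(\theta_F)|^{p-1}\,\mathrm{sgn}(F-G(\theta_F))\quad\text{when }F\ne G(\theta_F).$$ Moreover (normal laws $N(0,\sigma^2)$ with $\sigma\ge0$): (i) If $p=1$, then $T$ has a zero-mean normal law if and only if the part of the contact set on which $0<F<1$, that is $C\cap\{t:0<F(t)<1\}$, has Lebesgue measure zero. (ii) If $1<p<\infty$, then $T$ has a zero-mean normal law if and only if $F\ne G(\theta_F)$, and this holds if and only if $F\notin\mathcal G$. -/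

import Mathlib

open MeasureTheory ProbabilityTheory Filter Topology Set
open scoped ENNReal NNReal

noncomputable section

namespace AGoF

/-- The parameter space `ℝᵏ` with its Euclidean norm. -/
abbrev Param (k : ℕ) : Type := EuclideanSpace ℝ (Fin k)

/-- The empirical distribution function of `X₀, …, X_{n-1}`. -/
def empCDF {Ω : Type*} (X : ℕ → Ω → ℝ) (n : ℕ) (ω : Ω) (t : ℝ) : ℝ :=
  (n : ℝ)⁻¹ * ∑ i ∈ Finset.range n, (Iic t).indicator (fun _ => (1 : ℝ)) (X i ω)

/-- The `Lᵖ(ℝ)`-distance `‖f - g‖_p` with respect to Lebesgue measure. -/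
def lpDist (p : ℝ) (f g : ℝ → ℝ) : ℝ :=
  (eLpNorm (fun t => f t - g t) (ENNReal.ofReal p) volume).toReal

/-- The normalized statistic `√n (‖𝔽ₙ - G(θ̂ₙ)‖_p - ‖F - G(θ_F)‖_p)`, where `F` and `G(θ)` are the
distribution functions of `μ` and `Q θ`. -/
def testStat {k : ℕ} {Ω : Type*} (p : ℝ) (μ : Measure ℝ) (Q : Param k → Measure ℝ) (θF : Param k)
    (X : ℕ → Ω → ℝ) (θhat : ℕ → Ω → Param k) (n : ℕ) (ω : Ω) : ℝ :=
  √(n : ℝ) * (lpDist p (empCDF X n ω) (cdf (Q (θhat n ω))) - lpDist p (cdf μ) (cdf (Q θF)))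

/-- Standing framework: `Q θ`, `θ ∈ Θ`, is a parametric family of laws on `ℝ` such that
`E_{G(θ)} ψ_θ = 0` on `Θ`, and `θF` is an interior point of `Θ` that is the only solution in `Θ` of
`E_F ψ_θ = 0`, where `F` is the distribution function of `μ`. -/
structure Model {k : ℕ} (Θ : Set (Param k)) (Q : Param k → Measure ℝ)
    (ψ : Param k → ℝ → Param k) (μ : Measure ℝ) (θF : Param k) : Prop where
  isProb : ∀ θ ∈ Θ, IsProbabilityMeasure (Q θ)
  measurable_cdf : ∀ t : ℝ, Measurable (fun θ : Θ => cdf (Q (θ : Param k)) t)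
  unbiased : ∀ θ ∈ Θ, Integrable (ψ θ) (Q θ) ∧ ∫ x, ψ θ x ∂(Q θ) = 0
  interior : θF ∈ interior Θ
  root : Integrable (ψ θF) μ ∧ ∫ x, ψ θF x ∂μ = 0
  unique : ∀ θ ∈ Θ, Integrable (ψ θ) μ → ∫ x, ψ θ x ∂μ = 0 → θ = θF

/-- Fréchet differentiability of `θ ↦ G(θ)` at `θF` in `Lᵖ(ℝ)`, with derivative `Gdot`:
`‖G(θF + h) - G(θF) - Gdotᵀ h‖_p = o(‖h‖)`. -/
structure LpDifferentiable {k : ℕ} (p : ℝ) (Q : Param k → Measure ℝ) (θF : Param k)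
    (Gdot : ℝ → Param k) : Prop where
  memLp : ∀ i : Fin k, MemLp (fun t => Gdot t i) (ENNReal.ofReal p) volume
  isLittleO : ∀ ε : ℝ, 0 < ε → ∀ᶠ h in 𝓝 (0 : Param k),
    eLpNorm (fun t => cdf (Q (θF + h)) t - cdf (Q θF) t - inner ℝ (Gdot t) h)
      (ENNReal.ofReal p) volume ≤ ENNReal.ofReal (ε * ‖h‖)

/-- The map `θ ↦ E_F ψ_θ(X)` is differentiable at `θF` with nonsingular derivative `V`, the function
`ψ_{θF}` is square integrable, and the estimators are asymptotically linear:
`√n (θ̂ₙ - θF) = - V⁻¹ n^{-1/2} ∑ ψ_{θF}(Xᵢ) + o_P(1)`. -/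
structure AsympLinear {k : ℕ} {Ω : Type*} [MeasurableSpace Ω] (P : Measure Ω)
    (ψ : Param k → ℝ → Param k) (μ : Measure ℝ) (θF : Param k) (V : Param k ≃L[ℝ] Param k)
    (X : ℕ → Ω → ℝ) (θhat : ℕ → Ω → Param k) : Prop where
  integrable : ∀ᶠ θ in 𝓝 θF, Integrable (ψ θ) μ
  hasFDerivAt : HasFDerivAt (fun θ => ∫ x, ψ θ x ∂μ) (V : Param k →L[ℝ] Param k) θF
  memLp_two : MemLp (ψ θF) 2 μ
  expansion : TendstoInMeasure P
    (fun (n : ℕ) ω => √(n : ℝ) • (θhat n ω - θF)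
      + V.symm ((√(n : ℝ))⁻¹ • ∑ i ∈ Finset.range n, ψ θF (X i ω)))
    atTop (fun _ => 0)

/-- The Lorentz condition `∫₀^∞ P(|X| > t)^{p/2} dt < ∞`, i.e. `X ∈ 𝓛^{2/p,1}`, for `X ∼ μ`. -/
def LorentzCond (p : ℝ) (μ : Measure ℝ) : Prop :=
  ∫⁻ t in Ioi (0 : ℝ), (μ {x : ℝ | t < |x|}) ^ (p / 2) < ∞

/-- The influence function `l = - V⁻¹ ψ_{θF}`. -/
def influence {k : ℕ} (ψ : Param k → ℝ → Param k) (θF : Param k) (V : Param k ≃L[ℝ] Param k)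
    (x : ℝ) : Param k :=
  -V.symm (ψ θF x)

/-- The matrix `M = E_F[l(X) l(X)ᵀ]`. -/
def influenceCov {k : ℕ} (μ : Measure ℝ) (l : ℝ → Param k) : Matrix (Fin k) (Fin k) ℝ :=
  Matrix.of fun i j => ∫ u, l u i * l u j ∂μ

/-- The covariance function of the limit process,
`F(x ∧ y) - F(x)F(y) + Ġ(x)ᵀ M Ġ(y) - Ġ(x)ᵀ E_F[l(X) 1_{X ≤ y}] - Ġ(y)ᵀ E_F[l(X) 1_{X ≤ x}]`. -/
def limitCov {k : ℕ} (μ : Measure ℝ) (Gdot l : ℝ → Param k) (x y : ℝ) : ℝ :=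
  cdf μ (min x y) - cdf μ x * cdf μ y
    + (fun i => Gdot x i) ⬝ᵥ Matrix.mulVec (influenceCov μ l) (fun j => Gdot y j)
    - inner ℝ (Gdot x) (∫ u in Iic y, l u ∂μ)
    - inner ℝ (Gdot y) (∫ u in Iic x, l u ∂μ)

/-- `𝔾` is a (jointly measurable) centered Gaussian process on `ℝ` with covariance function `K`. -/
structure IsCenteredGaussian {Ω' : Type*} [MeasurableSpace Ω'] (P' : Measure Ω')
    (K : ℝ → ℝ → ℝ) (𝔾 : ℝ → Ω' → ℝ) : Prop where
  isGaussian : IsGaussianProcess 𝔾 P'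
  centered : ∀ t : ℝ, ∫ ω, 𝔾 t ω ∂P' = 0
  cov_eq : ∀ x y : ℝ, cov[𝔾 x, 𝔾 y; P'] = K x y
  aemeasurable : AEMeasurable (fun z : Ω' × ℝ => 𝔾 z.2 z.1) (P'.prod volume)

/-- The contact set `{F = G}`. -/
def contactSet (F G : ℝ → ℝ) : Set ℝ := {t | F t = G t}

open Classical in
/-- The limit variable `T(F, G, p)` attached to the process `𝔾`. -/
def limitVar {Ω' : Type*} (p : ℝ) (F G : ℝ → ℝ) (𝔾 : ℝ → Ω' → ℝ) (ω : Ω') : ℝ :=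
  if p = 1 then
    (∫ t in contactSet F G, |𝔾 t ω|) + ∫ t in (contactSet F G)ᶜ, 𝔾 t ω * Real.sign (F t - G t)
  else if F = G then
    (∫ t, |𝔾 t ω| ^ p) ^ (1 / p)
  else
    (lpDist p F G ^ (p - 1))⁻¹ *
      ∫ t, 𝔾 t ω * |F t - G t| ^ (p - 1) * Real.sign (F t - G t)

/-- The random variable `T` has a zero-mean normal law `N(0, v)`, `v ≥ 0`. -/
def IsZeroMeanNormal {Ω' : Type*} [MeasurableSpace Ω'] (P' : Measure Ω') (T : Ω' → ℝ) : Prop :=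
  ∃ v : ℝ≥0, HasLaw T (gaussianReal 0 v) P'

end AGoF

end

set_option linter.unusedSectionVars false

/-! Write `D = F - G(θ_F)`. The statistic is exactly the difference quotient `√n (‖D + z/√n‖_p -
‖D‖_p)` evaluated at the estimated empirical process `z = √n ((𝔽ₙ - G(θ̂ₙ)) - D)` (`testStat_eq`).
As functions of `z ∈ Lᵖ` these quotients are 1-Lipschitz for every `n`, and they converge pointwise
to a directional derivative of the norm (`tendsto_normQuotient`), which gives the formula for `T`. A
delta method therefore applies once `z` is shown to converge weakly to `𝔾` in `Lᵖ`.

Weak convergence in `Lᵖ` is handled by finite-dimensional approximation. Averaging over the cells of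
a grid is an `Lᵖ`-contraction of finite rank that tends strongly to the identity. For a fixed grid,
the vector of cell averages of the linearized process obeys the central limit theorem by Cramér–Wold
(`tendstoInDistribution_cellVec`), and an extended continuous mapping theorem for equi-Lipschitz
maps (`tendstoInDistribution_of_lipschitz`) transports this to the quotients. What remains is that
the estimated process is close to its averaged linearization in `Lᵖ`, in probability, for fine grids
and then all large `n` (`eventually_measure_estProc_sub_averaging_le`).

The substantial term is the empirical process minus its cell averages. For `p ≤ 2` its `p`-th moment
at `t` is controlled by its variance there. For `p > 2` a Rosenthal-type bound has an additional
term `n^{1-p/2}` times the variance, which Hölder's inequality controls on the window `|t| ≤ n^{p/2}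
+ 1`. Outside the window one uses `n P(|X| > n^{p/2}) → 0`: with high probability all observations
lie inside, and there the process equals a deterministic tail. The Lorentz condition supplies both
facts and the dominating function for refining the grid.

For normality of `T`: an integral of `𝔾` against a weight is Gaussian, because it lies in the closed
`L²`-span of the process. If `p = 1`, then `T` is the sum of `∫_C |𝔾| ≥ 0` and a centered normal
variable, so a zero mean forces `∫_C |𝔾| = 0`, that is `K(t,t) = 0` for almost all `t ∈ C`. If `p >
1` and `F = G(θ_F)`, then `T ≥ 0`, and a zero mean forces `K(t,t) = 0` almost everywhere.

Vanishing variance at `t` means `1_{x ≤ t} - F(t) = Ġ(t)ᵀ l(x)` for `μ`-almost every `x`. Centered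
indicators at points with distinct values of `F` in `(0,1)` are linearly independent, so the vectors
`Ġ(t)` would be too (`linearIndependent_Gdot`); hence at most `k` values of `F` occur. The
degenerate points with `0 < F < 1` lie in finitely many level intervals of `F`, whose interiors are
excluded by the nondegeneracy assumption and whose boundaries are null (`measure_contact_eq_zero`).
Conversely, at contact points with `F ∈ {0,1}` the map `θ ↦ G(t;θ)` is extremal at `θ_F`, so `Ġ(t) =
0` and the variance vanishes (`LpDifferentiable.ae_eq_zero`). -/

namespace AGoF

/-! ### Difference quotients and directional derivatives of the `Lᵖ`-norm -/

/-- The `Lᵖ(ℝ)`-seminorm as a real number. -/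
noncomputable def lpNormReal (p : ℝ) (f : ℝ → ℝ) : ℝ :=
  (eLpNorm f (ENNReal.ofReal p) volume).toReal

/-- The difference quotient `√n (‖F - G + z / √n‖_p - ‖F - G‖_p)`. -/
noncomputable def normQuotient (p : ℝ) (F G : ℝ → ℝ) (n : ℕ) (z : ℝ → ℝ) : ℝ :=
  √(n : ℝ) * (lpNormReal p ((F - G) + (√(n : ℝ))⁻¹ • z) - lpNormReal p (F - G))

open Classical in
/-- The directional derivative of the `Lᵖ`-norm at `F - G`. -/
noncomputable def normDirDeriv (p : ℝ) (F G z : ℝ → ℝ) : ℝ :=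
  if p = 1 then
    (∫ t in contactSet F G, |z t|) + ∫ t in (contactSet F G)ᶜ, z t * Real.sign (F t - G t)
  else if F = G then
    (∫ t, |z t| ^ p) ^ (1 / p)
  else
    (lpDist p F G ^ (p - 1))⁻¹ *
      ∫ t, z t * |F t - G t| ^ (p - 1) * Real.sign (F t - G t)

lemma limitVar_eq {Ω' : Type*} (p : ℝ) (F G : ℝ → ℝ) (𝔾 : ℝ → Ω' → ℝ) (ω : Ω') :
    limitVar p F G 𝔾 ω = normDirDeriv p F G (fun t => 𝔾 t ω) := rfl

lemma one_le_ofReal {p : ℝ} (hp : 1 ≤ p) : 1 ≤ ENNReal.ofReal p := by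
  simpa using ENNReal.ofReal_le_ofReal hp

lemma abs_lpNormReal_sub_le {p : ℝ} (hp : 1 ≤ p) {f g : ℝ → ℝ}
    (hf : MemLp f (ENNReal.ofReal p) volume) (hg : MemLp g (ENNReal.ofReal p) volume) :
    |lpNormReal p f - lpNormReal p g| ≤ lpNormReal p (f - g) := by
  have : Fact (1 ≤ ENNReal.ofReal p) := ⟨one_le_ofReal hp⟩
  have h := abs_norm_sub_norm_le (hf.toLp f) (hg.toLp g)
  rwa [← MemLp.toLp_sub, Lp.norm_toLp, Lp.norm_toLp, Lp.norm_toLp] at h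

lemma lpNormReal_smul (p c : ℝ) (f : ℝ → ℝ) :
    lpNormReal p (c • f) = |c| * lpNormReal p f := by
  simp [lpNormReal, eLpNorm_const_smul, ENNReal.toReal_mul]

/-- The factor `√n` cancels the scale `1/√n`, so the Lipschitz constant is 1 for every `n`. This
uniformity is what the extended continuous mapping theorem needs. -/
lemma abs_normQuotient_sub_le {p : ℝ} (hp : 1 ≤ p) {F G z w : ℝ → ℝ}
    (hD : MemLp (F - G) (ENNReal.ofReal p) volume)
    (hz : MemLp z (ENNReal.ofReal p) volume) (hw : MemLp w (ENNReal.ofReal p) volume) (n : ℕ) :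
    |normQuotient p F G n z - normQuotient p F G n w| ≤ lpNormReal p (z - w) := by
  unfold normQuotient
  rcases Nat.eq_zero_or_pos n with rfl | hn
  · simp [lpNormReal]
  have hs : 0 < √(n : ℝ) := Real.sqrt_pos.2 (by exact_mod_cast hn)
  rw [← mul_sub, sub_sub_sub_cancel_right, abs_mul, abs_of_pos hs]
  have h := abs_lpNormReal_sub_le hp (hD.add (hz.const_smul (√(n : ℝ))⁻¹))
    (hD.add (hw.const_smul (√(n : ℝ))⁻¹))
  have e : (F - G + (√(n : ℝ))⁻¹ • z) - (F - G + (√(n : ℝ))⁻¹ • w) = (√(n : ℝ))⁻¹ • (z - w) := by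
    rw [smul_sub]; abel
  rw [e, lpNormReal_smul, abs_of_pos (inv_pos.2 hs)] at h
  calc _ ≤ √(n : ℝ) * ((√(n : ℝ))⁻¹ * lpNormReal p (z - w)) := by gcongr
    _ = _ := by field_simp

lemma lpNormReal_eq_integral {p : ℝ} (hp : 1 ≤ p) {f : ℝ → ℝ}
    (hf : MemLp f (ENNReal.ofReal p) volume) :
    lpNormReal p f = (∫ t, |f t| ^ p) ^ (1 / p) := by
  have hp0 : 0 < p := by linarith
  rw [lpNormReal, hf.eLpNorm_eq_integral_rpow_norm (by simpa using hp0) (by simp),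
    ENNReal.toReal_ofReal (by positivity), ENNReal.toReal_ofReal hp0.le]
  simp

lemma tendsto_inv_sqrt_natCast : Tendsto (fun n : ℕ => (√(n : ℝ))⁻¹) atTop (𝓝 0) :=
  tendsto_inv_atTop_zero.comp (Real.tendsto_sqrt_atTop.comp tendsto_natCast_atTop_atTop)

lemma measurableSet_contactSet {F G : ℝ → ℝ} (hF : Measurable F) (hG : Measurable G) :
    MeasurableSet (contactSet F G) :=
  measurableSet_eq_fun hF hG

/-- The sequence is eventually constant: for `d ≠ 0` the perturbed value finally has the sign of
`d`, and for `d = 0` the absolute value is homogeneous. -/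
lemma tendsto_mul_abs_add_sub_abs (d z : ℝ) :
    Tendsto (fun n : ℕ => √(n : ℝ) * (|d + (√(n : ℝ))⁻¹ * z| - |d|)) atTop
      (𝓝 (if d = 0 then |z| else z * Real.sign d)) := by
  have hpos : ∀ᶠ n : ℕ in atTop, 0 < √(n : ℝ) := by
    filter_upwards [eventually_gt_atTop 0] with n hn
    exact Real.sqrt_pos.2 (by exact_mod_cast hn)
  have hlim : Tendsto (fun n : ℕ => d + (√(n : ℝ))⁻¹ * z) atTop (𝓝 d) := by
    simpa using (tendsto_inv_sqrt_natCast.mul_const z).const_add d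
  rcases lt_trichotomy d 0 with h | h | h
  · rw [if_neg h.ne, Real.sign_of_neg h]
    refine tendsto_const_nhds.congr' ?_
    filter_upwards [hpos, hlim.eventually (gt_mem_nhds h)] with n hn h1
    rw [abs_of_neg h1, abs_of_neg h]
    field_simp
    ring
  · subst h
    simp only [if_true]
    refine tendsto_const_nhds.congr' ?_
    filter_upwards [hpos] with n hn
    rw [zero_add, abs_zero, sub_zero, abs_mul, abs_of_pos (inv_pos.2 hn)]
    field_simp
  · rw [if_neg h.ne', Real.sign_of_pos h]
    refine tendsto_const_nhds.congr' ?_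
    filter_upwards [hpos, hlim.eventually (lt_mem_nhds h)] with n hn h1
    rw [abs_of_pos h1, abs_of_pos h]
    field_simp
    ring

/-- Dominated convergence: the integrands converge pointwise and are bounded by `|z|` through the
reverse triangle inequality. The contact set enters because the absolute value is not differentiable
at 0. -/
lemma tendsto_normQuotient_one {F G z : ℝ → ℝ} (hF : Measurable F) (hG : Measurable G)
    (hD : MemLp (F - G) (ENNReal.ofReal 1) volume) (hz : MemLp z (ENNReal.ofReal 1) volume) :
    Tendsto (fun n => normQuotient 1 F G n z) atTop (𝓝 (normDirDeriv 1 F G z)) := by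
  have hDz : ∀ n : ℕ, MemLp ((F - G) + (√(n : ℝ))⁻¹ • z) (ENNReal.ofReal 1) volume :=
    fun n => hD.add (hz.const_smul _)
  have hint : ∀ {f : ℝ → ℝ}, MemLp f (ENNReal.ofReal 1) volume → Integrable f volume := by
    intro f hf
    rw [ENNReal.ofReal_one] at hf
    exact memLp_one_iff_integrable.1 hf
  have hC := measurableSet_contactSet hF hG
  set φ : ℝ → ℝ := fun t => if F t - G t = 0 then |z t| else z t * Real.sign (F t - G t) with hφ
  have hsm : Measurable (fun t => Real.sign (F t - G t)) := by
    have : Measurable Real.sign := by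
      unfold Real.sign
      exact Measurable.ite measurableSet_Iio measurable_const
        (Measurable.ite measurableSet_Ioi measurable_const measurable_const)
    exact this.comp (hF.sub hG)
  have hsb : ∀ t, |z t * Real.sign (F t - G t)| ≤ |z t| := by
    intro t
    rcases Real.sign_apply_eq (F t - G t) with h | h | h <;> simp [h]
  have hsi : Integrable (fun t => z t * Real.sign (F t - G t)) := by
    refine (hint hz).mono ((hint hz).1.mul hsm.aestronglyMeasurable) (ae_of_all _ fun t => ?_)
    simpa using hsb t
  have hval : normDirDeriv 1 F G z = ∫ t, φ t := by
    have hφi : Integrable φ := by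
      refine (hint hz).mono ?_ (ae_of_all _ fun t => ?_)
      · have : φ = (contactSet F G).indicator (fun t => |z t|) +
            (contactSet F G)ᶜ.indicator (fun t => z t * Real.sign (F t - G t)) := by
          funext t
          by_cases h : F t = G t
          · simp [hφ, contactSet, h]
          · simp [hφ, contactSet, h, sub_eq_zero]
        rw [this]
        exact ((hint hz).1.norm.indicator hC).add (hsi.1.indicator hC.compl)
      · simp only [hφ]
        split_ifs
        · simp
        · simpa using hsb t
    rw [← integral_add_compl hC hφi, normDirDeriv, if_pos rfl]
    congr 1
    · refine setIntegral_congr_fun hC fun t ht => ?_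
      have : F t = G t := ht
      simp [hφ, this]
    · refine setIntegral_congr_fun hC.compl fun t ht => ?_
      have : ¬ F t = G t := ht
      simp [hφ, sub_eq_zero, this]
  have hquot : ∀ n : ℕ, normQuotient 1 F G n z
      = ∫ t, √(n : ℝ) * (|(F t - G t) + (√(n : ℝ))⁻¹ * z t| - |F t - G t|) := by
    intro n
    rw [normQuotient, lpNormReal_eq_integral le_rfl (hDz n), lpNormReal_eq_integral le_rfl hD,
      integral_const_mul]
    simp only [Real.rpow_one, div_one]
    rw [← integral_sub (hint (hDz n)).abs (hint hD).abs]
    simp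
  rw [hval]
  simp_rw [hquot]
  refine tendsto_integral_of_dominated_convergence (fun t => |z t|) (fun n => ?_)
    (hint hz).abs (fun n => ae_of_all _ fun t => ?_) (ae_of_all _ fun t => ?_)
  · exact (((hint (hDz n)).abs.sub (hint hD).abs).const_mul (√(n : ℝ))).1
  · rw [Real.norm_eq_abs, abs_mul, abs_of_nonneg (Real.sqrt_nonneg _)]
    have h1 := abs_abs_sub_abs_le_abs_sub ((F t - G t) + (√(n : ℝ))⁻¹ * z t) (F t - G t)
    rw [add_sub_cancel_left, abs_mul, abs_of_nonneg (inv_nonneg.2 (Real.sqrt_nonneg _))] at h1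
    calc _ ≤ √(n : ℝ) * ((√(n : ℝ))⁻¹ * |z t|) := by gcongr
      _ = (√(n : ℝ) * (√(n : ℝ))⁻¹) * |z t| := by ring
      _ ≤ 1 * |z t| := by gcongr; exact mul_inv_le_one
      _ = _ := one_mul _
  · exact tendsto_mul_abs_add_sub_abs _ _

/-- Differentiation under the integral sign: for `|s| ≤ 1` the derivative in `s` is dominated by the
integrable function `p (|D| + |z|)^p`. -/
lemma hasDerivAt_integral_abs_rpow {p : ℝ} (hp : 1 < p) {D z : ℝ → ℝ}
    (hD : MemLp D (ENNReal.ofReal p) volume) (hz : MemLp z (ENNReal.ofReal p) volume) :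
    HasDerivAt (fun s : ℝ => ∫ t, |D t + s * z t| ^ p)
      (∫ t, p * |D t| ^ (p - 2) * D t * z t) 0 := by
  have hp0 : 0 < p := by linarith
  have hint : ∀ {f : ℝ → ℝ}, MemLp f (ENNReal.ofReal p) volume →
      Integrable (fun t => |f t| ^ p) volume := by
    intro f hf
    have := hf.integrable_norm_rpow (by simpa using hp0) (by simp)
    simpa [ENNReal.toReal_ofReal hp0.le] using this
  have hDz : ∀ s : ℝ, MemLp (fun t => D t + s * z t) (ENNReal.ofReal p) volume :=
    fun s => hD.add (hz.const_mul s)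
  have key := hasDerivAt_integral_of_dominated_loc_of_deriv_le (μ := volume)
    (F := fun s t => |D t + s * z t| ^ p)
    (F' := fun s t => p * |D t + s * z t| ^ (p - 2) * (D t + s * z t) * z t) (x₀ := (0 : ℝ))
    (s := Metric.ball 0 1)
    (bound := fun t => p * (|D t| + |z t|) ^ p) (Metric.ball_mem_nhds 0 one_pos)
    (Eventually.of_forall fun s => (hint (hDz s)).1) (by simpa using hint hD)
    ?_ ?_ ?_ ?_
  · simpa using key.2
  · have h1 : AEStronglyMeasurable (fun t => D t + 0 * z t) volume := (hDz 0).1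
    have h2 : AEMeasurable (fun t => |D t + 0 * z t| ^ (p - 2)) volume :=
      (h1.aemeasurable.abs).pow_const _
    exact (((h2.const_mul p).mul h1.aemeasurable).mul hz.1.aemeasurable).aestronglyMeasurable
  · refine ae_of_all _ fun t s hs => ?_
    have hs1 : |s| ≤ 1 := by
      have := mem_ball_zero_iff.1 hs
      rw [Real.norm_eq_abs] at this
      exact this.le
    set u := D t + s * z t with hu
    have hub : |u| ≤ |D t| + |z t| := by
      refine (abs_add_le _ _).trans ?_
      refine add_le_add_right ?_ _
      rw [abs_mul]
      exact mul_le_of_le_one_left (abs_nonneg _) hs1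
    -- The exponent `p - 2` may be negative, so `u = 0` is treated apart; there the factor `|u|`
    -- makes the product vanish.
    have e1 : |u| ^ (p - 2) * |u| ≤ (|D t| + |z t|) ^ (p - 1) := by
      rcases eq_or_ne u 0 with h0 | h0
      · simp only [h0, abs_zero, mul_zero]; positivity
      · have : |u| ^ (p - 2) * |u| = |u| ^ (p - 1) := by
          nth_rewrite 2 [← Real.rpow_one |u|]
          rw [← Real.rpow_add (abs_pos.2 h0)]
          ring_nf
        rw [this]
        exact Real.rpow_le_rpow (abs_nonneg _) hub (by linarith)
    rw [Real.norm_eq_abs, abs_mul, abs_mul, abs_mul, abs_of_pos hp0,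
      abs_of_nonneg (Real.rpow_nonneg (abs_nonneg u) _)]
    have e2 : (|D t| + |z t|) ^ (p - 1) * |z t| ≤ (|D t| + |z t|) ^ p := by
      rcases (add_nonneg (abs_nonneg (D t)) (abs_nonneg (z t))).eq_or_lt with h0 | h0
      · have : |z t| = 0 := by
          have := abs_nonneg (D t); have := abs_nonneg (z t); linarith
        rw [this, mul_zero]; positivity
      · calc _ ≤ (|D t| + |z t|) ^ (p - 1) * (|D t| + |z t|) := by
              gcongr; linarith [abs_nonneg (D t)]
          _ = _ := by
              nth_rewrite 2 [← Real.rpow_one (|D t| + |z t|)]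
              rw [← Real.rpow_add h0]; ring_nf
    calc p * |u| ^ (p - 2) * |u| * |z t| = p * ((|u| ^ (p - 2) * |u|) * |z t|) := by ring
      _ ≤ p * ((|D t| + |z t|) ^ (p - 1) * |z t|) := by gcongr
      _ ≤ _ := by gcongr
  · have h := hint (hD.norm.add hz.norm)
    refine Integrable.const_mul ?_ p
    refine h.congr (ae_of_all _ fun t => ?_)
    simp only [Pi.add_apply, Real.norm_eq_abs]
    rw [abs_of_nonneg (by positivity)]
  · refine ae_of_all _ fun t s _ => ?_
    have h1 : HasDerivAt (fun s : ℝ => D t + s * z t) (z t) s := by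
      simpa using ((hasDerivAt_id s).mul_const (z t)).const_add (D t)
    exact (hasDerivAt_abs_rpow (D t + s * z t) hp).comp s h1

lemma abs_rpow_mul_self_eq_sign {p : ℝ} (x : ℝ) :
    |x| ^ (p - 2) * x = |x| ^ (p - 1) * Real.sign x := by
  rcases eq_or_ne x 0 with h | h
  · simp [h]
  · have hx : x = |x| * Real.sign x := by
      rcases lt_or_gt_of_ne h with h | h
      · rw [Real.sign_of_neg h, abs_of_neg h]; ring
      · rw [Real.sign_of_pos h, abs_of_pos h]; ring
    calc |x| ^ (p - 2) * x = |x| ^ (p - 2) * (|x| * Real.sign x) := by rw [← hx]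
      _ = (|x| ^ (p - 2) * |x| ^ (1 : ℝ)) * Real.sign x := by rw [Real.rpow_one]; ring
      _ = _ := by
        rw [← Real.rpow_add (abs_pos.2 h)]; ring_nf

/-- The difference quotients of the `Lᵖ`-norm converge to its directional derivative. -/
theorem tendsto_normQuotient {p : ℝ} (hp : 1 ≤ p) {F G z : ℝ → ℝ} (hF : Measurable F)
    (hG : Measurable G) (hFG : F =ᵐ[volume] G → F = G)
    (hD : MemLp (F - G) (ENNReal.ofReal p) volume) (hz : MemLp z (ENNReal.ofReal p) volume) :
    Tendsto (fun n => normQuotient p F G n z) atTop (𝓝 (normDirDeriv p F G z)) := by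
  rcases hp.eq_or_lt with rfl | hp1
  · exact tendsto_normQuotient_one hF hG hD hz
  have hp0 : 0 < p := by linarith
  by_cases hEq : F = G
  · subst hEq
    rw [normDirDeriv, if_neg hp1.ne', if_pos rfl, ← lpNormReal_eq_integral hp hz]
    refine tendsto_const_nhds.congr' ?_
    filter_upwards [eventually_gt_atTop 0] with n hn
    have hs : 0 < √(n : ℝ) := Real.sqrt_pos.2 (by exact_mod_cast hn)
    rw [normQuotient, sub_self, zero_add, lpNormReal_smul, abs_of_pos (inv_pos.2 hs)]
    have : lpNormReal p 0 = 0 := by simp [lpNormReal]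
    rw [this, sub_zero]
    field_simp
  · have hder := hasDerivAt_integral_abs_rpow hp1 hD hz
    have hN : lpNormReal p (F - G) = (∫ t, |F t - G t| ^ p) ^ (1 / p) :=
      lpNormReal_eq_integral hp hD
    -- The outer power `1/p` is differentiable only away from 0. Positivity holds because equality
    -- almost everywhere would give equality everywhere by `hFG`.
    have hpos : 0 < ∫ t, |F t - G t| ^ p := by
      have hint : Integrable (fun t => |F t - G t| ^ p) volume := by
        have := hD.integrable_norm_rpow (by simpa using hp0) (by simp)
        simpa [ENNReal.toReal_ofReal hp0.le] using this
      refine lt_of_le_of_ne (integral_nonneg fun t => by positivity) fun h => hEq (hFG ?_)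
      have := (integral_eq_zero_iff_of_nonneg (fun t => by positivity) hint).1 h.symm
      filter_upwards [this] with t ht
      have : |F t - G t| = 0 := by
        have h2 : |F t - G t| ^ p = 0 := ht
        rwa [Real.rpow_eq_zero (abs_nonneg _) hp0.ne'] at h2
      exact sub_eq_zero.1 (abs_eq_zero.1 this)
    have hder2 := hder.rpow_const (p := 1 / p) (Or.inl (by simpa using hpos.ne'))
    have hslope := hder2.tendsto_slope
    have hseq : Tendsto (fun n : ℕ => (√(n : ℝ))⁻¹) atTop (𝓝[≠] 0) := by
      refine tendsto_nhdsWithin_iff.2 ⟨tendsto_inv_sqrt_natCast, ?_⟩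
      filter_upwards [eventually_gt_atTop 0] with n hn
      have hs : 0 < √(n : ℝ) := Real.sqrt_pos.2 (by exact_mod_cast hn)
      exact (inv_pos.2 hs).ne'
    have h3 := hslope.comp hseq
    have hvalue : normDirDeriv p F G z = (∫ t, p * |(F - G) t| ^ (p - 2) * (F - G) t * z t) *
        (1 / p) * (∫ t, |(F - G) t + 0 * z t| ^ p) ^ (1 / p - 1) := by
      rw [normDirDeriv, if_neg hp1.ne', if_neg hEq]
      have e1 : lpDist p F G = (∫ t, |F t - G t| ^ p) ^ (1 / p) := hN
      have e2 : (fun t => p * |(F - G) t| ^ (p - 2) * (F - G) t * z t) =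
          fun t => p * (z t * |F t - G t| ^ (p - 1) * Real.sign (F t - G t)) := by
        funext t
        have := abs_rpow_mul_self_eq_sign (p := p) (F t - G t)
        simp only [Pi.sub_apply]
        rw [mul_assoc p, this]; ring
      rw [e1, e2, integral_const_mul, ← Real.rpow_mul hpos.le, ← Real.rpow_neg hpos.le]
      simp only [Pi.sub_apply, zero_mul, add_zero]
      have e3 : -(1 / p * (p - 1)) = 1 / p - 1 := by field_simp; ring
      rw [e3]
      field_simp
    rw [hvalue]
    refine h3.congr fun n => ?_
    simp only [Function.comp, slope, vsub_eq_sub, sub_zero, smul_eq_mul, inv_inv]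
    rw [normQuotient, lpNormReal_eq_integral hp (hD.add (hz.const_smul (√(n : ℝ))⁻¹)),
      lpNormReal_eq_integral hp hD]
    simp

/-- The uniform Lipschitz bound of the difference quotients survives in the limit. -/
lemma abs_normDirDeriv_sub_le {p : ℝ} (hp : 1 ≤ p) {F G z w : ℝ → ℝ} (hF : Measurable F)
    (hG : Measurable G) (hFG : F =ᵐ[volume] G → F = G)
    (hD : MemLp (F - G) (ENNReal.ofReal p) volume)
    (hz : MemLp z (ENNReal.ofReal p) volume) (hw : MemLp w (ENNReal.ofReal p) volume) :
    |normDirDeriv p F G z - normDirDeriv p F G w| ≤ lpNormReal p (z - w) :=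
  le_of_tendsto ((tendsto_normQuotient hp hF hG hFG hD hz).sub
    (tendsto_normQuotient hp hF hG hFG hD hw)).abs
    (Eventually.of_forall fun n => abs_normQuotient_sub_le hp hD hz hw n)


/-! ### Averaging over the cells of a grid -/

/-- The `i`-th cell of the grid of mesh `1 / (j + 1)`. -/
def cell (j : ℕ) (i : ℤ) : Set ℝ := Ioc ((i : ℝ) / (j + 1)) ((i + 1 : ℝ) / (j + 1))

/-- The cells covering `(-(j + 1), j + 1]`. -/
noncomputable def cells (j : ℕ) : Finset ℤ := Finset.Ico (-((j : ℤ) + 1) ^ 2) (((j : ℤ) + 1) ^ 2)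

/-- The average of `f` over a cell. -/
noncomputable def cellAvg (j : ℕ) (i : ℤ) (f : ℝ → ℝ) : ℝ := (j + 1 : ℝ) * ∫ s in cell j i, f s

/-- Cellwise averaging on `(-(j + 1), j + 1]`. -/
noncomputable def averaging (j : ℕ) (f : ℝ → ℝ) (t : ℝ) : ℝ :=
  ∑ i ∈ cells j, cellAvg j i f * (cell j i).indicator (fun _ => (1 : ℝ)) t

/-- The index of the cell containing `t`. -/
noncomputable def cellIndex (j : ℕ) (t : ℝ) : ℤ := ⌈t * (j + 1)⌉ - 1

lemma measurableSet_cell (j : ℕ) (i : ℤ) : MeasurableSet (cell j i) := measurableSet_Ioc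

/-- Cells are open on the left and closed on the right, hence the ceiling minus one in `cellIndex`.
Uniqueness of the index also gives disjointness of the cells. -/
lemma mem_cell_iff {j : ℕ} {i : ℤ} {t : ℝ} : t ∈ cell j i ↔ cellIndex j t = i := by
  have hj : (0 : ℝ) < j + 1 := by positivity
  rw [cellIndex, sub_eq_iff_eq_add, Int.ceil_eq_iff, cell, mem_Ioc, div_lt_iff₀ hj, le_div_iff₀ hj]
  push_cast
  rw [add_sub_cancel_right]

lemma mem_cell_cellIndex (j : ℕ) (t : ℝ) : t ∈ cell j (cellIndex j t) := mem_cell_iff.2 rfl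

lemma cellIndex_mem_cells {j : ℕ} {t : ℝ} :
    cellIndex j t ∈ cells j ↔ -((j : ℝ) + 1) < t ∧ t ≤ (j : ℝ) + 1 := by
  have hj : (0 : ℝ) < j + 1 := by positivity
  rw [cells, Finset.mem_Ico, cellIndex, le_sub_iff_add_le, Int.add_one_le_iff, Int.lt_ceil,
    sub_lt_iff_lt_add, Int.lt_add_one_iff, Int.ceil_le]
  push_cast
  have e1 : -((j : ℝ) + 1) ^ 2 = (-((j : ℝ) + 1)) * (j + 1) := by ring
  rw [e1, sq, mul_lt_mul_iff_left₀ hj, mul_le_mul_iff_left₀ hj]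

lemma averaging_apply_of_mem {j : ℕ} {i : ℤ} (hi : i ∈ cells j) {t : ℝ} (ht : t ∈ cell j i)
    (f : ℝ → ℝ) : averaging j f t = cellAvg j i f := by
  rw [averaging, Finset.sum_eq_single i]
  · simp [ht]
  · intro k _ hk
    have : t ∉ cell j k := fun h => hk ((mem_cell_iff.1 h).symm.trans (mem_cell_iff.1 ht))
    simp [this]
  · exact fun h => absurd hi h

lemma averaging_apply_of_notMem {j : ℕ} {t : ℝ} (ht : cellIndex j t ∉ cells j) (f : ℝ → ℝ) :
    averaging j f t = 0 := by
  refine Finset.sum_eq_zero fun i hi => ?_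
  have : t ∉ cell j i := fun h => ht (by rwa [mem_cell_iff.1 h])
  simp [this]

lemma volume_cell (j : ℕ) (i : ℤ) : volume (cell j i) = ENNReal.ofReal (1 / (j + 1)) := by
  rw [cell, Real.volume_Ioc]
  congr 1
  ring

lemma volume_cell_ne_top (j : ℕ) (i : ℤ) : volume (cell j i) ≠ ∞ := by
  rw [volume_cell]; exact ENNReal.ofReal_ne_top

lemma measurable_averaging (j : ℕ) (f : ℝ → ℝ) : Measurable (averaging j f) := by
  unfold averaging
  exact Finset.measurable_fun_sum _ fun i _ =>
    (measurable_const.indicator (measurableSet_cell j i)).const_mul _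

lemma integrableOn_cell {p : ℝ} (hp : 1 ≤ p) {f : ℝ → ℝ}
    (hf : MemLp f (ENNReal.ofReal p) volume) (j : ℕ) (i : ℤ) : IntegrableOn f (cell j i) := by
  have : IsFiniteMeasure (volume.restrict (cell j i)) :=
    ⟨by simpa using (volume_cell_ne_top j i).lt_top⟩
  exact (hf.restrict _).integrable (one_le_ofReal hp)

lemma cellAvg_sub {j : ℕ} {i : ℤ} {f g : ℝ → ℝ} (hf : IntegrableOn f (cell j i))
    (hg : IntegrableOn g (cell j i)) : cellAvg j i (f - g) = cellAvg j i f - cellAvg j i g := by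
  simp only [cellAvg, Pi.sub_apply]
  rw [integral_sub hf hg, mul_sub]

lemma averaging_sub {j : ℕ} {f g : ℝ → ℝ} (hf : ∀ i, IntegrableOn f (cell j i))
    (hg : ∀ i, IntegrableOn g (cell j i)) :
    averaging j (f - g) = averaging j f - averaging j g := by
  funext t
  simp only [averaging, Pi.sub_apply]
  rw [← Finset.sum_sub_distrib]
  exact Finset.sum_congr rfl fun i _ => by rw [cellAvg_sub (hf i) (hg i)]; ring

/-- Jensen's inequality: the cell average is an expectation under normalized Lebesgue measure on the
cell, and on a probability space the `L¹`-norm is at most the `Lᵖ`-norm. -/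
lemma enorm_cellAvg_rpow_le {p : ℝ} (hp : 1 ≤ p) {f : ℝ → ℝ} (hf : AEStronglyMeasurable f volume)
    (j : ℕ) (i : ℤ) :
    ‖cellAvg j i f‖ₑ ^ p * volume (cell j i) ≤ ∫⁻ t in cell j i, ‖f t‖ₑ ^ p := by
  have hj : (0 : ℝ) < j + 1 := by positivity
  set c : ℝ≥0∞ := ENNReal.ofReal (j + 1) with hc
  have hcv : c * volume (cell j i) = 1 := by
    rw [volume_cell, hc, ← ENNReal.ofReal_mul hj.le, mul_one_div_cancel hj.ne', ENNReal.ofReal_one]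
  set ν : Measure ℝ := c • volume.restrict (cell j i) with hν
  have hprob : IsProbabilityMeasure ν := ⟨by simp [hν, hcv]⟩
  have havg : cellAvg j i f = ∫ t, f t ∂ν := by
    rw [hν, integral_smul_measure, hc, ENNReal.toReal_ofReal hj.le]
    rfl
  have hfν : AEStronglyMeasurable f ν := (hf.restrict).smul_measure _
  have h1 : ‖cellAvg j i f‖ₑ ≤ eLpNorm f (ENNReal.ofReal p) ν := by
    rw [havg]
    refine (enorm_integral_le_lintegral_enorm f).trans ?_
    rw [← eLpNorm_one_eq_lintegral_enorm]
    exact eLpNorm_le_eLpNorm_of_exponent_le (one_le_ofReal hp) hfν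
  have hp0 : 0 < p := by linarith
  have h2 : ‖cellAvg j i f‖ₑ ^ p ≤ ∫⁻ t, ‖f t‖ₑ ^ p ∂ν := by
    refine (ENNReal.rpow_le_rpow h1 hp0.le).trans ?_
    rw [eLpNorm_eq_lintegral_rpow_enorm_toReal (by simpa using hp0) (by simp),
      ENNReal.toReal_ofReal hp0.le, ← ENNReal.rpow_mul, one_div, inv_mul_cancel₀ hp0.ne',
      ENNReal.rpow_one]
  calc _ ≤ (∫⁻ t, ‖f t‖ₑ ^ p ∂ν) * volume (cell j i) := by gcongr
    _ = (c * volume (cell j i)) * ∫⁻ t in cell j i, ‖f t‖ₑ ^ p := by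
        rw [hν, lintegral_smul_measure, smul_eq_mul]; ring
    _ = _ := by rw [hcv, one_mul]

lemma eLpNorm_rpow_eq {p : ℝ} (hp : 1 ≤ p) (f : ℝ → ℝ) :
    eLpNorm f (ENNReal.ofReal p) volume ^ p = ∫⁻ t, ‖f t‖ₑ ^ p := by
  have hp0 : 0 < p := by linarith
  rw [eLpNorm_eq_lintegral_rpow_enorm_toReal (by simpa using hp0) (by simp),
      ENNReal.toReal_ofReal hp0.le, ← ENNReal.rpow_mul, one_div, inv_mul_cancel₀ hp0.ne',
      ENNReal.rpow_one]

/-- Averaging is a contraction of `Lᵖ`. -/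
lemma eLpNorm_averaging_le {p : ℝ} (hp : 1 ≤ p) {f : ℝ → ℝ}
    (hf : AEStronglyMeasurable f volume) (j : ℕ) :
    eLpNorm (averaging j f) (ENNReal.ofReal p) volume ≤ eLpNorm f (ENNReal.ofReal p) volume := by
  have hp0 : 0 < p := by linarith
  rw [← ENNReal.rpow_le_rpow_iff hp0, eLpNorm_rpow_eq hp, eLpNorm_rpow_eq hp]
  have hpt : ∀ t, ‖averaging j f t‖ₑ ^ p ≤
      ∑ i ∈ cells j, (cell j i).indicator (fun _ => ‖cellAvg j i f‖ₑ ^ p) t := by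
    intro t
    by_cases ht : cellIndex j t ∈ cells j
    · rw [averaging_apply_of_mem ht (mem_cell_cellIndex j t)]
      refine le_trans ?_ (Finset.single_le_sum (fun i _ => zero_le) ht)
      rw [indicator_of_mem (mem_cell_cellIndex j t)]
    · rw [averaging_apply_of_notMem ht]
      simp [hp0]
  calc _ ≤ ∫⁻ t, ∑ i ∈ cells j, (cell j i).indicator (fun _ => ‖cellAvg j i f‖ₑ ^ p) t :=
        lintegral_mono hpt
    _ = ∑ i ∈ cells j, ‖cellAvg j i f‖ₑ ^ p * volume (cell j i) := by
        rw [lintegral_finsetSum _ fun i _ => measurable_const.indicator (measurableSet_cell j i)]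
        refine Finset.sum_congr rfl fun i _ => ?_
        rw [lintegral_indicator (measurableSet_cell j i), setLIntegral_const]
    _ ≤ ∑ i ∈ cells j, ∫⁻ t in cell j i, ‖f t‖ₑ ^ p :=
        Finset.sum_le_sum fun i _ => enorm_cellAvg_rpow_le hp hf j i
    _ = ∫⁻ t in ⋃ i ∈ cells j, cell j i, ‖f t‖ₑ ^ p := by
        refine (lintegral_biUnion_finset ?_ (fun i _ => measurableSet_cell j i) _).symm
        intro i _ k _ hik
        refine Set.disjoint_left.2 fun t hi hk => hik ?_
        exact (mem_cell_iff.1 hi).symm.trans (mem_cell_iff.1 hk)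
    _ ≤ _ := setLIntegral_le_lintegral _ _

lemma abs_sub_le_of_mem_cell {j : ℕ} {i : ℤ} {s t : ℝ} (hs : s ∈ cell j i) (ht : t ∈ cell j i) :
    |s - t| ≤ 1 / (j + 1) := by
  have : ((i + 1 : ℝ) / (j + 1)) = (i : ℝ) / (j + 1) + 1 / (j + 1) := by ring
  rw [cell, mem_Ioc, this] at hs ht
  rw [abs_le]
  constructor <;> linarith [hs.1, hs.2, ht.1, ht.2]

lemma abs_cellAvg_sub_le {j : ℕ} {i : ℤ} {f : ℝ → ℝ} (hf : IntegrableOn f (cell j i)) {c ε : ℝ}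
    (h : ∀ s ∈ cell j i, |f s - c| ≤ ε) : |cellAvg j i f - c| ≤ ε := by
  have hj : (0 : ℝ) < j + 1 := by positivity
  have hvol : (volume.restrict (cell j i)).real univ = 1 / (j + 1) := by
    rw [measureReal_def, Measure.restrict_apply_univ, volume_cell, ENNReal.toReal_ofReal]
    positivity
  have hvol' : volume.real (cell j i) = 1 / (j + 1) := by
    rw [measureReal_def, volume_cell, ENNReal.toReal_ofReal]
    positivity
  have : IsFiniteMeasure (volume.restrict (cell j i)) :=
    ⟨by simpa using (volume_cell_ne_top j i).lt_top⟩
  have e : cellAvg j i f - c = (j + 1 : ℝ) * ∫ s in cell j i, (f s - c) := by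
    rw [integral_sub hf (integrable_const c), integral_const, hvol, cellAvg, smul_eq_mul]
    field_simp
  have h2 := norm_setIntegral_le_of_norm_le_const (f := fun s => f s - c)
    (volume_cell_ne_top j i).lt_top h
  rw [hvol', Real.norm_eq_abs] at h2
  rw [e, abs_mul, abs_of_pos hj]
  calc _ ≤ (j + 1 : ℝ) * (ε * (1 / (j + 1))) := by gcongr
    _ = ε := by field_simp

/-- Uniform continuity makes the error at most `ε` everywhere once the mesh is small. As the mesh is
at most 1, the error lives on the support enlarged by 1, a set of finite measure. -/
lemma tendsto_averaging_of_continuous {p : ℝ} (hp : 1 ≤ p) {g : ℝ → ℝ} (hg : Continuous g)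
    (hgc : HasCompactSupport g) :
    Tendsto (fun j => eLpNorm (averaging j g - g) (ENNReal.ofReal p) volume) atTop (𝓝 0) := by
  have hp0 : 0 < p := by linarith
  obtain ⟨R, hR⟩ := hgc.isCompact.isBounded.subset_closedBall (0 : ℝ)
  have hgz : ∀ t, R < |t| → g t = 0 := by
    intro t ht
    refine image_eq_zero_of_notMem_tsupport fun h => ?_
    have := hR h
    rw [mem_closedBall_zero_iff, Real.norm_eq_abs] at this
    linarith
  have huc := hgc.uniformContinuous_of_continuous hg
  have hloc : ∀ j i, IntegrableOn g (cell j i) := fun j i =>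
    (hg.integrable_of_hasCompactSupport hgc).integrableOn
  have hbd : ∀ ε : ℝ, 0 < ε → ∀ᶠ j : ℕ in atTop, ∀ t,
      ‖(averaging j g - g) t‖ ≤ ‖(Icc (-R - 1) (R + 1)).indicator (fun _ => ε) t‖ := by
    intro ε hε
    obtain ⟨δ, hδ, hδ'⟩ := Metric.uniformContinuous_iff.1 huc ε hε
    have h1 : ∀ᶠ j : ℕ in atTop, 1 / ((j : ℝ) + 1) < δ :=
      tendsto_one_div_add_atTop_nhds_zero_nat.eventually (gt_mem_nhds hδ)
    obtain ⟨m, hm⟩ := exists_nat_gt R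
    filter_upwards [h1, eventually_ge_atTop m] with j hj hjm t
    have hjR : R < (j : ℝ) + 1 := by
      have : (m : ℝ) ≤ j := by exact_mod_cast hjm
      linarith
    have hmesh : 1 / ((j : ℝ) + 1) ≤ 1 := by
      rw [div_le_one (by positivity)]
      have : (0 : ℝ) ≤ j := by positivity
      linarith
    rw [Pi.sub_apply, Real.norm_eq_abs]
    by_cases ht : cellIndex j t ∈ cells j
    · rw [averaging_apply_of_mem ht (mem_cell_cellIndex j t)]
      by_cases htI : t ∈ Icc (-R - 1) (R + 1)
      · rw [indicator_of_mem htI, Real.norm_eq_abs, abs_of_pos hε]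
        refine abs_cellAvg_sub_le (hloc _ _) fun s hs => ?_
        have h3 := abs_sub_le_of_mem_cell hs (mem_cell_cellIndex j t)
        have := hδ' (a := s) (b := t) (by rw [Real.dist_eq]; linarith)
        rw [Real.dist_eq] at this
        exact this.le
      · rw [indicator_of_notMem htI, norm_zero]
        have htR : R + 1 < |t| := by
          by_contra hcon
          push Not at hcon
          have := abs_le.1 hcon
          exact htI ⟨by linarith [this.1], this.2⟩
        refine abs_cellAvg_sub_le (hloc _ _) fun s hs => ?_
        have h3 := abs_sub_le_of_mem_cell hs (mem_cell_cellIndex j t)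
        have h4 : R < |s| := by
          have := abs_sub_abs_le_abs_sub t s
          rw [abs_sub_comm t s] at this
          linarith
        rw [hgz t (by linarith), hgz s h4]
        simp
    · rw [averaging_apply_of_notMem ht]
      have : R < |t| := by
        rw [cellIndex_mem_cells] at ht
        by_contra hcon
        push Not at hcon
        have := abs_le.1 hcon
        exact ht ⟨by linarith [this.1], by linarith [this.2]⟩
      rw [hgz t this]
      simp
  set V : ℝ≥0∞ := volume (Icc (-R - 1) (R + 1)) ^ (1 / p) with hV
  have hVtop : V ≠ ∞ := by
    refine ENNReal.rpow_ne_top_of_nonneg (by positivity) ?_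
    rw [Real.volume_Icc]; exact ENNReal.ofReal_ne_top
  have hest : ∀ ε : ℝ, 0 < ε → ∀ᶠ j : ℕ in atTop,
      eLpNorm (averaging j g - g) (ENNReal.ofReal p) volume ≤ ENNReal.ofReal ε * V := by
    intro ε hε
    filter_upwards [hbd ε hε] with j hj
    refine (eLpNorm_mono hj).trans ?_
    rw [eLpNorm_indicator_const measurableSet_Icc (by simpa using hp0) (by simp),
      ENNReal.toReal_ofReal hp0.le, Real.enorm_eq_ofReal hε.le]
  rw [ENNReal.tendsto_nhds_zero]
  intro η hη
  rcases eq_or_ne η ∞ with rfl | hηt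
  · exact Eventually.of_forall fun _ => le_top
  have hη0 : 0 < η.toReal := ENNReal.toReal_pos hη.ne' hηt
  have hpos : 0 < η.toReal / (V.toReal + 1) := by positivity
  filter_upwards [hest _ hpos] with j hj
  refine hj.trans ?_
  have e : ENNReal.ofReal (η.toReal / (V.toReal + 1)) * V
      = ENNReal.ofReal (η.toReal / (V.toReal + 1) * V.toReal) := by
    rw [ENNReal.ofReal_mul hpos.le, ENNReal.ofReal_toReal hVtop]
  rw [e]
  refine ENNReal.ofReal_le_of_le_toReal ?_
  rw [div_mul_eq_mul_div, div_le_iff₀ (by positivity)]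
  nlinarith [ENNReal.toReal_nonneg (a := V)]

/-- The averages of `f ∈ Lᵖ` converge to `f` in `Lᵖ`. -/
theorem tendsto_averaging {p : ℝ} (hp : 1 ≤ p) {f : ℝ → ℝ}
    (hf : MemLp f (ENNReal.ofReal p) volume) :
    Tendsto (fun j => eLpNorm (averaging j f - f) (ENNReal.ofReal p) volume) atTop (𝓝 0) := by
  rw [ENNReal.tendsto_nhds_zero]
  intro η hη
  have hη3 : η / 3 ≠ 0 := (ENNReal.div_pos hη.ne' (by simp)).ne'
  obtain ⟨g, hgc, hfg, hgcont, hgLp⟩ :=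
    hf.exists_hasCompactSupport_eLpNorm_sub_le (by simp) hη3
  filter_upwards [ENNReal.tendsto_nhds_zero.1 (tendsto_averaging_of_continuous hp hgcont hgc)
    (η / 3) (pos_iff_ne_zero.2 hη3)] with j hj
  -- An `ε/3` argument: contractivity handles `f - g`, uniform continuity handles `g`, and density
  -- handles `g - f`.
  have e : averaging j f - f = (averaging j (f - g) + (averaging j g - g)) + (g - f) := by
    rw [averaging_sub (fun i => integrableOn_cell hp hf j i)
      (fun i => integrableOn_cell hp hgLp j i)]
    abel
  have hm1 : AEStronglyMeasurable (averaging j (f - g)) volume :=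
    (measurable_averaging j _).aestronglyMeasurable
  have hm2 : AEStronglyMeasurable (averaging j g - g) volume :=
    (measurable_averaging j _).aestronglyMeasurable.sub hgLp.1
  rw [e]
  refine (eLpNorm_add_le (hm1.add hm2) (hgLp.1.sub hf.1) (one_le_ofReal hp)).trans ?_
  refine (add_le_add_left (eLpNorm_add_le hm1 hm2 (one_le_ofReal hp)) _).trans ?_
  have h1 := (eLpNorm_averaging_le hp (hf.1.sub hgLp.1) j).trans hfg
  have h3 : eLpNorm (g - f) (ENNReal.ofReal p) volume ≤ η / 3 := by
    rw [eLpNorm_sub_comm]; exact hfg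
  calc _ ≤ η / 3 + η / 3 + η / 3 := by gcongr
    _ = η := ENNReal.add_thirds η

lemma memLp_averaging {p : ℝ} (j : ℕ) (f : ℝ → ℝ) :
    MemLp (averaging j f) (ENNReal.ofReal p) volume := by
  unfold averaging
  refine memLp_finsetSum _ fun i _ => ?_
  exact (memLp_indicator_const _ (measurableSet_cell j i) (1 : ℝ)
    (Or.inr (volume_cell_ne_top j i))).const_mul _


/-! ### Square-integrable processes integrated against weights -/

section Moments

variable {Ω : Type*} [MeasurableSpace Ω] {P : Measure Ω} [IsProbabilityMeasure P]

lemma ae_ae_of_ae_prod_symm {p : Ω × ℝ → Prop} (h : ∀ᵐ z ∂P.prod (volume : Measure ℝ), p z) :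
    ∀ᵐ t : ℝ, ∀ᵐ ω ∂P, p (ω, t) := by
  have h2 := (Measure.measurePreserving_swap (μ := (volume : Measure ℝ))
    (ν := P)).quasiMeasurePreserving.ae h
  exact Measure.ae_ae_of_ae_prod h2

lemma eLpNorm_two_eq (f : Ω → ℝ) : eLpNorm f 2 P = (∫⁻ ω, ‖f ω‖ₑ ^ (2 : ℝ) ∂P) ^ (1 / 2 : ℝ) := by
  rw [eLpNorm_eq_lintegral_rpow_enorm_toReal (by simp) (by simp)]
  simp

lemma lintegral_mul_le_two {f g : Ω → ℝ≥0∞} (hf : AEMeasurable f P) (hg : AEMeasurable g P) :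
    ∫⁻ ω, f ω * g ω ∂P ≤ (∫⁻ ω, f ω ^ (2 : ℝ) ∂P) ^ (1 / 2 : ℝ) *
      (∫⁻ ω, g ω ^ (2 : ℝ) ∂P) ^ (1 / 2 : ℝ) :=
  ENNReal.lintegral_mul_le_Lp_mul_Lq P Real.HolderConjugate.two_two hf hg

/-- Minkowski's integral inequality in `L²`. -/
lemma lintegral_sq_lintegral_le {a : Ω × ℝ → ℝ≥0∞} (ha : Measurable a) :
    ∫⁻ ω, (∫⁻ t, a (ω, t)) ^ (2 : ℝ) ∂P ≤
      (∫⁻ t, (∫⁻ ω, a (ω, t) ^ (2 : ℝ) ∂P) ^ (1 / 2 : ℝ)) ^ (2 : ℝ) := by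
  set n : ℝ → ℝ≥0∞ := fun t => (∫⁻ ω, a (ω, t) ^ (2 : ℝ) ∂P) ^ (1 / 2 : ℝ) with hn
  have hn_meas : Measurable n :=
    (Measurable.lintegral_prod_left' (ha.pow_const (2 : ℝ))).pow_const _
  have hat : ∀ t, Measurable fun ω => a (ω, t) := fun t => ha.comp measurable_prodMk_right
  have hω : ∀ ω, Measurable fun t => a (ω, t) := fun ω => ha.comp measurable_prodMk_left
  have hA : Measurable fun ω => ∫⁻ t, a (ω, t) := Measurable.lintegral_prod_right' ha
  -- The square is expanded into a double integral over `(s, t)`, so that Cauchy–Schwarz in `ω` can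
  -- be applied for each pair.
  calc ∫⁻ ω, (∫⁻ t, a (ω, t)) ^ (2 : ℝ) ∂P
      = ∫⁻ ω, (∫⁻ s, a (ω, s) * ∫⁻ t, a (ω, t)) ∂P := by
        refine lintegral_congr fun ω => ?_
        rw [lintegral_mul_const _ (hω ω), ENNReal.rpow_two, sq]
    _ = ∫⁻ s, ∫⁻ ω, a (ω, s) * (∫⁻ t, a (ω, t)) ∂P := by
        refine lintegral_lintegral_swap ?_
        exact (ha.mul (hA.comp measurable_fst)).aemeasurable
    _ = ∫⁻ s, ∫⁻ t, ∫⁻ ω, a (ω, s) * a (ω, t) ∂P := by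
        refine lintegral_congr fun s => ?_
        rw [← lintegral_lintegral_swap]
        · refine lintegral_congr fun ω => ?_
          rw [lintegral_const_mul _ (hω ω)]
        · exact (((hat s).comp measurable_fst).mul ha).aemeasurable
    _ ≤ ∫⁻ s, ∫⁻ t, n s * n t := by
        refine lintegral_mono fun s => lintegral_mono fun t => ?_
        exact lintegral_mul_le_two (hat s).aemeasurable (hat t).aemeasurable
    _ = (∫⁻ t, n t) ^ (2 : ℝ) := by
        simp_rw [lintegral_const_mul _ hn_meas]
        rw [lintegral_mul_const _ hn_meas, ENNReal.rpow_two, sq]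

variable {Z : ℝ → Ω → ℝ} {f : ℝ → ℝ}

lemma aemeasurable_process_mul (hZ : AEMeasurable (fun z : Ω × ℝ => Z z.2 z.1) (P.prod volume))
    (hf : AEMeasurable f volume) :
    AEMeasurable (fun z : Ω × ℝ => Z z.2 z.1 * f z.2) (P.prod volume) :=
  hZ.mul hf.comp_snd

/-- The integral of a process against a function is square integrable. -/
lemma memLp_two_integral (hZ : AEMeasurable (fun z : Ω × ℝ => Z z.2 z.1) (P.prod volume))
    (hf : AEMeasurable f volume)
    (hfin : ∫⁻ t, eLpNorm (Z t) 2 P * ‖f t‖ₑ ≠ ∞) :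
    MemLp (fun ω => ∫ t, Z t ω * f t) 2 P := by
  have hm := aemeasurable_process_mul hZ hf
  refine ⟨hm.aestronglyMeasurable.integral_prod_right', ?_⟩
  set b : Ω × ℝ → ℝ≥0∞ := fun z => ‖Z z.2 z.1 * f z.2‖ₑ with hb
  have hbm : AEMeasurable b (P.prod volume) := hm.enorm
  -- Joint measurability holds only up to null sets. A measurable version agrees with `b` on almost
  -- every section in either direction, which is all that the two integrals see.
  set a := hbm.mk b with ha
  have h1 : ∀ᵐ ω ∂P, ∀ᵐ t : ℝ, b (ω, t) = a (ω, t) := Measure.ae_ae_of_ae_prod hbm.ae_eq_mk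
  have h2 : ∀ᵐ t : ℝ, ∀ᵐ ω ∂P, b (ω, t) = a (ω, t) := ae_ae_of_ae_prod_symm hbm.ae_eq_mk
  rw [eLpNorm_two_eq]
  refine ENNReal.rpow_lt_top_of_nonneg (by norm_num) (ne_of_lt ?_)
  calc ∫⁻ ω, ‖∫ t, Z t ω * f t‖ₑ ^ (2 : ℝ) ∂P
      ≤ ∫⁻ ω, (∫⁻ t, a (ω, t)) ^ (2 : ℝ) ∂P := by
        refine lintegral_mono_ae ?_
        filter_upwards [h1] with ω hω
        refine ENNReal.rpow_le_rpow ?_ (by norm_num)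
        refine (enorm_integral_le_lintegral_enorm _).trans (lintegral_congr_ae hω).le
    _ ≤ (∫⁻ t, (∫⁻ ω, a (ω, t) ^ (2 : ℝ) ∂P) ^ (1 / 2 : ℝ)) ^ (2 : ℝ) :=
        lintegral_sq_lintegral_le hbm.measurable_mk
    _ = (∫⁻ t, eLpNorm (Z t) 2 P * ‖f t‖ₑ) ^ (2 : ℝ) := by
        congr 1
        refine lintegral_congr_ae ?_
        filter_upwards [h2] with t ht
        rw [lintegral_congr_ae (g := fun ω => b (ω, t) ^ (2 : ℝ))
          (by filter_upwards [ht] with ω hω; rw [hω]), ← eLpNorm_two_eq (P := P)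
          (f := fun ω => Z t ω * f t)]
        have : (fun ω => Z t ω * f t) = f t • Z t := by
          funext ω; simp [mul_comm]
        rw [this, eLpNorm_const_smul, mul_comm]
    _ < ∞ := ENNReal.rpow_lt_top_of_nonneg (by norm_num) hfin

/-- Tonelli together with Cauchy–Schwarz in `ω`; this is the integrability that Fubini requires
below. -/
lemma integrable_mul_process_mul
    (hZ : AEMeasurable (fun z : Ω × ℝ => Z z.2 z.1) (P.prod volume))
    (hZ2 : ∀ t, AEMeasurable (Z t) P) (hf : AEMeasurable f volume)
    (hfin : ∫⁻ t, eLpNorm (Z t) 2 P * ‖f t‖ₑ ≠ ∞) {R : Ω → ℝ} (hR : MemLp R 2 P) :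
    Integrable (fun z : Ω × ℝ => R z.1 * (Z z.2 z.1 * f z.2)) (P.prod volume) := by
  have hm : AEMeasurable (fun z : Ω × ℝ => R z.1 * (Z z.2 z.1 * f z.2)) (P.prod volume) :=
    (hR.1.aemeasurable.comp_fst (ν := (volume : Measure ℝ))).mul
    (aemeasurable_process_mul hZ hf)
  refine ⟨hm.aestronglyMeasurable, ?_⟩
  rw [hasFiniteIntegral_iff_enorm, lintegral_prod_symm _ hm.enorm]
  refine lt_of_le_of_lt (lintegral_mono (g := fun t => eLpNorm R 2 P *
    (eLpNorm (Z t) 2 P * ‖f t‖ₑ)) fun t => ?_) ?_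
  · calc ∫⁻ ω, ‖R ω * (Z t ω * f t)‖ₑ ∂P = (∫⁻ ω, ‖R ω‖ₑ * ‖Z t ω‖ₑ ∂P) * ‖f t‖ₑ := by
          rw [← lintegral_mul_const' _ _ enorm_ne_top]
          refine lintegral_congr fun ω => ?_
          rw [enorm_mul, enorm_mul, mul_assoc]
      _ ≤ (eLpNorm R 2 P * eLpNorm (Z t) 2 P) * ‖f t‖ₑ := by
          gcongr
          rw [eLpNorm_two_eq, eLpNorm_two_eq]
          exact lintegral_mul_le_two hR.1.aemeasurable.enorm (hZ2 t).enorm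
      _ = _ := by rw [mul_assoc]
  · rw [lintegral_const_mul' _ _ hR.2.ne]
    exact ENNReal.mul_lt_top hR.2 hfin.lt_top

lemma integral_mul_integral_process
    (hZ : AEMeasurable (fun z : Ω × ℝ => Z z.2 z.1) (P.prod volume))
    (hZ2 : ∀ t, AEMeasurable (Z t) P) (hf : AEMeasurable f volume)
    (hfin : ∫⁻ t, eLpNorm (Z t) 2 P * ‖f t‖ₑ ≠ ∞) {R : Ω → ℝ} (hR : MemLp R 2 P) :
    ∫ ω, R ω * (∫ t, Z t ω * f t) ∂P = ∫ t, (∫ ω, R ω * Z t ω ∂P) * f t := by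
  have hint := integrable_mul_process_mul hZ hZ2 hf hfin hR
  have h := integral_integral_swap (μ := P) (ν := volume)
    (f := fun ω t => R ω * (Z t ω * f t)) hint
  calc _ = ∫ ω, (∫ t, R ω * (Z t ω * f t)) ∂P := by simp_rw [integral_const_mul]
    _ = ∫ t, ∫ ω, R ω * (Z t ω * f t) ∂P := h
    _ = _ := by simp_rw [← mul_assoc, integral_mul_const]

/-- The second moment of the integral of a process. -/
lemma integral_sq_integral_process
    (hZ : AEMeasurable (fun z : Ω × ℝ => Z z.2 z.1) (P.prod volume))
    (hZ2 : ∀ t, MemLp (Z t) 2 P) (hf : AEMeasurable f volume)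
    (hfin : ∫⁻ t, eLpNorm (Z t) 2 P * ‖f t‖ₑ ≠ ∞) {K : ℝ → ℝ → ℝ}
    (hK : ∀ s t, ∫ ω, Z s ω * Z t ω ∂P = K s t) :
    ∫ ω, (∫ t, Z t ω * f t) ^ 2 ∂P = ∫ t, (∫ s, K t s * f s) * f t := by
  have hI := memLp_two_integral hZ hf hfin
  have hZ2' := fun t => (hZ2 t).1.aemeasurable
  -- The exchange identity is used twice, first with the integral itself as the test variable and
  -- then with `Z t`.
  have h1 := integral_mul_integral_process hZ hZ2' hf hfin hI
  simp_rw [sq]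
  rw [h1]
  refine integral_congr_ae (ae_of_all _ fun t => ?_)
  have h2 := integral_mul_integral_process hZ hZ2' hf hfin (hZ2 t)
  simp only
  rw [← integral_congr_ae (ae_of_all _ fun ω => mul_comm (Z t ω) (∫ s, Z s ω * f s)), h2]
  simp_rw [hK]

end Moments

/-! ### Gaussian variables in `L²` and Gaussian processes -/

section Gaussian

variable {Ω : Type*} [MeasurableSpace Ω] {P : Measure Ω} [IsProbabilityMeasure P]

lemma variance_eq_integral_sq {u : Ω → ℝ} (hu : AEMeasurable u P) (h0 : ∫ ω, u ω ∂P = 0) :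
    Var[u; P] = ∫ ω, u ω ^ 2 ∂P := by
  rw [variance_eq_integral hu, h0]; simp

lemma hasLaw_gaussianReal_of_hasGaussianLaw {u : Ω → ℝ} (hu : HasGaussianLaw u P)
    (h0 : ∫ ω, u ω ∂P = 0) : HasLaw u (gaussianReal 0 (∫ ω, u ω ^ 2 ∂P).toNNReal) P := by
  refine ⟨hu.aemeasurable, ?_⟩
  rw [hu.map_eq_gaussianReal, h0, variance_eq_integral_sq hu.aemeasurable h0]

/-- The set of centered Gaussian random variables is closed in `L²`. -/
lemma hasLaw_gaussianReal_of_tendsto {u : ℕ → Lp ℝ 2 P} {w : Lp ℝ 2 P}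
    (hu : ∀ n, HasLaw (u n) (gaussianReal 0 (‖u n‖ ^ 2).toNNReal) P)
    (hw : Tendsto u atTop (𝓝 w)) : HasLaw w (gaussianReal 0 (‖w‖ ^ 2).toNNReal) P := by
  have hwm : AEMeasurable w P := (Lp.aestronglyMeasurable w).aemeasurable
  -- Convergence in `L²` implies convergence in distribution, and the variances `‖u n‖²` converge,
  -- so the characteristic functions converge to that of a centered normal law.
  have hd := (tendstoInMeasure_of_tendsto_Lp hw).tendstoInDistribution
    (fun n => (hu n).aemeasurable)
  have hc := ProbabilityMeasure.tendsto_iff_tendsto_charFun.1 hd.tendsto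
  refine ⟨hwm, ?_⟩
  have : IsProbabilityMeasure (P.map w) := Measure.isProbabilityMeasure_map hwm
  refine Measure.ext_of_charFun ?_
  funext t
  have h1 := hc t
  simp only [ProbabilityMeasure.coe_mk] at h1
  refine tendsto_nhds_unique h1 ?_
  have h2 : ∀ n, charFun (P.map (u n)) t = Complex.exp (-((‖u n‖ ^ 2 : ℝ) : ℂ) * t ^ 2 / 2) := by
    intro n
    rw [(hu n).map_eq, charFun_gaussianReal]
    congr 1
    simp only [Complex.ofReal_zero, mul_zero, zero_mul, zero_sub]
    have : (((‖u n‖ ^ 2).toNNReal : ℝ) : ℂ) = ((‖u n‖ ^ 2 : ℝ) : ℂ) := by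
      rw [Real.coe_toNNReal _ (by positivity)]
    rw [this]; ring
  simp_rw [h2]
  rw [charFun_gaussianReal]
  have h3 : Complex.exp (t * ((0 : ℝ) : ℂ) * Complex.I - ((‖w‖ ^ 2).toNNReal : ℝ) * t ^ 2 / 2)
      = Complex.exp (-((‖w‖ ^ 2 : ℝ) : ℂ) * t ^ 2 / 2) := by
    congr 1
    rw [Real.coe_toNNReal _ (by positivity)]
    simp only [Complex.ofReal_zero, mul_zero, zero_mul, zero_sub]
    ring
  rw [h3]
  refine (Complex.continuous_exp.tendsto _).comp ?_
  refine Tendsto.div_const (Tendsto.mul_const _ (Tendsto.neg ?_)) _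
  exact (Complex.continuous_ofReal.tendsto _).comp (hw.norm.pow 2)

lemma norm_sq_toLp {u : Ω → ℝ} (hu : MemLp u 2 P) : ‖hu.toLp u‖ ^ 2 = ∫ ω, u ω ^ 2 ∂P := by
  rw [← real_inner_self_eq_norm_sq, L2.inner_def]
  refine integral_congr_ae ?_
  filter_upwards [hu.coeFn_toLp] with ω hω
  rw [hω]
  simp [sq]

lemma norm_sq_Lp (u : Lp ℝ 2 P) : ‖u‖ ^ 2 = ∫ ω, u ω ^ 2 ∂P := by
  have := norm_sq_toLp (Lp.memLp u)
  rwa [Lp.toLp_coeFn] at this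

variable {K : ℝ → ℝ → ℝ} {𝔾 : ℝ → Ω → ℝ}

lemma IsCenteredGaussian.memLp_two (h : IsCenteredGaussian P K 𝔾) (t : ℝ) : MemLp (𝔾 t) 2 P :=
  (h.isGaussian.hasGaussianLaw_eval t).memLp_two

lemma IsCenteredGaussian.integral_mul (h : IsCenteredGaussian P K 𝔾) (s t : ℝ) :
    ∫ ω, 𝔾 s ω * 𝔾 t ω ∂P = K s t := by
  rw [← h.cov_eq, covariance, h.centered, h.centered]
  simp

lemma IsCenteredGaussian.nonneg (h : IsCenteredGaussian P K 𝔾) (t : ℝ) : 0 ≤ K t t := by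
  rw [← h.integral_mul]
  exact integral_nonneg fun ω => mul_self_nonneg _

lemma IsCenteredGaussian.eLpNorm_two (h : IsCenteredGaussian P K 𝔾) (t : ℝ) :
    eLpNorm (𝔾 t) 2 P = ENNReal.ofReal √(K t t) := by
  have hm := h.memLp_two t
  rw [← ENNReal.ofReal_toReal hm.2.ne, ← Lp.norm_toLp _ hm]
  congr 1
  refine (Real.sqrt_eq_iff_mul_self_eq (h.nonneg t) (norm_nonneg _)).2 ?_ |>.symm
  rw [← sq, norm_sq_toLp hm, ← h.integral_mul]
  simp_rw [sq]

lemma IsCenteredGaussian.hasLaw_eval (h : IsCenteredGaussian P K 𝔾) (t : ℝ) :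
    HasLaw (𝔾 t) (gaussianReal 0 (K t t).toNNReal) P := by
  have := hasLaw_gaussianReal_of_hasGaussianLaw (h.isGaussian.hasGaussianLaw_eval t) (h.centered t)
  simp_rw [sq] at this
  rwa [h.integral_mul] at this

/-- The variance is recorded as a squared `L²`-norm so that the statement passes to limits of
elements of the span. -/
lemma IsCenteredGaussian.hasLaw_of_mem_span (h : IsCenteredGaussian P K 𝔾) {u : Lp ℝ 2 P}
    (hu : u ∈ Submodule.span ℝ (range fun t => (h.memLp_two t).toLp (𝔾 t))) :
    HasLaw u (gaussianReal 0 (‖u‖ ^ 2).toNNReal) P := by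
  obtain ⟨c, rfl⟩ := Finsupp.mem_span_range_iff_exists_finsupp.1 hu
  set u := c.sum fun t a => a • (h.memLp_two t).toLp (𝔾 t) with hu'
  have hae : (fun ω => ∑ t ∈ c.support, c t * 𝔾 t ω) =ᵐ[P] u := by
    have h1 := Lp.coeFn_finsetSum c.support fun t => c t • (h.memLp_two t).toLp (𝔾 t)
    have h2 : ∀ᵐ ω ∂P, ∀ t ∈ c.support,
        (c t • (h.memLp_two t).toLp (𝔾 t) : Lp ℝ 2 P) ω = c t * 𝔾 t ω := by
      rw [Filter.eventually_all_finset]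
      intro t _
      filter_upwards [Lp.coeFn_smul (c t) ((h.memLp_two t).toLp (𝔾 t)),
        (h.memLp_two t).coeFn_toLp] with ω h3 h4
      rw [h3, Pi.smul_apply, h4, smul_eq_mul]
    filter_upwards [h1, h2] with ω h3 h4
    rw [hu', Finsupp.sum, h3, Finset.sum_apply]
    exact Finset.sum_congr rfl fun t ht => (h4 t ht).symm
  have hg : HasGaussianLaw u P :=
    ((h.isGaussian.smul (fun t => c t)).hasGaussianLaw_fun_sum (I := c.support)).congr hae
  have h0 : ∫ ω, u ω ∂P = 0 := by
    rw [← integral_congr_ae hae, integral_finsetSum]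
    · simp_rw [integral_const_mul, h.centered, mul_zero, Finset.sum_const_zero]
    · intro t _
      exact ((h.memLp_two t).integrable one_le_two).const_mul _
  have := hasLaw_gaussianReal_of_hasGaussianLaw hg h0
  rwa [← norm_sq_Lp] at this

lemma IsCenteredGaussian.lintegral_ne_top (h : IsCenteredGaussian P K 𝔾) {f : ℝ → ℝ}
    (hfin : Integrable (fun t => √(K t t) * f t)) :
    ∫⁻ t, eLpNorm (𝔾 t) 2 P * ‖f t‖ₑ ≠ ∞ := by
  have := hfin.2
  rw [hasFiniteIntegral_iff_enorm] at this
  refine ne_of_lt (lt_of_le_of_lt (le_of_eq (lintegral_congr fun t => ?_)) this)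
  rw [h.eLpNorm_two, enorm_mul, Real.enorm_eq_ofReal (Real.sqrt_nonneg _)]

/-- Integrals of a Gaussian process are Gaussian. -/
theorem IsCenteredGaussian.hasLaw_integral (h : IsCenteredGaussian P K 𝔾) {f : ℝ → ℝ}
    (hf : AEMeasurable f volume) (hfin : Integrable (fun t => √(K t t) * f t)) :
    HasLaw (fun ω => ∫ t, 𝔾 t ω * f t)
      (gaussianReal 0 (∫ t, (∫ s, K t s * f s) * f t).toNNReal) P := by
  have hfin' := h.lintegral_ne_top hfin
  have hm := fun t => (h.memLp_two t).1.aemeasurable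
  have hI := memLp_two_integral h.aemeasurable hf hfin'
  set S := Submodule.span ℝ (range fun t => (h.memLp_two t).toLp (𝔾 t)) with hS
  have hmem : hI.toLp _ ∈ S.topologicalClosure := by
    -- The closure of a subspace is its double orthogonal complement: a variable orthogonal to every
    -- `𝔾 t` is orthogonal to the integral by Fubini. No Riemann sums or path regularity are needed.
    rw [← Submodule.orthogonal_orthogonal_eq_closure, Submodule.mem_orthogonal]
    intro R hR
    rw [L2.inner_def]
    have hR0 : ∀ t, ∫ ω, R ω * 𝔾 t ω ∂P = 0 := by
      intro t
      have h1 := (Submodule.mem_orthogonal _ _).1 hR _ (Submodule.subset_span ⟨t, rfl⟩)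
      rw [L2.inner_def] at h1
      rw [← h1]
      refine integral_congr_ae ?_
      filter_upwards [(h.memLp_two t).coeFn_toLp] with ω hω
      rw [hω]
      simp
    have h2 := integral_mul_integral_process h.aemeasurable hm hf hfin' (Lp.memLp R)
    simp_rw [hR0, zero_mul, integral_zero] at h2
    rw [← h2]
    refine integral_congr_ae ?_
    filter_upwards [hI.coeFn_toLp] with ω hω
    rw [hω]
    simp [mul_comm]
  obtain ⟨u, hu, hlim⟩ := mem_closure_iff_seq_limit.1 (show hI.toLp _ ∈ closure (S : Set _) from hmem)
  have hlaw := hasLaw_gaussianReal_of_tendsto (fun n => h.hasLaw_of_mem_span (hu n)) hlim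
  rw [norm_sq_toLp, integral_sq_integral_process h.aemeasurable h.memLp_two hf hfin'
    h.integral_mul] at hlaw
  exact hlaw.congr hI.coeFn_toLp.symm

lemma lintegral_rpow_gaussianReal {p : ℝ} (hp : 1 ≤ p) (v : ℝ≥0) :
    ∫⁻ x, ‖x‖ₑ ^ p ∂(gaussianReal 0 v) =
      ENNReal.ofReal √v ^ p * ∫⁻ x, ‖x‖ₑ ^ p ∂(gaussianReal 0 1) := by
  have hp0 : 0 ≤ p := by linarith
  have h1 : gaussianReal 0 v = (gaussianReal 0 1).map (√v * ·) := by
    rw [gaussianReal_map_const_mul]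
    congr 1
    · simp
    · ext; simp
  rw [h1, lintegral_map (by fun_prop) (by fun_prop), ← lintegral_const_mul _ (by fun_prop)]
  refine lintegral_congr fun x => ?_
  rw [enorm_mul, ENNReal.mul_rpow_of_nonneg _ _ hp0, Real.enorm_eq_ofReal (Real.sqrt_nonneg _)]

lemma lintegral_rpow_gaussianReal_ne_top {p : ℝ} (hp : 1 ≤ p) :
    ∫⁻ x, ‖x‖ₑ ^ p ∂(gaussianReal 0 1) ≠ ∞ := by
  have hp0 : 0 < p := by linarith
  have h := (memLp_id_gaussianReal' (μ := 0) (v := 1) (ENNReal.ofReal p) (by simp)).2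
  rw [eLpNorm_eq_lintegral_rpow_enorm_toReal (by simpa using hp0) (by simp),
    ENNReal.toReal_ofReal hp0.le] at h
  intro hcon
  simp only [id] at h
  rw [hcon, ENNReal.top_rpow_of_pos (by positivity)] at h
  exact lt_irrefl _ h

/-- Almost all paths of the Gaussian process are in `Lᵖ`. -/
theorem IsCenteredGaussian.ae_memLp (h : IsCenteredGaussian P K 𝔾) {p : ℝ} (hp : 1 ≤ p)
    (hK : MemLp (fun t => √(K t t)) (ENNReal.ofReal p) volume) :
    ∀ᵐ ω ∂P, MemLp (fun t => 𝔾 t ω) (ENNReal.ofReal p) volume := by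
  have hp0 : 0 < p := by linarith
  -- By Tonelli and Gaussian scaling, the expected `p`-th power of the path norm is a constant times
  -- `∫ K(t,t)^{p/2} dt`.
  have hfin : ∫⁻ ω, (∫⁻ t, ‖𝔾 t ω‖ₑ ^ p) ∂P ≠ ∞ := by
    rw [lintegral_lintegral_swap (f := fun ω t => ‖𝔾 t ω‖ₑ ^ p) (h.aemeasurable.enorm.pow_const p)]
    have : ∀ t, ∫⁻ ω, ‖𝔾 t ω‖ₑ ^ p ∂P =
        ‖√(K t t)‖ₑ ^ p * ∫⁻ x, ‖x‖ₑ ^ p ∂(gaussianReal 0 1) := by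
      intro t
      have h1 := (h.hasLaw_eval t)
      rw [Real.enorm_eq_ofReal (Real.sqrt_nonneg _)]
      have h2 := lintegral_rpow_gaussianReal hp (K t t).toNNReal
      rw [Real.coe_toNNReal _ (h.nonneg t), ← h1.map_eq, lintegral_map' (by fun_prop)
        h1.aemeasurable] at h2
      exact h2
    simp_rw [this]
    rw [lintegral_mul_const' _ _ (lintegral_rpow_gaussianReal_ne_top hp)]
    refine ENNReal.mul_ne_top ?_ (lintegral_rpow_gaussianReal_ne_top hp)
    rw [← eLpNorm_rpow_eq hp]
    exact ENNReal.rpow_ne_top_of_nonneg hp0.le hK.2.ne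
  have hm : AEMeasurable (fun ω => ∫⁻ t, ‖𝔾 t ω‖ₑ ^ p) P :=
    (h.aemeasurable.enorm.pow_const p).lintegral_prod_right'
  filter_upwards [ae_lt_top' hm hfin, h.aemeasurable.aestronglyMeasurable.prodMk_left]
    with ω hω hms
  refine ⟨hms, ?_⟩
  rw [← eLpNorm_rpow_eq hp] at hω
  exact (ENNReal.rpow_lt_top_iff_of_pos hp0).1 hω

end Gaussian


/-! ### Moment bounds for normalized sums -/

/-- The normalized sum `n^{-1/2} ∑_{i < n} ξ(X_i)`. -/
noncomputable def normSum {Ω : Type*} (X : ℕ → Ω → ℝ) (ξ : ℝ → ℝ) (n : ℕ) (ω : Ω) : ℝ :=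
  (√(n : ℝ))⁻¹ * ∑ i ∈ Finset.range n, ξ (X i ω)

/-- The bracket is `2 (cosh y - 1)`, of order `y²` at 0 and of exponential growth at infinity. With
an integer `m ≥ p`, Taylor terms of order 2 (for `|y| ≤ 1`) and `m` (for `|y| ≥ 1`) suffice, and
`m!` serves both ranges since `m ≥ 2`. -/
lemma exists_abs_rpow_le_exp {p : ℝ} (hp : 2 ≤ p) :
    ∃ C : ℝ, 0 < C ∧ ∀ y : ℝ,
      |y| ^ p ≤ C * ((Real.exp y - 1 - y) + (Real.exp (-y) - 1 - (-y))) := by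
  obtain ⟨m, hm⟩ := exists_nat_ge p
  have hm2 : 2 ≤ m := by
    have : (2 : ℝ) ≤ m := hp.trans hm
    exact_mod_cast this
  have hexp : ∀ k : ℕ, 2 ≤ k → ∀ x : ℝ, 0 ≤ x →
      x ^ k / k.factorial ≤ Real.exp x - 1 - x := by
    intro k hk x hx
    have h := Real.sum_le_exp_of_nonneg hx (k + 1)
    have h2 : ∑ i ∈ ({0, 1, k} : Finset ℕ), x ^ i / i.factorial ≤
        ∑ i ∈ Finset.range (k + 1), x ^ i / i.factorial := by
      refine Finset.sum_le_sum_of_subset_of_nonneg ?_ fun i _ _ => by positivity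
      intro i hi
      simp only [Finset.mem_insert, Finset.mem_singleton] at hi
      rw [Finset.mem_range]
      omega
    rw [Finset.sum_insert (by simp; omega), Finset.sum_insert (by simp; omega),
      Finset.sum_singleton] at h2
    simp only [pow_zero, Nat.factorial_zero, Nat.cast_one, div_one, pow_one,
      Nat.factorial_one] at h2
    linarith
  have hpos : ∀ x : ℝ, 0 ≤ Real.exp x - 1 - x := fun x => by linarith [Real.add_one_le_exp x]
  have hfac : (2 : ℝ) ≤ m.factorial := by
    have := Nat.factorial_le hm2
    exact_mod_cast this
  have key : ∀ x : ℝ, 0 ≤ x → x ^ p ≤ m.factorial * (Real.exp x - 1 - x) := by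
    intro x hx
    rcases le_total x 1 with h1 | h1
    · rcases hx.eq_or_lt with rfl | hx0
      · rw [Real.zero_rpow (by linarith)]; simp
      have h3 : x ^ p ≤ x ^ 2 := by
        rw [← Real.rpow_two]
        exact Real.rpow_le_rpow_of_exponent_ge hx0 h1 hp
      have h4 := hexp 2 le_rfl x hx
      rw [Nat.factorial_two] at h4
      push_cast at h4
      calc x ^ p ≤ 2 * (Real.exp x - 1 - x) := by linarith
        _ ≤ _ := by
          have := hpos x
          gcongr
    · have h3 : x ^ p ≤ x ^ m := by
        rw [← Real.rpow_natCast]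
        exact Real.rpow_le_rpow_of_exponent_le h1 hm
      have h4 := hexp m hm2 x hx
      rw [div_le_iff₀ (by positivity)] at h4
      linarith
  refine ⟨m.factorial, by positivity, fun y => ?_⟩
  rw [mul_add]
  rcases le_total 0 y with h | h
  · rw [abs_of_nonneg h]
    have : (0 : ℝ) ≤ m.factorial * (Real.exp (-y) - 1 - (-y)) := mul_nonneg (by positivity) (hpos _)
    linarith [key y h]
  · rw [abs_of_nonpos h]
    have : (0 : ℝ) ≤ m.factorial * (Real.exp y - 1 - y) := mul_nonneg (by positivity) (hpos _)
    linarith [key (-y) (by linarith)]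

section Sums

variable {Ω : Type*} [MeasurableSpace Ω] {P : Measure Ω} [IsProbabilityMeasure P]
  {μ : Measure ℝ} [IsProbabilityMeasure μ] {X : ℕ → Ω → ℝ}

lemma aemeasurable_comp (hX : ∀ i, HasLaw (X i) μ P) {ξ : ℝ → ℝ} (hξ : AEMeasurable ξ μ) (i : ℕ) :
    AEMeasurable (fun ω => ξ (X i ω)) P := by
  have : AEMeasurable ξ (P.map (X i)) := by rwa [(hX i).map_eq]
  exact this.comp_aemeasurable (hX i).aemeasurable

lemma aemeasurable_normSum (hX : ∀ i, HasLaw (X i) μ P) {ξ : ℝ → ℝ} (hξ : AEMeasurable ξ μ)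
    (n : ℕ) : AEMeasurable (normSum X ξ n) P :=
  (Finset.aemeasurable_fun_sum _ fun i _ => aemeasurable_comp hX hξ i).const_mul _

lemma iIndepFun_comp (hX : ∀ i, HasLaw (X i) μ P) (hind : iIndepFun X P) {ξ : ℝ → ℝ}
    (hξ : AEMeasurable ξ μ) : iIndepFun (fun i ω => ξ (X i ω)) P :=
  hind.comp₀ (fun _ => ξ) (fun i => (hX i).aemeasurable) fun i => by rwa [(hX i).map_eq]

lemma integral_comp_law (hX : ∀ i, HasLaw (X i) μ P) {ξ : ℝ → ℝ} (hξ : AEMeasurable ξ μ) (i : ℕ) :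
    ∫ ω, ξ (X i ω) ∂P = ∫ x, ξ x ∂μ := by
  have hm : AEStronglyMeasurable ξ (P.map (X i)) := by
    rw [(hX i).map_eq]; exact hξ.aestronglyMeasurable
  rw [← integral_map (hX i).aemeasurable hm, (hX i).map_eq]

lemma memLp_comp_law (hX : ∀ i, HasLaw (X i) μ P) {ξ : ℝ → ℝ} {q : ℝ≥0∞} (hξ : MemLp ξ q μ)
    (i : ℕ) : MemLp (fun ω => ξ (X i ω)) q P := by
  have : MemLp ξ q (P.map (X i)) := by rwa [(hX i).map_eq]
  exact this.comp_of_map (hX i).aemeasurable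

/-- The second moment of a normalized sum. -/
lemma integral_normSum_sq_le (hX : ∀ i, HasLaw (X i) μ P) (hind : iIndepFun X P) {ξ : ℝ → ℝ}
    (hξ : MemLp ξ 2 μ) (h0 : ∫ x, ξ x ∂μ = 0) (n : ℕ) :
    MemLp (normSum X ξ n) 2 P ∧ ∫ ω, normSum X ξ n ω ^ 2 ∂P ≤ ∫ x, ξ x ^ 2 ∂μ := by
  have hmem : ∀ i, MemLp (fun ω => ξ (X i ω)) 2 P := fun i => memLp_comp_law hX hξ i
  have hS : MemLp (fun ω => ∑ i ∈ Finset.range n, ξ (X i ω)) 2 P :=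
    memLp_finsetSum _ fun i _ => hmem i
  refine ⟨hS.const_mul _, ?_⟩
  have hind' := iIndepFun_comp hX hind hξ.1.aemeasurable
  have hvar := IndepFun.variance_sum (s := Finset.range n) (fun i _ => hmem i)
    (fun i _ k _ hik => hind'.indepFun hik)
  have hmean : ∫ ω, ∑ i ∈ Finset.range n, ξ (X i ω) ∂P = 0 := by
    rw [integral_finsetSum _ fun i _ => (hmem i).integrable one_le_two]
    exact Finset.sum_eq_zero fun i _ => by
      rw [integral_comp_law hX hξ.1.aemeasurable, h0]
  have e1 : (∑ i ∈ Finset.range n, fun ω => ξ (X i ω)) =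
      fun ω => ∑ i ∈ Finset.range n, ξ (X i ω) := by
    funext ω; simp
  rw [e1, variance_eq_integral_sq hS.1.aemeasurable hmean] at hvar
  have e2 : ∀ i, Var[fun ω => ξ (X i ω); P] = ∫ x, ξ x ^ 2 ∂μ := by
    intro i
    rw [variance_eq_integral_sq (hmem i).1.aemeasurable
      (by rw [integral_comp_law hX hξ.1.aemeasurable, h0])]
    exact integral_comp_law (ξ := fun x => ξ x ^ 2) hX (hξ.1.aemeasurable.pow_const 2) i
  simp_rw [e2] at hvar
  rw [Finset.sum_const, Finset.card_range, nsmul_eq_mul] at hvar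
  simp_rw [normSum, mul_pow]
  rw [integral_const_mul, hvar, ← mul_assoc, inv_pow, Real.sq_sqrt (Nat.cast_nonneg n)]
  have hnn : 0 ≤ ∫ x, ξ x ^ 2 ∂μ := integral_nonneg fun x => sq_nonneg _
  calc _ ≤ 1 * ∫ x, ξ x ^ 2 ∂μ := by gcongr; exact inv_mul_le_one
    _ = _ := one_mul _

lemma eLpNorm_normSum_le (hX : ∀ i, HasLaw (X i) μ P) (hind : iIndepFun X P) {ξ : ℝ → ℝ}
    (hξ : MemLp ξ 2 μ) (h0 : ∫ x, ξ x ∂μ = 0) (n : ℕ) :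
    eLpNorm (normSum X ξ n) 2 P ≤ ENNReal.ofReal √(∫ x, ξ x ^ 2 ∂μ) := by
  obtain ⟨h1, h2⟩ := integral_normSum_sq_le hX hind hξ h0 n
  rw [← ENNReal.ofReal_toReal h1.2.ne, ← Lp.norm_toLp _ h1]
  refine ENNReal.ofReal_le_ofReal (Real.le_sqrt_of_sq_le ?_)
  rwa [norm_sq_toLp]

/-- Moments of order `p ≤ 2` of normalized sums. -/
lemma lintegral_normSum_rpow_le_of_le_two (hX : ∀ i, HasLaw (X i) μ P) (hind : iIndepFun X P)
    {ξ : ℝ → ℝ} (hξ : MemLp ξ 2 μ) (h0 : ∫ x, ξ x ∂μ = 0) {p : ℝ} (hp : 1 ≤ p) (hp2 : p ≤ 2)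
    (n : ℕ) :
    ∫⁻ ω, ‖normSum X ξ n ω‖ₑ ^ p ∂P ≤ ENNReal.ofReal √(∫ x, ξ x ^ 2 ∂μ) ^ p := by
  have hp0 : 0 < p := by linarith
  have hm := (aemeasurable_normSum hX hξ.1.aemeasurable n).aestronglyMeasurable
  have h1 : eLpNorm (normSum X ξ n) (ENNReal.ofReal p) P ≤ ENNReal.ofReal √(∫ x, ξ x ^ 2 ∂μ) := by
    refine (eLpNorm_le_eLpNorm_of_exponent_le ?_ hm).trans (eLpNorm_normSum_le hX hind hξ h0 n)
    simpa using ENNReal.ofReal_le_ofReal hp2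
  have h2 := ENNReal.rpow_le_rpow h1 hp0.le
  rwa [eLpNorm_eq_lintegral_rpow_enorm_toReal (by simpa using hp0) (by simp),
    ENNReal.toReal_ofReal hp0.le, ← ENNReal.rpow_mul, one_div, inv_mul_cancel₀ hp0.ne',
    ENNReal.rpow_one] at h2

/-- Since `|c ξ| ≤ 1`, one has `exp(cξ) ≤ 1 + cξ + (cξ)²`. The linear term integrates to zero, and
independence multiplies the bounds. -/
lemma integral_exp_normSum_le (hX : ∀ i, HasLaw (X i) μ P) (hind : iIndepFun X P)
    {ξ : ℝ → ℝ} (hξ : Measurable ξ) (hb : ∀ x, |ξ x| ≤ 2) (h0 : ∫ x, ξ x ∂μ = 0) {c : ℝ}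
    (hc : |c| ≤ 1 / 2) (n : ℕ) :
    Integrable (fun ω => Real.exp (c * ∑ i ∈ Finset.range n, ξ (X i ω))) P ∧
    ∫ ω, Real.exp (c * ∑ i ∈ Finset.range n, ξ (X i ω)) ∂P ≤
      Real.exp (n * (∫ x, ξ x ^ 2 ∂μ) * c ^ 2) := by
  have hm : ∀ i, AEMeasurable (fun ω => ξ (X i ω)) P :=
    fun i => aemeasurable_comp hX hξ.aemeasurable i
  have hSb : ∀ ω, |∑ i ∈ Finset.range n, ξ (X i ω)| ≤ n * 2 := by
    intro ω
    refine (Finset.abs_sum_le_sum_abs _ _).trans ?_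
    calc _ ≤ ∑ i ∈ Finset.range n, (2 : ℝ) := Finset.sum_le_sum fun i _ => hb _
      _ = _ := by simp
  have hbint : ∀ {ν : Measure ℝ} [IsProbabilityMeasure ν] {f : ℝ → ℝ} {B : ℝ}, Measurable f →
      (∀ x, |f x| ≤ B) → Integrable f ν := fun hf hB =>
    Integrable.of_bound hf.aestronglyMeasurable _ (ae_of_all _ hB)
  have hcξ : ∀ x, |c * ξ x| ≤ 1 := by
    intro x
    rw [abs_mul]
    calc |c| * |ξ x| ≤ 1 / 2 * 2 := by gcongr; exact hb x
      _ = 1 := by norm_num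
  have hexpb : ∀ x, |Real.exp (c * ξ x)| ≤ Real.exp 1 := fun x => by
    rw [Real.abs_exp]
    exact Real.exp_le_exp.2 ((le_abs_self _).trans (hcξ x))
  refine ⟨?_, ?_⟩
  · refine Integrable.of_bound (C := Real.exp (|c| * (n * 2))) ?_ (ae_of_all _ fun ω => ?_)
    · exact (Real.measurable_exp.comp_aemeasurable
        ((Finset.aemeasurable_fun_sum _ fun i _ => hm i).const_mul c)).aestronglyMeasurable
    · rw [Real.norm_eq_abs, Real.abs_exp]
      refine Real.exp_le_exp.2 ((le_abs_self _).trans ?_)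
      rw [abs_mul]
      gcongr
      exact hSb ω
  have hmgf := (iIndepFun_comp hX hind hξ.aemeasurable).mgf_sum₀ (t := c) hm (Finset.range n)
  have hone : ∀ i, mgf (fun ω => ξ (X i ω)) P c ≤ Real.exp ((∫ x, ξ x ^ 2 ∂μ) * c ^ 2) := by
    intro i
    have e : mgf (fun ω => ξ (X i ω)) P c = ∫ x, Real.exp (c * ξ x) ∂μ :=
      integral_comp_law (ξ := fun x => Real.exp (c * ξ x)) hX
        (Real.measurable_exp.comp (hξ.const_mul c)).aemeasurable i
    rw [e]
    have hi1 : Integrable (fun x => Real.exp (c * ξ x)) μ :=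
      hbint (Real.measurable_exp.comp (hξ.const_mul c)) hexpb
    have hi2 : Integrable (fun x => ξ x) μ := hbint hξ hb
    have hi3 : Integrable (fun x => ξ x ^ 2) μ := hbint (hξ.pow_const 2) (B := 4) fun x => by
      rw [abs_pow]
      nlinarith [hb x, abs_nonneg (ξ x)]
    have hpt : ∀ x, Real.exp (c * ξ x) ≤ 1 + c * ξ x + c ^ 2 * ξ x ^ 2 := by
      intro x
      have := (abs_le.1 (Real.abs_exp_sub_one_sub_id_le (hcξ x))).2
      rw [mul_pow] at this
      linarith
    have hi4 : Integrable (fun x => 1 + c * ξ x) μ := (integrable_const _).add (hi2.const_mul c)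
    calc ∫ x, Real.exp (c * ξ x) ∂μ ≤ ∫ x, (1 + c * ξ x + c ^ 2 * ξ x ^ 2) ∂μ :=
          integral_mono hi1 (hi4.add (hi3.const_mul _)) hpt
      _ = 1 + c ^ 2 * ∫ x, ξ x ^ 2 ∂μ := by
          rw [integral_add hi4 (hi3.const_mul _),
            integral_add (integrable_const _) (hi2.const_mul c), integral_const_mul,
            integral_const_mul, h0]
          simp
      _ ≤ _ := by
          rw [add_comm, mul_comm]
          exact Real.add_one_le_exp _
  have e1 : (∑ i ∈ Finset.range n, fun ω => ξ (X i ω)) =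
      fun ω => ∑ i ∈ Finset.range n, ξ (X i ω) := by
    funext ω; simp
  rw [e1] at hmgf
  change mgf (fun ω => ∑ i ∈ Finset.range n, ξ (X i ω)) P c ≤ _
  rw [hmgf]
  calc _ ≤ ∏ i ∈ Finset.range n, Real.exp ((∫ x, ξ x ^ 2 ∂μ) * c ^ 2) :=
        Finset.prod_le_prod (fun i _ => mgf_nonneg) fun i _ => hone i
    _ = _ := by
      rw [Finset.prod_const, Finset.card_range, ← Real.exp_nat_mul]
      ring_nf

/-- Moments of order `p ≥ 2` of normalized sums of bounded variables. -/
lemma exists_lintegral_normSum_rpow_le {p : ℝ} (hp : 2 ≤ p) :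
    ∃ C : ℝ, 0 < C ∧ ∀ (Ω : Type*) [MeasurableSpace Ω] (P : Measure Ω) [IsProbabilityMeasure P]
      (μ : Measure ℝ) [IsProbabilityMeasure μ] (X : ℕ → Ω → ℝ),
      (∀ i, HasLaw (X i) μ P) → iIndepFun X P → ∀ ξ : ℝ → ℝ, Measurable ξ → (∀ x, |ξ x| ≤ 2) →
      ∫ x, ξ x ∂μ = 0 → ∀ n : ℕ, 0 < n →
      ∫⁻ ω, ‖normSum X ξ n ω‖ₑ ^ p ∂P ≤ ENNReal.ofReal
        (C * (√(∫ x, ξ x ^ 2 ∂μ) ^ p + (n : ℝ) ^ (1 - p / 2) * ∫ x, ξ x ^ 2 ∂μ)) := by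
  obtain ⟨C₀, hC₀, hexp⟩ := exists_abs_rpow_le_exp hp
  refine ⟨4 * C₀ * 2 ^ (p - 2), by positivity, ?_⟩
  intro Ω _ P _ μ _ X hX hind ξ hξ hb h0 n hn
  have hp0 : 0 < p := by linarith
  set v := ∫ x, ξ x ^ 2 ∂μ with hv
  have hv0 : 0 ≤ v := integral_nonneg fun x => sq_nonneg _
  have hn0 : (0 : ℝ) < n := by exact_mod_cast hn
  set S : Ω → ℝ := fun ω => ∑ i ∈ Finset.range n, ξ (X i ω) with hS
  set a : ℝ := n * v with ha
  have ha0 : 0 ≤ a := by positivity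
  -- With `c = 1/M` one has both `c ≤ 1/2`, as the exponential bound requires, and `a c² ≤ 1`. The
  -- two alternatives in the maximum are the source of the two terms of the final bound.
  set M : ℝ := max 2 √a with hM
  have hM2 : 2 ≤ M := le_max_left _ _
  have hM0 : 0 < M := by linarith
  set c : ℝ := M⁻¹ with hc
  have hc0 : 0 < c := inv_pos.2 hM0
  have hc1 : c ≤ 1 / 2 := by
    rw [hc, one_div]; exact inv_anti₀ two_pos hM2
  have hac : a * c ^ 2 ≤ 1 := by
    have : a ≤ M ^ 2 := by
      calc a = √a ^ 2 := (Real.sq_sqrt ha0).symm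
        _ ≤ M ^ 2 := by gcongr; exact le_max_right _ _
    rw [hc, inv_pow, ← div_eq_mul_inv, div_le_one (by positivity)]
    exact this
  -- For `0 ≤ u ≤ 1` one has `exp u ≤ 1 + u + u² ≤ 1 + 2u`, used with `u = a c²`. The two signs of
  -- `d` together yield the factor 4.
  have hE : ∀ d : ℝ, |d| = c → Integrable (fun ω => Real.exp (d * S ω)) P ∧
      ∫ ω, Real.exp (d * S ω) ∂P ≤ 1 + 2 * (a * c ^ 2) := by
    intro d hd
    obtain ⟨h1, h2⟩ := integral_exp_normSum_le hX hind hξ hb h0 (c := d) (by rw [hd]; exact hc1) n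
    refine ⟨h1, h2.trans ?_⟩
    rw [← sq_abs d, hd]
    have h3 : |a * c ^ 2| ≤ 1 := by rwa [abs_of_nonneg (by positivity)]
    have := (abs_le.1 (Real.abs_exp_sub_one_sub_id_le h3)).2
    have h4 : (a * c ^ 2) ^ 2 ≤ a * c ^ 2 := by
      rw [sq]; exact mul_le_of_le_one_left (by positivity) hac
    linarith
  obtain ⟨hi1, he1⟩ := hE c (abs_of_pos hc0)
  obtain ⟨hi2, he2⟩ := hE (-c) (by rw [abs_neg, abs_of_pos hc0])
  have hSm : AEMeasurable S P :=
    Finset.aemeasurable_fun_sum _ fun i _ => aemeasurable_comp hX hξ.aemeasurable i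
  have hint : Integrable (fun ω => C₀ * (Real.exp (c * S ω) + Real.exp (-c * S ω) - 2)) P :=
    ((hi1.add hi2).sub (integrable_const 2)).const_mul C₀
  have hbound : ∀ ω, |c * S ω| ^ p ≤ C₀ * (Real.exp (c * S ω) + Real.exp (-c * S ω) - 2) := by
    intro ω
    refine (hexp (c * S ω)).trans (le_of_eq ?_)
    rw [neg_mul]; ring
  have hIle : ∫ ω, C₀ * (Real.exp (c * S ω) + Real.exp (-c * S ω) - 2) ∂P
      ≤ 4 * C₀ * (a * c ^ 2) := by
    have hi3 : Integrable (fun ω => Real.exp (c * S ω) + Real.exp (-c * S ω)) P := hi1.add hi2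
    rw [integral_const_mul, integral_sub hi3 (integrable_const 2),
      integral_add hi1 hi2]
    simp only [integral_const, probReal_univ, one_smul]
    rw [mul_comm 4 C₀, mul_assoc]
    refine mul_le_mul_of_nonneg_left ?_ hC₀.le
    linarith
  have h1 : ∫⁻ ω, ENNReal.ofReal (|c * S ω| ^ p) ∂P ≤ ENNReal.ofReal (4 * C₀ * (a * c ^ 2)) := by
    refine (lintegral_mono fun ω => ENNReal.ofReal_le_ofReal (hbound ω)).trans ?_
    rw [← ofReal_integral_eq_lintegral_ofReal hint
      (ae_of_all _ fun ω => le_trans (by positivity) (hbound ω))]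
    exact ENNReal.ofReal_le_ofReal hIle
  have hscale : ∀ ω, ‖normSum X ξ n ω‖ₑ ^ p =
      ENNReal.ofReal (((√(n : ℝ))⁻¹ * M) ^ p) * ENNReal.ofReal (|c * S ω| ^ p) := by
    intro ω
    rw [← ENNReal.ofReal_mul (by positivity), Real.enorm_eq_ofReal_abs,
      ENNReal.ofReal_rpow_of_nonneg (abs_nonneg _) hp0.le, ← Real.mul_rpow (by positivity)
      (abs_nonneg _)]
    congr 2
    rw [normSum, abs_mul, abs_mul, abs_of_pos hc0, abs_of_nonneg (by positivity), hc]
    field_simp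
    rfl
  simp_rw [hscale]
  rw [lintegral_const_mul' _ _ ENNReal.ofReal_ne_top]
  refine (mul_le_mul_right h1 _).trans ?_
  rw [← ENNReal.ofReal_mul (by positivity)]
  refine ENNReal.ofReal_le_ofReal ?_
  have hMp : M ^ p * c ^ 2 = M ^ (p - 2) := by
    rw [Real.rpow_sub hM0, Real.rpow_two, hc, inv_pow, div_eq_mul_inv]
  have hMle : M ^ (p - 2) ≤ 2 ^ (p - 2) * (1 + √a ^ (p - 2)) := by
    have h2 : (1 : ℝ) ≤ 2 ^ (p - 2) := Real.one_le_rpow one_le_two (by linarith)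
    have h3 : 0 ≤ √a ^ (p - 2) := by positivity
    rcases max_choice 2 √a with h | h
    · rw [hM, h]; nlinarith
    · rw [hM, h]; nlinarith
  have hsq : (√(n : ℝ))⁻¹ ^ p * n = (n : ℝ) ^ (1 - p / 2) := by
    rw [Real.inv_rpow (Real.sqrt_nonneg _), Real.sqrt_eq_rpow, ← Real.rpow_mul hn0.le,
      ← Real.rpow_neg hn0.le]
    nth_rewrite 2 [← Real.rpow_one (n : ℝ)]
    rw [← Real.rpow_add hn0]
    congr 1; ring
  have hsqa : √a ^ (p - 2) * v = √(n : ℝ) ^ (p - 2) * √v ^ p := by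
    rw [ha, Real.sqrt_mul hn0.le, Real.mul_rpow (by positivity) (by positivity), mul_assoc]
    congr 1
    rcases hv0.eq_or_lt with h | h
    · rw [← h]; simp [hp0.ne']
    · have : √v ^ p = √v ^ (p - 2) * √v ^ (2 : ℝ) := by
        rw [← Real.rpow_add (Real.sqrt_pos.2 h)]; congr 1; ring
      rw [this, Real.rpow_two, Real.sq_sqrt hv0]
  have hsqn : (√(n : ℝ))⁻¹ ^ p * n * √(n : ℝ) ^ (p - 2) = 1 := by
    rw [hsq, Real.sqrt_eq_rpow, ← Real.rpow_mul hn0.le, ← Real.rpow_add hn0]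
    rw [show (1 - p / 2 + 1 / 2 * (p - 2)) = 0 by ring, Real.rpow_zero]
  rw [Real.mul_rpow (by positivity) hM0.le]
  calc (√(n : ℝ))⁻¹ ^ p * M ^ p * (4 * C₀ * (a * c ^ 2))
      = 4 * C₀ * ((√(n : ℝ))⁻¹ ^ p * n) * v * (M ^ p * c ^ 2) := by rw [ha]; ring
    _ = 4 * C₀ * ((√(n : ℝ))⁻¹ ^ p * n) * v * M ^ (p - 2) := by rw [hMp]
    _ ≤ 4 * C₀ * ((√(n : ℝ))⁻¹ ^ p * n) * v * (2 ^ (p - 2) * (1 + √a ^ (p - 2))) := by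
        gcongr
    _ = 4 * C₀ * 2 ^ (p - 2) * (((√(n : ℝ))⁻¹ ^ p * n) * (√a ^ (p - 2) * v) +
          ((√(n : ℝ))⁻¹ ^ p * n) * v) := by ring
    _ = 4 * C₀ * 2 ^ (p - 2) * (((√(n : ℝ))⁻¹ ^ p * n * √(n : ℝ) ^ (p - 2)) * √v ^ p +
          ((√(n : ℝ))⁻¹ ^ p * n) * v) := by rw [hsqa]; ring
    _ = _ := by rw [hsqn, hsq, one_mul]

end Sums


/-! ### The covariance of the linearized process -/

section Covariance

variable {k : ℕ} {μ : Measure ℝ} [IsProbabilityMeasure μ] {Gdot l : ℝ → Param k}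

/-- The centered indicator process `1_{x ≤ t} - F(t)`. -/
noncomputable def centeredInd (μ : Measure ℝ) (t x : ℝ) : ℝ :=
  (Iic t).indicator (fun _ => (1 : ℝ)) x - cdf μ t

/-- The summand `1_{x ≤ t} - F(t) - Ġ(t)ᵀ l(x)` of the linearized process. -/
noncomputable def limitSummand (μ : Measure ℝ) (Gdot l : ℝ → Param k) (t x : ℝ) : ℝ :=
  centeredInd μ t x - inner ℝ (Gdot t) (l x)

lemma abs_centeredInd_le (t x : ℝ) : |centeredInd μ t x| ≤ 1 := by
  have h0 := cdf_nonneg μ t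
  have h1 := cdf_le_one μ t
  unfold centeredInd
  by_cases h : x ∈ Iic t
  · rw [indicator_of_mem h, abs_le]; constructor <;> linarith
  · rw [indicator_of_notMem h, abs_le]; constructor <;> linarith

lemma measurable_cdf' (μ : Measure ℝ) : Measurable (cdf μ) := (monotone_cdf μ).measurable

lemma measurable_centeredInd (μ : Measure ℝ) :
    Measurable (fun z : ℝ × ℝ => centeredInd μ z.2 z.1) := by
  have h1 : (fun z : ℝ × ℝ => centeredInd μ z.2 z.1) =
      fun z => {z : ℝ × ℝ | z.1 ≤ z.2}.indicator (fun _ => (1 : ℝ)) z - cdf μ z.2 := by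
    funext z
    simp [centeredInd, indicator]
  rw [h1]
  exact (measurable_const.indicator (measurableSet_le measurable_fst measurable_snd)).sub
    ((measurable_cdf' μ).comp measurable_snd)

lemma measurable_centeredInd_left (μ : Measure ℝ) (t : ℝ) : Measurable (centeredInd μ t) :=
  (measurable_centeredInd μ).comp measurable_prodMk_right

lemma memLp_centeredInd (t : ℝ) (q : ℝ≥0∞) : MemLp (centeredInd μ t) q μ :=
  MemLp.of_bound (measurable_centeredInd_left μ t).aestronglyMeasurable 1
    (ae_of_all _ fun x => abs_centeredInd_le t x)

lemma integral_indicator_Iic (t : ℝ) :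
    ∫ x, (Iic t).indicator (fun _ => (1 : ℝ)) x ∂μ = cdf μ t := by
  rw [integral_indicator_const _ measurableSet_Iic, cdf_eq_real, smul_eq_mul, mul_one]

lemma integrable_indicator_Iic (t : ℝ) :
    Integrable ((Iic t).indicator (fun _ => (1 : ℝ))) μ :=
  (integrable_const 1).indicator measurableSet_Iic

lemma integral_centeredInd (t : ℝ) : ∫ x, centeredInd μ t x ∂μ = 0 := by
  unfold centeredInd
  rw [integral_sub (integrable_indicator_Iic t) (integrable_const _), integral_indicator_Iic]
  simp

lemma integral_centeredInd_mul (s t : ℝ) :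
    ∫ x, centeredInd μ s x * centeredInd μ t x ∂μ = cdf μ (min s t) - cdf μ s * cdf μ t := by
  have e : ∀ x, centeredInd μ s x * centeredInd μ t x =
      (Iic (min s t)).indicator (fun _ => (1 : ℝ)) x
        - cdf μ t * (Iic s).indicator (fun _ => (1 : ℝ)) x - cdf μ s * centeredInd μ t x := by
    intro x
    have : (Iic (min s t)).indicator (fun _ => (1 : ℝ)) x =
        (Iic s).indicator (fun _ => (1 : ℝ)) x * (Iic t).indicator (fun _ => (1 : ℝ)) x := by
      by_cases h1 : x ≤ s <;> by_cases h2 : x ≤ t <;> simp [indicator, h1, h2]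
    rw [this]; unfold centeredInd; ring
  have hi : Integrable (fun x => (Iic (min s t)).indicator (fun _ => (1 : ℝ)) x
        - cdf μ t * (Iic s).indicator (fun _ => (1 : ℝ)) x) μ :=
    (integrable_indicator_Iic _).sub ((integrable_indicator_Iic s).const_mul _)
  simp_rw [e]
  rw [integral_sub hi (((memLp_centeredInd t 1).integrable le_rfl).const_mul _),
    integral_sub (integrable_indicator_Iic _) ((integrable_indicator_Iic s).const_mul _),
    integral_const_mul, integral_const_mul, integral_centeredInd, integral_indicator_Iic,
    integral_indicator_Iic]
  ring

lemma memLp_apply {q : ℝ≥0∞} {ν : Measure ℝ} {f : ℝ → Param k} (hf : MemLp f q ν) (i : Fin k) :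
    MemLp (fun x => f x i) q ν :=
  ((EuclideanSpace.proj (𝕜 := ℝ) i).comp_memLp' hf)

lemma integral_apply {ν : Measure ℝ} {f : ℝ → Param k} (hf : Integrable f ν) (i : Fin k) :
    (∫ x, f x ∂ν) i = ∫ x, f x i ∂ν :=
  ((EuclideanSpace.proj (𝕜 := ℝ) i).integral_comp_comm hf).symm

lemma inner_param (u v : Param k) : inner ℝ u v = ∑ i, u i * v i := by
  rw [PiLp.inner_apply]
  exact Finset.sum_congr rfl fun i _ => by simp [mul_comm]

lemma memLp_inner (hl : MemLp l 2 μ) (v : Param k) : MemLp (fun x => inner ℝ v (l x)) 2 μ :=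
  (innerSL ℝ v).comp_memLp' hl

lemma memLp_limitSummand (hl : MemLp l 2 μ) (t : ℝ) : MemLp (limitSummand μ Gdot l t) 2 μ :=
  (memLp_centeredInd t 2).sub (memLp_inner hl (Gdot t))

lemma integral_inner_eq_zero (hl : MemLp l 2 μ) (h0 : ∫ x, l x ∂μ = 0) (v : Param k) :
    ∫ x, inner ℝ v (l x) ∂μ = 0 := by
  have := (innerSL ℝ v).integral_comp_comm (hl.integrable one_le_two)
  simp only [innerSL_apply_apply] at this
  rw [this, h0, inner_zero_right]

lemma integral_limitSummand (hl : MemLp l 2 μ) (h0 : ∫ x, l x ∂μ = 0) (t : ℝ) :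
    ∫ x, limitSummand μ Gdot l t x ∂μ = 0 := by
  unfold limitSummand
  rw [integral_sub ((memLp_centeredInd t 1).integrable le_rfl)
    ((memLp_inner hl _).integrable one_le_two), integral_centeredInd,
    integral_inner_eq_zero hl h0, sub_zero]

lemma integral_centeredInd_mul_inner (hl : MemLp l 2 μ) (h0 : ∫ x, l x ∂μ = 0) (t : ℝ)
    (v : Param k) :
    ∫ x, centeredInd μ t x * inner ℝ v (l x) ∂μ = inner ℝ v (∫ u in Iic t, l u ∂μ) := by
  have hi : Integrable (fun x => inner ℝ v (l x)) μ := (memLp_inner hl v).integrable one_le_two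
  have e : ∀ x, centeredInd μ t x * inner ℝ v (l x) =
      (Iic t).indicator (fun x => inner ℝ v (l x)) x - cdf μ t * inner ℝ v (l x) := by
    intro x
    unfold centeredInd
    by_cases h : x ∈ Iic t
    · rw [indicator_of_mem h, indicator_of_mem h]; ring
    · rw [indicator_of_notMem h, indicator_of_notMem h]; ring
  simp_rw [e]
  rw [integral_sub (hi.indicator measurableSet_Iic) (hi.const_mul _), integral_const_mul,
    integral_inner_eq_zero hl h0, integral_indicator measurableSet_Iic]
  have := (innerSL ℝ v).integral_comp_comm ((hl.integrable one_le_two).integrableOn (s := Iic t))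
  simp only [innerSL_apply_apply] at this
  rw [this]; ring

lemma integral_inner_mul_inner (hl : MemLp l 2 μ) (u v : Param k) :
    ∫ x, inner ℝ u (l x) * inner ℝ v (l x) ∂μ =
      (fun i => u i) ⬝ᵥ Matrix.mulVec (influenceCov μ l) (fun j => v j) := by
  have hij : ∀ i j, Integrable (fun x => l x i * l x j) μ := fun i j =>
    (memLp_apply hl i).integrable_mul (memLp_apply hl j)
  have e : ∀ x, inner ℝ u (l x) * inner ℝ v (l x) =
      ∑ i, ∑ j, u i * (v j * (l x i * l x j)) := by
    intro x
    rw [inner_param, inner_param, Finset.sum_mul_sum]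
    exact Finset.sum_congr rfl fun i _ => Finset.sum_congr rfl fun j _ => by ring
  simp_rw [e]
  rw [integral_finsetSum _ fun i _ => integrable_finsetSum _ fun j _ =>
    ((hij i j).const_mul _).const_mul _]
  refine Finset.sum_congr rfl fun i _ => ?_
  rw [integral_finsetSum _ fun j _ => ((hij i j).const_mul _).const_mul _]
  simp only [Matrix.mulVec, dotProduct, Finset.mul_sum]
  refine Finset.sum_congr rfl fun j _ => ?_
  rw [integral_const_mul, integral_const_mul, influenceCov, Matrix.of_apply]
  ring

/-- The limit covariance is the covariance of the summands of the linearized process. -/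
theorem integral_limitSummand_mul (hl : MemLp l 2 μ) (h0 : ∫ x, l x ∂μ = 0) (s t : ℝ) :
    ∫ x, limitSummand μ Gdot l s x * limitSummand μ Gdot l t x ∂μ = limitCov μ Gdot l s t := by
  have e : ∀ x, limitSummand μ Gdot l s x * limitSummand μ Gdot l t x =
      (centeredInd μ s x * centeredInd μ t x + inner ℝ (Gdot s) (l x) * inner ℝ (Gdot t) (l x)) -
      (centeredInd μ t x * inner ℝ (Gdot s) (l x) +
        centeredInd μ s x * inner ℝ (Gdot t) (l x)) := by
    intro x; unfold limitSummand; ring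
  have i1 : Integrable (fun x => centeredInd μ s x * centeredInd μ t x) μ :=
    (memLp_centeredInd s 2).integrable_mul (memLp_centeredInd t 2)
  have i2 : Integrable (fun x => inner ℝ (Gdot s) (l x) * inner ℝ (Gdot t) (l x)) μ :=
    (memLp_inner hl _).integrable_mul (memLp_inner hl _)
  have i3 : ∀ a b, Integrable (fun x => centeredInd μ a x * inner ℝ (Gdot b) (l x)) μ :=
    fun a b => (memLp_centeredInd a 2).integrable_mul (memLp_inner hl _)
  have i12 : Integrable (fun x => centeredInd μ s x * centeredInd μ t x +
      inner ℝ (Gdot s) (l x) * inner ℝ (Gdot t) (l x)) μ := i1.add i2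
  have i34 : Integrable (fun x => centeredInd μ t x * inner ℝ (Gdot s) (l x) +
      centeredInd μ s x * inner ℝ (Gdot t) (l x)) μ := (i3 t s).add (i3 s t)
  simp_rw [e]
  rw [integral_sub i12 i34, integral_add i1 i2, integral_add (i3 t s) (i3 s t),
    integral_centeredInd_mul, integral_inner_mul_inner hl, integral_centeredInd_mul_inner hl h0,
    integral_centeredInd_mul_inner hl h0, limitCov]
  ring

lemma integral_centeredInd_sq (t : ℝ) :
    ∫ x, centeredInd μ t x ^ 2 ∂μ = cdf μ t * (1 - cdf μ t) := by
  have := integral_centeredInd_mul (μ := μ) t t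
  rw [min_self] at this
  simp_rw [sq, this]; ring

/-- This is `(a - b)² ≤ 2a² + 2b²` with Cauchy–Schwarz for the inner product. It reduces
integrability of the standard deviation to that of `√(F(1-F))` and `‖Ġ‖`. -/
lemma limitCov_self_le (hl : MemLp l 2 μ) (h0 : ∫ x, l x ∂μ = 0) (t : ℝ) :
    limitCov μ Gdot l t t ≤
      2 * (cdf μ t * (1 - cdf μ t)) + 2 * (‖Gdot t‖ ^ 2 * ∫ x, ‖l x‖ ^ 2 ∂μ) := by
  have hn : Integrable (fun x => ‖l x‖ ^ 2) μ := hl.integrable_norm_pow (by simp)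
  have hc : Integrable (fun x => centeredInd μ t x ^ 2) μ := (memLp_centeredInd t 2).integrable_sq
  rw [← integral_limitSummand_mul hl h0, ← integral_centeredInd_sq, ← integral_const_mul,
    ← integral_const_mul, ← integral_const_mul,
    ← integral_add (hc.const_mul 2) ((hn.const_mul _).const_mul 2)]
  refine integral_mono ((memLp_limitSummand hl t).integrable_mul (memLp_limitSummand hl t))
    ((hc.const_mul 2).add ((hn.const_mul _).const_mul 2)) fun x => ?_
  have h1 : inner ℝ (Gdot t) (l x) ^ 2 ≤ ‖Gdot t‖ ^ 2 * ‖l x‖ ^ 2 := by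
    rw [← mul_pow, ← sq_abs]
    gcongr
    exact abs_real_inner_le_norm _ _
  simp only [limitSummand]
  nlinarith [sq_nonneg (centeredInd μ t x + inner ℝ (Gdot t) (l x))]

lemma ae_limitSummand_eq_zero (hl : MemLp l 2 μ) (h0 : ∫ x, l x ∂μ = 0) {t : ℝ}
    (ht : limitCov μ Gdot l t t = 0) : ∀ᵐ x ∂μ, limitSummand μ Gdot l t x = 0 := by
  rw [← integral_limitSummand_mul hl h0] at ht
  have := (integral_eq_zero_iff_of_nonneg (fun x => mul_self_nonneg _)
    ((memLp_limitSummand (Gdot := Gdot) hl t).integrable_mul (memLp_limitSummand hl t))).1 ht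
  filter_upwards [this] with x hx
  exact mul_self_eq_zero.1 hx

lemma limitCov_self_of_Gdot_eq_zero {t : ℝ} (hG : Gdot t = 0)
    (hF : cdf μ t = 0 ∨ cdf μ t = 1) : limitCov μ Gdot l t t = 0 := by
  unfold limitCov
  rcases hF with h | h <;> simp [hG, h, dotProduct]

end Covariance

/-! ### Points at which the limit variance vanishes -/

section Degenerate

variable {k : ℕ} {μ : Measure ℝ} [IsProbabilityMeasure μ] {Gdot l : ℝ → Param k}

lemma measure_Ioc_ne_zero {a b : ℝ} (hab : cdf μ a < cdf μ b) : μ (Ioc a b) ≠ 0 := by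
  rw [← measure_cdf μ, StieltjesFunction.measure_Ioc]
  simpa using hab

lemma measure_Ioi_ne_zero {a : ℝ} (ha : cdf μ a < 1) : μ (Ioi a) ≠ 0 := by
  rw [← measure_cdf μ, StieltjesFunction.measure_Ioi _ (tendsto_cdf_atTop μ)]
  simpa using ha

/-- At points with distinct values of `F` in `(0, 1)` at which the variance degenerates, the vectors
`Ġ` are linearly independent. -/
lemma linearIndependent_Gdot (U : Finset ℝ)
    (hU : ∀ t ∈ U, 0 < cdf μ t ∧ cdf μ t < 1 ∧ ∀ᵐ x ∂μ, limitSummand μ Gdot l t x = 0)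
    (hinj : Set.InjOn (cdf μ) U) : LinearIndependent ℝ (fun t : U => Gdot t) := by
  classical
  rw [Fintype.linearIndependent_iff]
  intro g hg
  by_contra! hne
  obtain ⟨t₀, ht₀⟩ := hne
  set S : Finset U := Finset.univ.filter fun t => g t ≠ 0 with hS
  -- Take the rightmost point with nonzero coefficient. Pairing the relation among the `Ġ(t)` with
  -- `l(x)` turns it into a relation among centered indicators.
  obtain ⟨m, hmS, hmax⟩ := S.exists_max_image (fun t => (t : ℝ)) ⟨t₀, by simp [hS, ht₀]⟩
  have hgm : g m ≠ 0 := (Finset.mem_filter.1 hmS).2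
  have hae : ∀ᵐ x ∂μ, ∑ t : U, g t * (Iic (t : ℝ)).indicator (fun _ => (1 : ℝ)) x =
      ∑ t : U, g t * cdf μ t := by
    have hall : ∀ᵐ x ∂μ, ∀ t : U, limitSummand μ Gdot l t x = 0 :=
      ae_all_iff.2 fun t => (hU t t.2).2.2
    filter_upwards [hall] with x hx
    rw [← sub_eq_zero, ← Finset.sum_sub_distrib]
    have h1 : ∑ t : U, inner ℝ (g t • Gdot t) (l x) = 0 := by
      rw [← sum_inner, hg, inner_zero_left]
    rw [← h1]
    refine Finset.sum_congr rfl fun t _ => ?_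
    have h2 := hx t
    simp only [limitSummand, centeredInd] at h2
    rw [real_inner_smul_left]
    linear_combination (g t) * h2
  -- To the right of `m`, where `μ` has mass because `F(m) < 1`, every indicator with a nonzero
  -- coefficient vanishes, so the constant is 0.
  have hc : ∑ t : U, g t * cdf μ t = 0 := by
    obtain ⟨x, hx, hx2⟩ := Measure.exists_mem_of_measure_ne_zero_of_ae
      (measure_Ioi_ne_zero (hU m m.2).2.1) (ae_restrict_of_ae hae)
    rw [← hx2]
    refine Finset.sum_eq_zero fun t _ => ?_
    by_cases hgt : g t = 0
    · simp [hgt]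
    · have : (t : ℝ) ≤ m := hmax t (by simp [hS, hgt])
      have hx' : (m : ℝ) < x := hx
      rw [indicator_of_notMem (by simp; linarith), mul_zero]
  -- Take `b` to be the next largest such point, or a point far to the left if there is none. Since
  -- `F(b) < F(m)`, the interval `(b, m]` has mass, and there only the indicator at `m` survives,
  -- which forces its coefficient to be 0.
  obtain ⟨b, hb, hbF⟩ : ∃ b : ℝ, (∀ t ∈ S, t ≠ m → (t : ℝ) ≤ b) ∧ cdf μ b < cdf μ m := by
    rcases (S.erase m).eq_empty_or_nonempty with h | h
    · obtain ⟨b, hb⟩ := ((tendsto_cdf_atBot μ).eventually (gt_mem_nhds (hU m m.2).1)).exists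
      refine ⟨b, fun t ht htm => ?_, hb⟩
      exact absurd (h ▸ Finset.mem_erase.2 ⟨htm, ht⟩) (Finset.notMem_empty t)
    · obtain ⟨b, hbS, hbmax⟩ := (S.erase m).exists_max_image (fun t => (t : ℝ)) h
      refine ⟨b, fun t ht htm => hbmax t (Finset.mem_erase.2 ⟨htm, ht⟩), ?_⟩
      obtain ⟨hbm, hbS'⟩ := Finset.mem_erase.1 hbS
      refine lt_of_le_of_ne (monotone_cdf μ (hmax b hbS')) fun heq => hbm ?_
      exact Subtype.ext (hinj b.2 m.2 heq)
  obtain ⟨x, hx, hx2⟩ := Measure.exists_mem_of_measure_ne_zero_of_ae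
    (measure_Ioc_ne_zero hbF) (ae_restrict_of_ae hae)
  rw [hc, Finset.sum_eq_single m] at hx2
  · rw [indicator_of_mem (show x ∈ Iic (m : ℝ) from hx.2), mul_one] at hx2
    exact hgm hx2
  · intro t _ htm
    by_cases hgt : g t = 0
    · simp [hgt]
    · have h1 : (t : ℝ) ≤ b := hb t (by simp [hS, hgt]) htm
      have h2 : b < x := hx.1
      rw [indicator_of_notMem (by simp; linarith), mul_zero]
  · simp

/-- If the variance of the limit process vanishes almost everywhere on the part of the set `C` on
which `0 < F < 1`, then this part is null, provided that the variance does not vanish where `F` is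
locally constant. -/
theorem measure_contact_eq_zero (hl : MemLp l 2 μ) (h0 : ∫ x, l x ∂μ = 0) {C : Set ℝ}
    (hnd : ∀ᵐ t : ℝ, t ∈ C → 0 < cdf μ t → cdf μ t < 1 →
      (∀ᶠ s in 𝓝 t, cdf μ s = cdf μ t) → 0 < limitCov μ Gdot l t t)
    (hK : ∀ᵐ t : ℝ, t ∈ C → limitCov μ Gdot l t t = 0) :
    volume (C ∩ {t | 0 < cdf μ t ∧ cdf μ t < 1}) = 0 := by
  set A : Set ℝ := {t | t ∈ C ∧ 0 < cdf μ t ∧ cdf μ t < 1 ∧ limitCov μ Gdot l t t = 0} with hA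
  -- Choosing one point of `A` for each value of `F`, infinitely many values would give `k + 1`
  -- linearly independent vectors in `ℝᵏ`.
  have hfin : (cdf μ '' A).Finite := by
    by_contra hinf
    obtain ⟨A', hA'sub, hbij⟩ := Set.exists_subset_bijOn A (cdf μ)
    have hA'inf : A'.Infinite := by
      intro hf
      exact hinf (hbij.image_eq ▸ hf.image _)
    obtain ⟨U, hUsub, hUcard⟩ := hA'inf.exists_subset_card_eq (k + 1)
    have hlin : LinearIndependent ℝ (fun t : U => Gdot t) := by
      refine linearIndependent_Gdot (μ := μ) (l := l) U (fun t ht => ?_) (hbij.injOn.mono hUsub)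
      have htA := hA'sub (hUsub ht)
      exact ⟨htA.2.1, htA.2.2.1, ae_limitSummand_eq_zero hl h0 htA.2.2.2⟩
    have := hlin.fintype_card_le_finrank
    rw [Fintype.card_coe, hUcard, finrank_euclideanSpace_fin] at this
    omega
  -- A level set of `F` is an interval, so its frontier is null; at an interior point `F` is locally
  -- constant, and `hnd` excludes degeneracy for almost all such points of `C`.
  have hnull : ∀ u ∈ cdf μ '' A, volume {t | t ∈ A ∧ cdf μ t = u} = 0 := by
    intro u _
    have hconv : Convex ℝ {t | cdf μ t = u} := by
      refine Set.OrdConnected.convex ⟨fun a ha b hb c hc => ?_⟩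
      have h1 := monotone_cdf μ hc.1
      have h2 := monotone_cdf μ hc.2
      have ha' : cdf μ a = u := ha
      have hb' : cdf μ b = u := hb
      exact le_antisymm (by rw [← hb']; exact h2) (by rw [← ha']; exact h1)
    have hfr := hconv.addHaar_frontier volume
    rw [← compl_mem_ae_iff] at hfr ⊢
    filter_upwards [hfr, hnd] with t ht1 ht2 ht3
    obtain ⟨⟨hC, hp0, hp1, hz⟩, hu⟩ := ht3
    have hint : t ∈ interior {t | cdf μ t = u} := by
      by_contra hcon
      exact ht1 ⟨subset_closure hu, hcon⟩
    have hev : ∀ᶠ s in 𝓝 t, cdf μ s = cdf μ t := by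
      filter_upwards [mem_interior_iff_mem_nhds.1 hint] with s hs
      rw [hu]; exact hs
    exact (ht2 hC hp0 hp1 hev).ne' hz
  have hAnull : volume A = 0 := by
    have hsub : A ⊆ ⋃ u ∈ cdf μ '' A, {t | t ∈ A ∧ cdf μ t = u} := by
      intro t ht
      simp only [mem_iUnion]
      exact ⟨cdf μ t, ⟨t, ht, rfl⟩, ht, rfl⟩
    exact measure_mono_null hsub ((measure_biUnion_null_iff hfin.countable).2 hnull)
  rw [← compl_mem_ae_iff] at hAnull ⊢
  filter_upwards [hAnull, hK] with t h1 h2 h3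
  exact h1 ⟨h3.1, h3.2.1, h3.2.2, h2 h3.1⟩

end Degenerate

/-! ### The derivative of the model where `G(θ_F)` is extremal -/

section Boundary

variable {k : ℕ} {p : ℝ} {Q : Param k → Measure ℝ} {θF : Param k} {Gdot : ℝ → Param k}

lemma LpDifferentiable.aemeasurable (hG : LpDifferentiable p Q θF Gdot) :
    AEMeasurable Gdot volume := by
  have h : AEMeasurable (fun t => WithLp.ofLp (Gdot t)) volume :=
    aemeasurable_pi_iff.2 fun i => (hG.memLp i).1.aemeasurable
  exact (PiLp.continuous_toLp 2 (fun _ : Fin k => ℝ)).measurable.comp_aemeasurable h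

/-- The remainder in the expansion of the model. -/
noncomputable def modelRemainder (Q : Param k → Measure ℝ) (θF : Param k) (Gdot : ℝ → Param k)
    (h : Param k) (t : ℝ) : ℝ :=
  cdf (Q (θF + h)) t - cdf (Q θF) t - inner ℝ (Gdot t) h

lemma LpDifferentiable.aemeasurable_remainder (hG : LpDifferentiable p Q θF Gdot) (h : Param k) :
    AEMeasurable (modelRemainder Q θF Gdot h) volume :=
  ((measurable_cdf' _).aemeasurable.sub (measurable_cdf' _).aemeasurable).sub
    (hG.aemeasurable.inner aemeasurable_const)

/-- The derivative of the model vanishes where `G(θF) ∈ {0, 1}`. -/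
theorem LpDifferentiable.ae_eq_zero (hp : 1 ≤ p) (hG : LpDifferentiable p Q θF Gdot) :
    ∀ᵐ t : ℝ, (cdf (Q θF) t = 0 ∨ cdf (Q θF) t = 1) → Gdot t = 0 := by
  set B : Set ℝ := {t | cdf (Q θF) t = 0 ∨ cdf (Q θF) t = 1} with hB
  have hBm : MeasurableSet B := by
    have hm := measurable_cdf' (Q θF)
    exact (hm (measurableSet_singleton 0)).union (hm (measurableSet_singleton 1))
  have hvec : ∀ v : Param k, ∀ᵐ t : ℝ, t ∈ B → inner ℝ (Gdot t) v = 0 := by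
    intro v
    set f : ℝ → ℝ := B.indicator fun t => inner ℝ (Gdot t) v with hf
    have hfm : AEStronglyMeasurable f volume :=
      (hG.aemeasurable.inner aemeasurable_const).aestronglyMeasurable.indicator hBm
    have hbound : ∀ ε : ℝ, 0 < ε →
        eLpNorm f (ENNReal.ofReal p) volume ≤ ENNReal.ofReal (2 * ε * ‖v‖) := by
      intro ε hε
      have hlim1 : Tendsto (fun s : ℝ => s • v) (𝓝[>] 0) (𝓝 0) := by
        have : Tendsto (fun s : ℝ => s • v) (𝓝 0) (𝓝 ((0 : ℝ) • v)) :=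
          (continuous_id.smul continuous_const).tendsto 0
        rw [zero_smul] at this
        exact this.mono_left nhdsWithin_le_nhds
      have hlim2 : Tendsto (fun s : ℝ => -(s • v)) (𝓝[>] 0) (𝓝 0) := by simpa using hlim1.neg
      obtain ⟨s, hs1, hs2, hs0⟩ := ((hlim1.eventually (hG.isLittleO ε hε)).and
        ((hlim2.eventually (hG.isLittleO ε hε)).and self_mem_nhdsWithin)).exists
      have hs0' : (0 : ℝ) < s := hs0
      -- If `G(t;θ_F)` is 0 or 1, the increments in the directions `s v` and `-(s v)` have the same
      -- sign. The linear term changes sign between the two, so it is dominated by the sum of the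
      -- two remainders.
      have hpt : ∀ t, ‖(s • f) t‖ ≤ ‖|modelRemainder Q θF Gdot (s • v) t| +
          |modelRemainder Q θF Gdot (-(s • v)) t|‖ := by
        intro t
        rw [Real.norm_eq_abs, Real.norm_eq_abs, abs_of_nonneg (add_nonneg (abs_nonneg _)
          (abs_nonneg (modelRemainder Q θF Gdot (-(s • v)) t)))]
        by_cases ht : t ∈ B
        · simp only [Pi.smul_apply, hf, indicator_of_mem ht, smul_eq_mul, modelRemainder,
            inner_neg_right, real_inner_smul_right]
          have h0 := cdf_nonneg (Q (θF + s • v)) t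
          have h1 := cdf_le_one (Q (θF + s • v)) t
          have h0' := cdf_nonneg (Q (θF + -(s • v))) t
          have h1' := cdf_le_one (Q (θF + -(s • v))) t
          set x := s * inner ℝ (Gdot t) v
          have ha1 := neg_abs_le (cdf (Q (θF + s • v)) t - cdf (Q θF) t - x)
          have ha2 := le_abs_self (cdf (Q (θF + s • v)) t - cdf (Q θF) t - x)
          have hb1 := neg_abs_le (cdf (Q (θF + -(s • v))) t - cdf (Q θF) t - -x)
          have hb2 := le_abs_self (cdf (Q (θF + -(s • v))) t - cdf (Q θF) t - -x)
          have hc1 := abs_nonneg (cdf (Q (θF + s • v)) t - cdf (Q θF) t - x)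
          have hc2 := abs_nonneg (cdf (Q (θF + -(s • v))) t - cdf (Q θF) t - -x)
          rw [abs_le]
          rcases ht with ht | ht <;> constructor <;> linarith
        · simp only [Pi.smul_apply, hf, indicator_of_notMem ht, smul_zero, abs_zero]
          positivity
      have h3 := (eLpNorm_mono (p := ENNReal.ofReal p) (μ := volume) hpt).trans
        (eLpNorm_add_le (hG.aemeasurable_remainder _).aestronglyMeasurable.norm
          (hG.aemeasurable_remainder _).aestronglyMeasurable.norm (one_le_ofReal hp))
      simp only [eLpNorm_norm, ← Real.norm_eq_abs] at h3
      have h4 : eLpNorm (s • f) (ENNReal.ofReal p) volume ≤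
          ENNReal.ofReal (ε * ‖s • v‖) + ENNReal.ofReal (ε * ‖-(s • v)‖) :=
        h3.trans (add_le_add hs1 hs2)
      rw [norm_neg, ← ENNReal.ofReal_add (by positivity) (by positivity), eLpNorm_const_smul,
        norm_smul, Real.norm_eq_abs, Real.enorm_eq_ofReal_abs, abs_of_pos hs0'] at h4
      have h5 : ε * (s * ‖v‖) + ε * (s * ‖v‖) = s * (2 * ε * ‖v‖) := by ring
      rw [h5, ENNReal.ofReal_mul hs0'.le] at h4
      -- Both sides are proportional to the step `s`, which cancels and leaves a bound proportional
      -- to the arbitrary `ε`.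
      exact (ENNReal.mul_le_mul_iff_right (by simpa using hs0') ENNReal.ofReal_ne_top).1 h4
    have hzero : eLpNorm f (ENNReal.ofReal p) volume = 0 := by
      have hlim : Tendsto (fun ε : ℝ => ENNReal.ofReal (2 * ε * ‖v‖)) (𝓝[>] 0) (𝓝 0) := by
        have : Tendsto (fun ε : ℝ => ENNReal.ofReal (2 * ε * ‖v‖)) (𝓝 0)
            (𝓝 (ENNReal.ofReal (2 * 0 * ‖v‖))) :=
          (ENNReal.continuous_ofReal.comp (by fun_prop)).tendsto 0
        simp only [mul_zero, zero_mul, ENNReal.ofReal_zero] at this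
        exact this.mono_left nhdsWithin_le_nhds
      refine le_antisymm (ge_of_tendsto hlim ?_) zero_le
      filter_upwards [self_mem_nhdsWithin] with ε hε
      exact hbound ε hε
    have hp0 : ENNReal.ofReal p ≠ 0 := by
      have : 0 < p := by linarith
      simpa using this
    have := (eLpNorm_eq_zero_iff hfm hp0).1 hzero
    filter_upwards [this] with t ht htB
    simpa [hf, indicator_of_mem htB] using ht
  have hall : ∀ᵐ t : ℝ, ∀ i : Fin k, t ∈ B → inner ℝ (Gdot t) (EuclideanSpace.single i (1 : ℝ)) = 0 :=
    ae_all_iff.2 fun i => hvec _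
  filter_upwards [hall] with t ht htB
  ext i
  have := ht i htB
  simpa [EuclideanSpace.inner_single_right] using this

end Boundary


/-! ### Consequences of the Lorentz condition for the tails -/

section Tails

variable {μ : Measure ℝ} [IsProbabilityMeasure μ] {p : ℝ}

/-- The two-sided tail probability `P(|X| > |t| - 1)`. -/
noncomputable def tailProb (μ : Measure ℝ) (t : ℝ) : ℝ≥0∞ := μ {x | |t| - 1 < |x|}

lemma antitone_tail (μ : Measure ℝ) : Antitone fun s : ℝ => μ {x : ℝ | s < |x|} :=
  fun _ _ hst => measure_mono fun _ hx => lt_of_le_of_lt hst hx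

lemma measurable_tailProb (μ : Measure ℝ) : Measurable (tailProb μ) :=
  (antitone_tail μ).measurable.comp ((measurable_id.abs).sub_const 1)

/-- The shift by 1 in `tailProb` leaves room for a cell of width at most 1. It adds only a bounded
interval, on which the integrand is at most 1. -/
lemma lintegral_tailProb_ne_top (hp : 1 ≤ p) (hX : LorentzCond p μ) :
    ∫⁻ t, tailProb μ t ^ (p / 2) ≠ ∞ := by
  have hp2 : 0 ≤ p / 2 := by linarith
  set h : ℝ → ℝ≥0∞ := fun s => (μ {x : ℝ | s < |x|}) ^ (p / 2) with hh
  have hm : Measurable h := (antitone_tail μ).measurable.pow_const _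
  -- The argument `|t| - 1` is at least `-1`, so cutting off at `-2` loses nothing and keeps the
  -- integral finite.
  set k : ℝ → ℝ≥0∞ := (Ioi (-2 : ℝ)).indicator h with hk
  have hkm : Measurable k := hm.indicator measurableSet_Ioi
  have hkfin : ∫⁻ s, k s < ∞ := by
    rw [hk, lintegral_indicator measurableSet_Ioi,
      ← Ioc_union_Ioi_eq_Ioi (show (-2 : ℝ) ≤ 0 by norm_num)]
    refine (lintegral_union_le _ _ _).trans_lt (ENNReal.add_lt_top.2 ⟨?_, hX⟩)
    calc ∫⁻ s in Ioc (-2 : ℝ) 0, h s ≤ ∫⁻ s in Ioc (-2 : ℝ) 0, 1 :=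
          lintegral_mono fun s => by
            simpa using ENNReal.rpow_le_rpow (prob_le_one (μ := μ)) hp2
      _ < ∞ := by simp
  have hle : ∀ t, tailProb μ t ^ (p / 2) ≤ k (t - 1) + k (-t - 1) := by
    intro t
    rcases le_total 0 t with ht | ht
    · refine le_add_right (le_of_eq ?_)
      rw [hk, indicator_of_mem (by simp; linarith), tailProb, abs_of_nonneg ht]
    · refine le_add_left (le_of_eq ?_)
      rw [hk, indicator_of_mem (by simp; linarith), tailProb, abs_of_nonpos ht]
  refine ne_of_lt ((lintegral_mono hle).trans_lt ?_)
  have hk1 : Measurable fun t => k (t - 1) := hkm.comp (measurable_id.sub_const 1)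
  rw [lintegral_add_left hk1]
  have e1 : ∫⁻ t, k (t - 1) = ∫⁻ t, k t := lintegral_sub_right_eq_self k 1
  have e2 : ∫⁻ t, k (-t - 1) = ∫⁻ t, k t := by
    rw [← e1]
    exact lintegral_neg_eq_self (fun t => k (t - 1))
  rw [e1, e2]
  exact ENNReal.add_lt_top.2 ⟨hkfin, hkfin⟩

lemma tendsto_lintegral_Ioi {h : ℝ → ℝ≥0∞} (hm : Measurable h)
    (hfin : ∫⁻ t in Ioi (0 : ℝ), h t ≠ ∞) {R : ℕ → ℝ} (hR : Tendsto R atTop atTop)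
    (hR0 : ∀ n, 0 ≤ R n) :
    Tendsto (fun n => ∫⁻ t in Ioi (R n), h t) atTop (𝓝 0) := by
  have e : ∀ n, ∫⁻ t in Ioi (R n), h t =
      ∫⁻ t in Ioi (0 : ℝ), (Ioi (R n)).indicator h t := by
    intro n
    rw [lintegral_indicator measurableSet_Ioi, Measure.restrict_restrict measurableSet_Ioi,
      inter_eq_left.2 (Ioi_subset_Ioi (hR0 n))]
  simp_rw [e]
  have h0 : (0 : ℝ≥0∞) = ∫⁻ t in Ioi (0 : ℝ), (0 : ℝ≥0∞) := by simp
  rw [h0]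
  refine tendsto_lintegral_of_dominated_convergence h (fun n => hm.indicator measurableSet_Ioi)
    (fun n => ae_of_all _ fun t => indicator_le_self _ _ _) hfin (ae_of_all _ fun t => ?_)
  refine tendsto_const_nhds.congr' ?_
  filter_upwards [hR.eventually (eventually_ge_atTop t)] with n hn
  rw [indicator_of_notMem (by simpa using hn)]

/-- Let `h(s) = P(|X| > s)^{p/2}` and `a = n^{p/2}`. Monotonicity gives `(a/2) h(a) ≤ ∫_{a/2}^∞ h →
0`, and `a h(a)` is the `p/2`-th power of the quantity in question. -/
lemma tendsto_natCast_mul_tail (hp : 1 ≤ p) (hX : LorentzCond p μ) :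
    Tendsto (fun n : ℕ => (n : ℝ≥0∞) * μ {x : ℝ | (n : ℝ) ^ (p / 2) < |x|}) atTop (𝓝 0) := by
  have hp2 : 0 < p / 2 := by linarith
  set h : ℝ → ℝ≥0∞ := fun s => (μ {x : ℝ | s < |x|}) ^ (p / 2) with hh
  have hanti : Antitone h := fun a b hab => ENNReal.rpow_le_rpow (antitone_tail μ hab) hp2.le
  have hm : Measurable h := hanti.measurable
  have hR : Tendsto (fun n : ℕ => (n : ℝ) ^ (p / 2) / 2) atTop atTop :=
    ((tendsto_rpow_atTop hp2).comp tendsto_natCast_atTop_atTop).atTop_div_const two_pos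
  have hlim := tendsto_lintegral_Ioi hm (ne_of_lt hX) hR (fun n => by positivity)
  have hle : ∀ n : ℕ, ((n : ℝ≥0∞) * μ {x : ℝ | (n : ℝ) ^ (p / 2) < |x|}) ^ (p / 2) ≤
      2 * ∫⁻ t in Ioi ((n : ℝ) ^ (p / 2) / 2), h t := by
    intro n
    set a : ℝ := (n : ℝ) ^ (p / 2) with ha
    have ha0 : 0 ≤ a := by positivity
    have h1 : ENNReal.ofReal (a / 2) * h a ≤ ∫⁻ t in Ioi (a / 2), h t := by
      calc ENNReal.ofReal (a / 2) * h a = ∫⁻ t in Ioc (a / 2) a, h a := by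
            rw [setLIntegral_const, Real.volume_Ioc, mul_comm]
            congr 2; ring
        _ ≤ ∫⁻ t in Ioc (a / 2) a, h t := setLIntegral_mono hm fun t ht => hanti ht.2
        _ ≤ _ := lintegral_mono_set Ioc_subset_Ioi_self
    have h2 : (n : ℝ≥0∞) ^ (p / 2) = 2 * ENNReal.ofReal (a / 2) := by
      rw [← ENNReal.ofReal_natCast, ENNReal.ofReal_rpow_of_nonneg (Nat.cast_nonneg n) hp2.le,
        show (2 : ℝ≥0∞) = ENNReal.ofReal 2 by simp, ← ENNReal.ofReal_mul two_pos.le]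
      congr 1; rw [ha]; ring
    rw [ENNReal.mul_rpow_of_nonneg _ _ hp2.le, h2, mul_assoc]
    gcongr
  have hlim2 : Tendsto (fun n : ℕ =>
      ((n : ℝ≥0∞) * μ {x : ℝ | (n : ℝ) ^ (p / 2) < |x|}) ^ (p / 2)) atTop (𝓝 0) := by
    refine tendsto_of_tendsto_of_tendsto_of_le_of_le tendsto_const_nhds ?_ (fun n => zero_le) hle
    have := ENNReal.Tendsto.const_mul (a := 2) hlim (Or.inr (by simp))
    simpa using this
  have h3 := ((ENNReal.continuous_rpow_const (y := (p / 2)⁻¹)).tendsto 0).comp hlim2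
  rw [ENNReal.zero_rpow_of_pos (inv_pos.2 hp2)] at h3
  refine h3.congr fun n => ?_
  simp only [Function.comp]
  rw [← ENNReal.rpow_mul, mul_inv_cancel₀ hp2.ne', ENNReal.rpow_one]

lemma ofReal_one_sub_cdf (t : ℝ) : ENNReal.ofReal (1 - cdf μ t) = μ (Ioi t) := by
  conv_rhs => rw [← measure_cdf μ]
  rw [StieltjesFunction.measure_Ioi _ (tendsto_cdf_atTop μ)]

lemma ofReal_cdf_sub (a b : ℝ) : ENNReal.ofReal (cdf μ b - cdf μ a) = μ (Ioc a b) := by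
  conv_rhs => rw [← measure_cdf μ]
  rw [StieltjesFunction.measure_Ioc]

lemma one_sub_cdf_le_tailProb {t : ℝ} (ht : 0 ≤ t) :
    ENNReal.ofReal (1 - cdf μ t) ≤ tailProb μ t := by
  rw [ofReal_one_sub_cdf, tailProb, abs_of_nonneg ht]
  refine measure_mono fun x hx => ?_
  have h1 : t < x := hx
  have := le_abs_self x
  show t - 1 < |x|
  linarith

lemma cdf_le_tailProb {t : ℝ} (ht : t ≤ 0) : ENNReal.ofReal (cdf μ t) ≤ tailProb μ t := by
  rw [ofReal_cdf, tailProb, abs_of_nonpos ht]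
  refine measure_mono fun x hx => ?_
  have h1 : x ≤ t := hx
  have := neg_le_abs x
  show -t - 1 < |x|
  linarith

lemma cdf_mul_one_sub_le_tailProb (t : ℝ) :
    ENNReal.ofReal (cdf μ t * (1 - cdf μ t)) ≤ tailProb μ t := by
  have h0 := cdf_nonneg μ t
  have h1 := cdf_le_one μ t
  rcases le_total 0 t with ht | ht
  · refine (ENNReal.ofReal_le_ofReal ?_).trans (one_sub_cdf_le_tailProb ht)
    nlinarith
  · refine (ENNReal.ofReal_le_ofReal ?_).trans (cdf_le_tailProb ht)
    nlinarith

end Tails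

/-! ### Deviation of the centered indicators from their cell averages -/

section Deviation

variable {μ : Measure ℝ} [IsProbabilityMeasure μ] {p : ℝ}

/-- The deviation of the centered indicator process from its cellwise averages. -/
noncomputable def gridDev (μ : Measure ℝ) (j : ℕ) (t x : ℝ) : ℝ :=
  centeredInd μ t x - averaging j (fun s => centeredInd μ s x) t

/-- A bound for the variance of `gridDev`. -/
noncomputable def gridVar (μ : Measure ℝ) (j : ℕ) (t : ℝ) : ℝ :=
  if cellIndex j t ∈ cells j then
    cdf μ ((cellIndex j t + 1 : ℝ) / (j + 1)) - cdf μ ((cellIndex j t : ℝ) / (j + 1))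
  else cdf μ t * (1 - cdf μ t)

lemma isFiniteMeasure_restrict_cell (j : ℕ) (i : ℤ) :
    IsFiniteMeasure ((volume : Measure ℝ).restrict (cell j i)) :=
  ⟨by simpa using (volume_cell_ne_top j i).lt_top⟩

lemma integrableOn_cell_of_bound {f : ℝ → ℝ} (hf : Measurable f) {B : ℝ} (hB : ∀ x, |f x| ≤ B)
    (j : ℕ) (i : ℤ) : IntegrableOn f (cell j i) := by
  have := isFiniteMeasure_restrict_cell j i
  exact Integrable.of_bound hf.aestronglyMeasurable B (ae_of_all _ hB)

lemma measurable_centeredInd_right (μ : Measure ℝ) (x : ℝ) :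
    Measurable (fun s => centeredInd μ s x) :=
  (measurable_centeredInd μ).comp measurable_prodMk_left

lemma integrableOn_centeredInd (x : ℝ) (j : ℕ) (i : ℤ) :
    IntegrableOn (fun s => centeredInd μ s x) (cell j i) :=
  integrableOn_cell_of_bound (measurable_centeredInd_right μ x)
    (fun s => abs_centeredInd_le s x) j i

lemma measurable_cellAvg_centeredInd (μ : Measure ℝ) (j : ℕ) (i : ℤ) :
    Measurable (fun x => cellAvg j i (fun s => centeredInd μ s x)) := by
  unfold cellAvg
  refine Measurable.const_mul ?_ _
  exact ((measurable_centeredInd μ).stronglyMeasurable.integral_prod_right'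
    (ν := volume.restrict (cell j i))).measurable

lemma abs_cellAvg_centeredInd_le (j : ℕ) (i : ℤ) (x : ℝ) :
    |cellAvg j i (fun s => centeredInd μ s x)| ≤ 1 := by
  have := abs_cellAvg_sub_le (integrableOn_centeredInd (μ := μ) x j i) (c := 0) (ε := 1)
    fun s _ => by simpa using abs_centeredInd_le s x
  simpa using this

lemma measurable_gridDev (μ : Measure ℝ) (j : ℕ) :
    Measurable (fun z : ℝ × ℝ => gridDev μ j z.2 z.1) := by
  unfold gridDev averaging
  refine (measurable_centeredInd μ).sub (Finset.measurable_fun_sum _ fun i _ => ?_)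
  exact ((measurable_cellAvg_centeredInd μ j i).comp measurable_fst).mul
    ((measurable_const.indicator (measurableSet_cell j i)).comp measurable_snd)

lemma measurable_gridDev_left (μ : Measure ℝ) (j : ℕ) (t : ℝ) : Measurable (gridDev μ j t) :=
  (measurable_gridDev μ j).comp measurable_prodMk_right

lemma gridDev_of_notMem {j : ℕ} {t : ℝ} (ht : cellIndex j t ∉ cells j) (x : ℝ) :
    gridDev μ j t x = centeredInd μ t x := by
  rw [gridDev, averaging_apply_of_notMem ht, sub_zero]

lemma gridDev_of_mem {j : ℕ} {t : ℝ} (ht : cellIndex j t ∈ cells j) (x : ℝ) :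
    gridDev μ j t x = centeredInd μ t x - cellAvg j (cellIndex j t) (fun s => centeredInd μ s x) := by
  rw [gridDev, averaging_apply_of_mem ht (mem_cell_cellIndex j t)]

lemma abs_gridDev_le (j : ℕ) (t x : ℝ) : |gridDev μ j t x| ≤ 2 := by
  have h1 := abs_centeredInd_le (μ := μ) t x
  by_cases ht : cellIndex j t ∈ cells j
  · rw [gridDev_of_mem ht]
    have h2 := abs_cellAvg_centeredInd_le (μ := μ) j (cellIndex j t) x
    have := abs_sub (centeredInd μ t x) (cellAvg j (cellIndex j t) (fun s => centeredInd μ s x))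
    linarith
  · rw [gridDev_of_notMem ht]; linarith

lemma integral_cellAvg_centeredInd (j : ℕ) (i : ℤ) :
    ∫ x, cellAvg j i (fun s => centeredInd μ s x) ∂μ = 0 := by
  have := isFiniteMeasure_restrict_cell j i
  unfold cellAvg
  have hint : Integrable (fun z : ℝ × ℝ => centeredInd μ z.2 z.1)
      (μ.prod (volume.restrict (cell j i))) :=
    Integrable.of_bound (measurable_centeredInd μ).aestronglyMeasurable 1
      (ae_of_all _ fun z => abs_centeredInd_le z.2 z.1)
  rw [integral_const_mul, integral_integral_swap (f := fun x s => centeredInd μ s x) hint]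
  simp_rw [integral_centeredInd]
  simp

lemma memLp_gridDev (j : ℕ) (t : ℝ) (q : ℝ≥0∞) : MemLp (gridDev μ j t) q μ :=
  MemLp.of_bound (measurable_gridDev_left μ j t).aestronglyMeasurable 2
    (ae_of_all _ fun x => abs_gridDev_le j t x)

lemma integral_gridDev (j : ℕ) (t : ℝ) : ∫ x, gridDev μ j t x ∂μ = 0 := by
  by_cases ht : cellIndex j t ∈ cells j
  · simp_rw [gridDev_of_mem ht]
    rw [integral_sub ((memLp_centeredInd t 1).integrable le_rfl), integral_centeredInd,
      integral_cellAvg_centeredInd, sub_zero]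
    exact Integrable.of_bound (measurable_cellAvg_centeredInd μ j _).aestronglyMeasurable 1
      (ae_of_all _ fun x => abs_cellAvg_centeredInd_le j _ x)
  · simp_rw [gridDev_of_notMem ht]
    exact integral_centeredInd t

lemma measurable_indicator_Iic (x : ℝ) :
    Measurable (fun s : ℝ => (Iic s).indicator (fun _ => (1 : ℝ)) x) := by
  have : (fun s : ℝ => (Iic s).indicator (fun _ => (1 : ℝ)) x) =
      (Ici x).indicator (fun _ => (1 : ℝ)) := by
    funext s; simp [indicator]
  rw [this]
  exact measurable_const.indicator measurableSet_Ici

/-- As `s` runs through a cell, `1_{x ≤ s}` is constant unless `x` lies in that cell, and otherwise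
it varies by at most 1. -/
lemma abs_indicator_sub_le {t x : ℝ} {j : ℕ} {i : ℤ} (ht : t ∈ cell j i) :
    |(Iic t).indicator (fun _ => (1 : ℝ)) x -
      cellAvg j i (fun s => (Iic s).indicator (fun _ => (1 : ℝ)) x)| ≤
      (cell j i).indicator (fun _ => (1 : ℝ)) x := by
  have hint : IntegrableOn (fun s => (Iic s).indicator (fun _ => (1 : ℝ)) x) (cell j i) :=
    integrableOn_cell_of_bound (measurable_indicator_Iic x) (B := 1)
      (fun s => by by_cases h : x ≤ s <;> simp [indicator, h]) j i
  rw [abs_sub_comm]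
  refine abs_cellAvg_sub_le hint fun s hs => ?_
  by_cases hx : x ∈ cell j i
  · rw [indicator_of_mem hx]
    by_cases h1 : x ≤ s <;> by_cases h2 : x ≤ t <;> simp [indicator, h1, h2]
  · rw [indicator_of_notMem hx]
    rw [cell, mem_Ioc, not_and_or, not_lt, not_le] at hx
    rcases hx with hx | hx
    · have h1 : x ≤ s := hx.trans hs.1.le
      have h2 : x ≤ t := hx.trans ht.1.le
      simp [indicator, h1, h2]
    · have h1 : ¬ x ≤ s := not_le.2 (lt_of_le_of_lt hs.2 hx)
      have h2 : ¬ x ≤ t := not_le.2 (lt_of_le_of_lt ht.2 hx)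
      simp [indicator, h1, h2]

lemma integral_gridDev_sq_le (j : ℕ) (t : ℝ) : ∫ x, gridDev μ j t x ^ 2 ∂μ ≤ gridVar μ j t := by
  by_cases ht : cellIndex j t ∈ cells j
  · rw [gridVar, if_pos ht]
    have htc := mem_cell_cellIndex j t
    set i := cellIndex j t with hi
    -- Adding `c` removes the centering. The second moment of the uncentered deviation is larger by
    -- `c²`, and it is at most the mass of the cell.
    set c : ℝ := cdf μ t - cellAvg j i (cdf μ) with hc
    set u : ℝ → ℝ := fun x => gridDev μ j t x + c with hu
    have hcdf : ∀ x, |cdf μ x| ≤ 1 := fun x => by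
      rw [abs_of_nonneg (cdf_nonneg μ x)]; exact cdf_le_one μ x
    have huval : ∀ x, u x = (Iic t).indicator (fun _ => (1 : ℝ)) x -
        cellAvg j i (fun s => (Iic s).indicator (fun _ => (1 : ℝ)) x) := by
      intro x
      have h1 : cellAvg j i (fun s => centeredInd μ s x) =
          cellAvg j i (fun s => (Iic s).indicator (fun _ => (1 : ℝ)) x) - cellAvg j i (cdf μ) :=
        cellAvg_sub (integrableOn_cell_of_bound (measurable_indicator_Iic x) (B := 1)
            (fun s => by by_cases h : x ≤ s <;> simp [indicator, h]) j i)
          (integrableOn_cell_of_bound (measurable_cdf' μ) hcdf j i)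
      show gridDev μ j t x + c = _
      rw [gridDev_of_mem ht, ← hi, h1, hc, centeredInd]
      ring
    have hub : ∀ x, |u x| ≤ (cell j i).indicator (fun _ => (1 : ℝ)) x := fun x => by
      rw [huval]; exact abs_indicator_sub_le htc
    have hgi := (memLp_gridDev (μ := μ) j t 1).integrable le_rfl
    have hg2 := (memLp_gridDev (μ := μ) j t 2).integrable_sq
    have h1 : ∫ x, gridDev μ j t x ^ 2 ∂μ = ∫ x, u x ^ 2 ∂μ - c ^ 2 := by
      have e : ∀ x, u x ^ 2 = gridDev μ j t x ^ 2 + (2 * c * gridDev μ j t x + c ^ 2) := by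
        intro x; simp only [hu]; ring
      simp_rw [e]
      have hi2 : Integrable (fun x => 2 * c * gridDev μ j t x + c ^ 2) μ :=
        (hgi.const_mul _).add (integrable_const _)
      rw [integral_add hg2 hi2, integral_add (hgi.const_mul _) (integrable_const _),
        integral_const_mul, integral_gridDev]
      simp
    have hci : Integrable ((cell j i).indicator (fun _ => (1 : ℝ))) μ :=
      (integrable_const 1).indicator (measurableSet_cell j i)
    have h2 : ∫ x, u x ^ 2 ∂μ ≤ ∫ x, (cell j i).indicator (fun _ => (1 : ℝ)) x ∂μ := by
      refine integral_mono_of_nonneg (ae_of_all _ fun x => sq_nonneg _) hci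
        (ae_of_all _ fun x => ?_)
      have h3 := hub x
      simp only
      rw [← sq_abs]
      by_cases hx : x ∈ cell j i
      · rw [indicator_of_mem hx] at h3 ⊢
        nlinarith [abs_nonneg (u x)]
      · rw [indicator_of_notMem hx] at h3 ⊢
        nlinarith [abs_nonneg (u x)]
    have h3 : ∫ x, (cell j i).indicator (fun _ => (1 : ℝ)) x ∂μ =
        cdf μ ((i + 1 : ℝ) / (j + 1)) - cdf μ ((i : ℝ) / (j + 1)) := by
      rw [integral_indicator_const _ (measurableSet_cell j i), smul_eq_mul, mul_one,
        measureReal_def, cell, ← ofReal_cdf_sub, ENNReal.toReal_ofReal]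
      exact sub_nonneg.2 (monotone_cdf μ (by gcongr; linarith))
    rw [← h3]
    linarith [sq_nonneg c]
  · rw [gridVar, if_neg ht]
    simp_rw [gridDev_of_notMem ht]
    rw [integral_centeredInd_sq]

/-- This is a domination that does not depend on the grid: a cell containing `t` has width at most
1, so it lies in `{x : |x| > |t| - 1}`. -/
lemma ofReal_gridVar_le_tailProb (j : ℕ) (t : ℝ) :
    ENNReal.ofReal (gridVar μ j t) ≤ tailProb μ t := by
  by_cases ht : cellIndex j t ∈ cells j
  · rw [gridVar, if_pos ht, ofReal_cdf_sub, tailProb]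
    refine measure_mono fun x hx => ?_
    have h1 := abs_sub_le_of_mem_cell (j := j) (i := cellIndex j t) hx (mem_cell_cellIndex j t)
    have h2 : 1 / ((j : ℝ) + 1) ≤ 1 := by
      rw [div_le_one (by positivity)]
      have : (0 : ℝ) ≤ j := by positivity
      linarith
    have hx1 : (cellIndex j t : ℝ) / (j + 1) < x := hx.1
    have htc := mem_cell_cellIndex j t
    show |t| - 1 < |x|
    rw [cell, mem_Ioc] at htc
    have e : ((cellIndex j t + 1 : ℝ) / (j + 1)) =
      (cellIndex j t : ℝ) / (j + 1) + 1 / (j + 1) := by ring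
    have hx2 : x ≤ (cellIndex j t + 1 : ℝ) / (j + 1) := hx.2
    rw [e] at hx2 htc
    rcases le_total 0 t with h0 | h0
    · rw [abs_of_nonneg h0]
      have := le_abs_self x
      linarith
    · rw [abs_of_nonpos h0]
      have := neg_le_abs x
      linarith
  · rw [gridVar, if_neg ht]
    exact cdf_mul_one_sub_le_tailProb t

/-- Both endpoints of the cell containing `t` tend to `t`, and for large `j` the point is covered by
`cells j`. -/
lemma tendsto_gridVar {t : ℝ} (ht : ContinuousAt (cdf μ) t) :
    Tendsto (fun j => gridVar μ j t) atTop (𝓝 0) := by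
  have h1 : Tendsto (fun j : ℕ => 1 / ((j : ℝ) + 1)) atTop (𝓝 0) :=
    tendsto_one_div_add_atTop_nhds_zero_nat
  have hcell : ∀ j : ℕ, t ∈ cell j (cellIndex j t) := fun j => mem_cell_cellIndex j t
  have e : ∀ j : ℕ, ((cellIndex j t + 1 : ℝ) / (j + 1)) =
      (cellIndex j t : ℝ) / (j + 1) + 1 / (j + 1) := fun j => by ring
  have hl : Tendsto (fun j : ℕ => (cellIndex j t : ℝ) / (j + 1)) atTop (𝓝 t) := by
    have h2 : Tendsto (fun j : ℕ => t - 1 / ((j : ℝ) + 1)) atTop (𝓝 t) := by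
      simpa using h1.const_sub t
    refine tendsto_of_tendsto_of_tendsto_of_le_of_le h2 tendsto_const_nhds (fun j => ?_)
      fun j => (hcell j).1.le
    have := (hcell j).2
    rw [e] at this
    simp only
    linarith
  have hr : Tendsto (fun j : ℕ => (cellIndex j t + 1 : ℝ) / (j + 1)) atTop (𝓝 t) := by
    simp_rw [e]
    simpa using hl.add h1
  have h3 := (ht.tendsto.comp hr).sub (ht.tendsto.comp hl)
  rw [sub_self] at h3
  refine h3.congr' ?_
  obtain ⟨m, hm⟩ := exists_nat_gt |t|
  filter_upwards [eventually_ge_atTop m] with j hj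
  have : cellIndex j t ∈ cells j := by
    rw [cellIndex_mem_cells]
    have h4 : (m : ℝ) ≤ j := by exact_mod_cast hj
    have h5 := abs_lt.1 hm
    constructor <;> linarith [h5.1, h5.2]
  rw [gridVar, if_pos this]
  rfl

lemma measurable_cellIndex (j : ℕ) : Measurable (cellIndex j) :=
  (Int.measurable_ceil.comp (measurable_id.mul_const _)).sub_const 1

lemma measurable_gridVar (μ : Measure ℝ) (j : ℕ) : Measurable (gridVar μ j) := by
  have hm := measurable_cellIndex j
  have hmr : Measurable fun t => (cellIndex j t : ℝ) := measurable_from_top.comp hm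
  unfold gridVar
  refine Measurable.ite (hm (MeasurableSet.of_discrete (s := {i : ℤ | i ∈ cells j}))) ?_ ?_
  · exact ((measurable_cdf' μ).comp ((hmr.add_const 1).div_const _)).sub
      ((measurable_cdf' μ).comp (hmr.div_const _))
  · exact (measurable_cdf' μ).mul (measurable_const.sub (measurable_cdf' μ))

/-- The total deviation tends to zero as the grid is refined. -/
lemma tendsto_lintegral_gridVar (hp : 1 ≤ p) (hX : LorentzCond p μ) :
    Tendsto (fun j => ∫⁻ t, ENNReal.ofReal (gridVar μ j t) ^ (p / 2)) atTop (𝓝 0) := by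
  have hp2 : 0 < p / 2 := by linarith
  have h0 : (0 : ℝ≥0∞) = ∫⁻ _ : ℝ, (0 : ℝ≥0∞) := by simp
  rw [h0]
  refine tendsto_lintegral_of_dominated_convergence (fun t => tailProb μ t ^ (p / 2))
    (fun j => (measurable_gridVar μ j).ennreal_ofReal.pow_const _)
    (fun j => ae_of_all _ fun t => ENNReal.rpow_le_rpow (ofReal_gridVar_le_tailProb j t) hp2.le)
    (lintegral_tailProb_ne_top hp hX) ?_
  have hc : ∀ᵐ t : ℝ, ContinuousAt (cdf μ) t := by
    have := (monotone_cdf μ).countable_not_continuousAt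
    exact ae_iff.2 (this.measure_zero volume)
  filter_upwards [hc] with t ht
  have h1 := (ENNReal.continuous_ofReal.tendsto 0).comp (tendsto_gridVar ht)
  rw [ENNReal.ofReal_zero] at h1
  have h2 := ((ENNReal.continuous_rpow_const (y := p / 2)).tendsto 0).comp h1
  rwa [ENNReal.zero_rpow_of_pos hp2] at h2

end Deviation


/-! ### Uniform approximation of the empirical process by cell averages -/

section EmpiricalTightness

variable {Ω : Type*} [MeasurableSpace Ω] {P : Measure Ω} [IsProbabilityMeasure P]
  {μ : Measure ℝ} [IsProbabilityMeasure μ] {X : ℕ → Ω → ℝ} {p : ℝ}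

lemma aemeasurable_normSum_process (hX : ∀ i, HasLaw (X i) μ P) {ξ : ℝ → ℝ → ℝ}
    (hξ : Measurable (fun z : ℝ × ℝ => ξ z.2 z.1)) (n : ℕ) (ν : Measure ℝ) [SFinite ν] :
    AEMeasurable (fun z : Ω × ℝ => normSum X (ξ z.2) n z.1) (P.prod ν) := by
  unfold normSum
  refine AEMeasurable.const_mul (Finset.aemeasurable_fun_sum _ fun i _ => ?_) _
  exact hξ.comp_aemeasurable
    (((hX i).aemeasurable.comp_fst (ν := ν)).prodMk measurable_snd.aemeasurable)

lemma ofReal_sqrt_rpow {v : ℝ} (hv : 0 ≤ v) (p : ℝ) :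
    ENNReal.ofReal √v ^ p = ENNReal.ofReal v ^ (p / 2) := by
  rw [Real.sqrt_eq_rpow, ← ENNReal.ofReal_rpow_of_nonneg hv (by norm_num), ← ENNReal.rpow_mul]
  congr 1; ring

lemma gridVar_nonneg (j : ℕ) (t : ℝ) : 0 ≤ gridVar μ j t :=
  (integral_nonneg fun _ => sq_nonneg _).trans (integral_gridDev_sq_le j t)

/-- Half the length of the window on which moment bounds are used at sample size `n`. -/
noncomputable def window (p : ℝ) (n : ℕ) : ℝ := (n : ℝ) ^ (p / 2) + 1

/-- Hölder's inequality with exponent `p/2`: the length of the window enters as at most `4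
n^{p/2-1}`, which compensates the factor `n^{1-p/2}` exactly. This dictates the size of the window.
-/
lemma lintegral_window_le (hp : 2 < p) {g : ℝ → ℝ≥0∞} (hg : Measurable g) {n : ℕ} (hn : 0 < n) :
    ENNReal.ofReal ((n : ℝ) ^ (1 - p / 2)) * ∫⁻ t in Icc (-window p n) (window p n), g t ≤
      4 * (∫⁻ t, g t ^ (p / 2)) ^ (2 / p) := by
  have hp0 : 0 < p := by linarith
  have hn1 : (1 : ℝ) ≤ n := by exact_mod_cast hn
  have hn0 : (0 : ℝ) < n := by linarith
  have hconj : (p / 2).HolderConjugate (p / 2 / (p / 2 - 1)) :=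
    Real.HolderConjugate.conjExponent (by linarith)
  set S : Set ℝ := Icc (-window p n) (window p n) with hS
  have h1 := ENNReal.lintegral_mul_le_Lp_mul_Lq (volume.restrict S) hconj hg.aemeasurable
    (aemeasurable_const (b := (1 : ℝ≥0∞)))
  simp only [Pi.mul_apply, mul_one, ENNReal.one_rpow, lintegral_one,
    Measure.restrict_apply_univ] at h1
  have hpow : (1 : ℝ) ≤ (n : ℝ) ^ (p / 2) := Real.one_le_rpow hn1 (by linarith)
  have hvol : volume S ≤ ENNReal.ofReal (4 * (n : ℝ) ^ (p / 2)) := by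
    rw [hS, Real.volume_Icc]
    refine ENNReal.ofReal_le_ofReal ?_
    unfold window; linarith
  have he : (1 : ℝ) / (p / 2 / (p / 2 - 1)) = 1 - 2 / p := by
    field_simp
  have he0 : 0 ≤ 1 - 2 / p := by
    rw [sub_nonneg, div_le_one hp0]; exact hp.le
  rw [he] at h1
  have h2 : volume S ^ (1 - 2 / p) ≤ ENNReal.ofReal (4 * (n : ℝ) ^ (p / 2 - 1)) := by
    refine (ENNReal.rpow_le_rpow hvol he0).trans ?_
    rw [ENNReal.ofReal_rpow_of_nonneg (by positivity) he0]
    refine ENNReal.ofReal_le_ofReal ?_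
    rw [Real.mul_rpow (by norm_num) (by positivity), ← Real.rpow_mul hn0.le]
    have e : p / 2 * (1 - 2 / p) = p / 2 - 1 := by field_simp
    rw [e]
    have : (4 : ℝ) ^ (1 - 2 / p) ≤ 4 ^ (1 : ℝ) :=
      Real.rpow_le_rpow_of_exponent_le (by norm_num) (by
        have : 0 ≤ 2 / p := by positivity
        linarith)
    rw [Real.rpow_one] at this
    gcongr
  have e2 : (1 : ℝ) / (p / 2) = 2 / p := by field_simp
  rw [e2] at h1
  calc _ ≤ ENNReal.ofReal ((n : ℝ) ^ (1 - p / 2)) *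
        ((∫⁻ t, g t ^ (p / 2)) ^ (2 / p) * ENNReal.ofReal (4 * (n : ℝ) ^ (p / 2 - 1))) := by
        refine mul_le_mul_right (h1.trans ?_) _
        gcongr
        exact Measure.restrict_le_self
    _ = (ENNReal.ofReal ((n : ℝ) ^ (1 - p / 2)) * ENNReal.ofReal (4 * (n : ℝ) ^ (p / 2 - 1))) *
        (∫⁻ t, g t ^ (p / 2)) ^ (2 / p) := by ring
    _ = _ := by
      rw [← ENNReal.ofReal_mul (by positivity)]
      have : (n : ℝ) ^ (1 - p / 2) * (4 * (n : ℝ) ^ (p / 2 - 1)) = 4 := by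
        rw [mul_left_comm, ← Real.rpow_add hn0]
        simp
      rw [this]; simp

/-- The moments of the grid deviations over the window, in terms of their total variance. -/
lemma exists_lintegral_window_le (hp : 1 ≤ p) (hX : ∀ i, HasLaw (X i) μ P) (hind : iIndepFun X P) :
    ∃ γ : ℝ≥0∞ → ℝ≥0∞, Tendsto γ (𝓝 0) (𝓝 0) ∧ ∀ j n : ℕ, 0 < n →
      ∫⁻ t in Icc (-window p n) (window p n), ∫⁻ ω, ‖normSum X (gridDev μ j t) n ω‖ₑ ^ p ∂P ≤
        γ (∫⁻ t, ENNReal.ofReal (gridVar μ j t) ^ (p / 2)) := by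
  have hp0 : 0 < p := by linarith
  rcases le_or_gt p 2 with hp2 | hp2
  -- For `p ≤ 2` the moment is at most the variance to the power `p/2`, and the window plays no
  -- role.
  · refine ⟨id, tendsto_id, fun j n hn => ?_⟩
    refine (setLIntegral_le_lintegral _ _).trans (lintegral_mono fun t => ?_)
    refine (lintegral_normSum_rpow_le_of_le_two hX hind (memLp_gridDev j t 2) (integral_gridDev j t)
      hp hp2 n).trans ?_
    rw [← ofReal_sqrt_rpow (gridVar_nonneg j t)]
    gcongr
    exact integral_gridDev_sq_le j t
  · obtain ⟨C, hC, hmom⟩ := exists_lintegral_normSum_rpow_le hp2.le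
    -- The first term is the `v^{p/2}` part of the moment bound; the second is its `n^{1-p/2} v`
    -- part after Hölder's inequality on the window.
    refine ⟨fun β => ENNReal.ofReal C * (β + 4 * β ^ (2 / p)), ?_, fun j n hn => ?_⟩
    · have h1 := (ENNReal.continuous_rpow_const (y := 2 / p)).tendsto 0
      rw [ENNReal.zero_rpow_of_pos (by positivity)] at h1
      have h2 := ENNReal.Tendsto.const_mul (a := ENNReal.ofReal C)
        ((tendsto_id (α := ℝ≥0∞) (x := 𝓝 0)).add
          (ENNReal.Tendsto.const_mul (a := 4) h1 (Or.inr (by simp)))) (Or.inr (by simp))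
      simpa using h2
    · set g : ℝ → ℝ≥0∞ := fun t => ENNReal.ofReal (gridVar μ j t) with hg
      have hgm : Measurable g := (measurable_gridVar μ j).ennreal_ofReal
      have hpt : ∀ t, ∫⁻ ω, ‖normSum X (gridDev μ j t) n ω‖ₑ ^ p ∂P ≤
          ENNReal.ofReal C * (g t ^ (p / 2) + ENNReal.ofReal ((n : ℝ) ^ (1 - p / 2)) * g t) := by
        intro t
        refine (hmom Ω P μ X hX hind _ (measurable_gridDev_left μ j t)
          (fun x => abs_gridDev_le j t x) (integral_gridDev j t) n hn).trans ?_
        have hv := integral_gridDev_sq_le (μ := μ) j t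
        have hv0 : 0 ≤ ∫ x, gridDev μ j t x ^ 2 ∂μ := integral_nonneg fun _ => sq_nonneg _
        have hgv := gridVar_nonneg (μ := μ) j t
        rw [hg, ← ofReal_sqrt_rpow hgv,
          ENNReal.ofReal_rpow_of_nonneg (Real.sqrt_nonneg _) hp0.le,
          ← ENNReal.ofReal_mul (by positivity), ← ENNReal.ofReal_add (by positivity) (by positivity),
          ← ENNReal.ofReal_mul hC.le]
        refine ENNReal.ofReal_le_ofReal ?_
        gcongr
      calc _ ≤ ∫⁻ t in Icc (-window p n) (window p n),
            ENNReal.ofReal C * (g t ^ (p / 2) + ENNReal.ofReal ((n : ℝ) ^ (1 - p / 2)) * g t) :=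
            lintegral_mono hpt
        _ = ENNReal.ofReal C * ((∫⁻ t in Icc (-window p n) (window p n), g t ^ (p / 2)) +
            ENNReal.ofReal ((n : ℝ) ^ (1 - p / 2)) *
              ∫⁻ t in Icc (-window p n) (window p n), g t) := by
            rw [lintegral_const_mul' _ _ ENNReal.ofReal_ne_top,
              lintegral_add_left (hgm.pow_const _), lintegral_const_mul' _ _ ENNReal.ofReal_ne_top]
        _ ≤ _ := by
            exact mul_le_mul_right (add_le_add (lintegral_mono' Measure.restrict_le_self le_rfl)
              (lintegral_window_le hp2 hgm hn)) _

lemma normSum_const_of_forall {ξ : ℝ → ℝ} {n : ℕ} {ω : Ω} {c : ℝ}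
    (h : ∀ i ∈ Finset.range n, ξ (X i ω) = c) : normSum X ξ n ω = √(n : ℝ) * c := by
  rw [normSum, Finset.sum_congr rfl h, Finset.sum_const, Finset.card_range, nsmul_eq_mul]
  rcases Nat.eq_zero_or_pos n with rfl | hn
  · simp
  have hs : 0 < √(n : ℝ) := Real.sqrt_pos.2 (by exact_mod_cast hn)
  rw [← mul_assoc]
  congr 1
  rw [inv_mul_eq_div, div_eq_iff hs.ne', Real.mul_self_sqrt (Nat.cast_nonneg n)]

/-- Beyond all observations the empirical distribution function is exactly 1 on the right and 0 on
the left, so the process reduces to `√n` times a tail of `F`. -/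
lemma enorm_normSum_centeredInd_le {n : ℕ} {ω : Ω} {a t : ℝ} (ha : ∀ i < n, |X i ω| ≤ a)
    (ht : a < |t|) :
    ‖normSum X (centeredInd μ t) n ω‖ₑ ≤ ENNReal.ofReal √(n : ℝ) * tailProb μ t := by
  rcases le_total 0 t with h0 | h0
  · rw [abs_of_nonneg h0] at ht
    have hval : ∀ i ∈ Finset.range n, centeredInd μ t (X i ω) = 1 - cdf μ t := by
      intro i hi
      have := (le_abs_self (X i ω)).trans (ha i (Finset.mem_range.1 hi))
      rw [centeredInd, indicator_of_mem (show X i ω ∈ Iic t by simp; linarith)]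
    have h1 := cdf_le_one μ t
    rw [normSum_const_of_forall hval, Real.enorm_eq_ofReal
      (mul_nonneg (Real.sqrt_nonneg _) (by linarith)), ENNReal.ofReal_mul (Real.sqrt_nonneg _)]
    gcongr
    exact one_sub_cdf_le_tailProb h0
  · rw [abs_of_nonpos h0] at ht
    have hval : ∀ i ∈ Finset.range n, centeredInd μ t (X i ω) = -cdf μ t := by
      intro i hi
      have := (neg_le_abs (X i ω)).trans (ha i (Finset.mem_range.1 hi))
      rw [centeredInd, indicator_of_notMem (show X i ω ∉ Iic t by simp; linarith), zero_sub]
    rw [normSum_const_of_forall hval, mul_neg, enorm_neg, Real.enorm_eq_ofReal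
      (mul_nonneg (Real.sqrt_nonneg _) (cdf_nonneg μ t)), ENNReal.ofReal_mul (Real.sqrt_nonneg _)]
    gcongr
    exact cdf_le_tailProb h0

/-- The part of the grid deviation outside the window. -/
lemma lintegral_compl_window_le (hp : 1 ≤ p) {j n : ℕ} {ω : Ω}
    (hj : (j : ℝ) ≤ (n : ℝ) ^ (p / 2)) (ha : ∀ i < n, |X i ω| ≤ (n : ℝ) ^ (p / 2)) :
    ∫⁻ t in (Icc (-window p n) (window p n))ᶜ, ‖normSum X (gridDev μ j t) n ω‖ₑ ^ p ≤
      ((n : ℝ≥0∞) * μ {x : ℝ | (n : ℝ) ^ (p / 2) < |x|}) ^ (p / 2) *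
        ∫⁻ t, tailProb μ t ^ (p / 2) := by
  have hp0 : 0 < p := by linarith
  rw [← lintegral_const_mul _ ((measurable_tailProb μ).pow_const _)]
  refine (setLIntegral_mono ((((measurable_tailProb μ).pow_const _)).const_mul _)
    fun t ht => ?_).trans (setLIntegral_le_lintegral _ _)
  have htw : window p n < |t| := by
    by_contra h
    exact ht (abs_le.1 (not_lt.1 h))
  unfold window at htw
  -- The window contains all cells since `j ≤ n^{p/2}`, so outside it the averages are zero.
  have hcell : cellIndex j t ∉ cells j := by
    rw [cellIndex_mem_cells]
    intro h
    have : |t| ≤ j + 1 := abs_le.2 ⟨h.1.le, h.2⟩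
    linarith
  have e : gridDev μ j t = centeredInd μ t := funext fun x => gridDev_of_notMem hcell x
  rw [e]
  -- The tail occurs in total to the power `p`. One half of the power is bounded by its value at the
  -- edge of the window and absorbs `n^{p/2}`; the other half is integrated.
  have hle : tailProb μ t ≤ μ {x : ℝ | (n : ℝ) ^ (p / 2) < |x|} :=
    antitone_tail μ (by linarith : (n : ℝ) ^ (p / 2) ≤ |t| - 1)
  calc _ ≤ (ENNReal.ofReal √(n : ℝ) * tailProb μ t) ^ p :=
        ENNReal.rpow_le_rpow (enorm_normSum_centeredInd_le ha (by linarith)) hp0.le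
    _ = ((n : ℝ≥0∞) * tailProb μ t) ^ (p / 2) * tailProb μ t ^ (p / 2) := by
        rw [ENNReal.mul_rpow_of_nonneg _ _ hp0.le, ofReal_sqrt_rpow (Nat.cast_nonneg n),
          ENNReal.ofReal_natCast, ENNReal.mul_rpow_of_nonneg _ _ (by positivity), mul_assoc,
          ← ENNReal.rpow_add_of_nonneg _ _ (by positivity) (by positivity), add_halves]
    _ ≤ _ := by gcongr

lemma measure_exists_lt_abs_le (hX : ∀ i, HasLaw (X i) μ P) (n : ℕ) (a : ℝ) :
    P {ω | ¬ ∀ i < n, |X i ω| ≤ a} ≤ n * μ {x : ℝ | a < |x|} := by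
  have hs : MeasurableSet {x : ℝ | a < |x|} := measurableSet_lt measurable_const measurable_id.abs
  have hsub : {ω | ¬ ∀ i < n, |X i ω| ≤ a} ⊆ ⋃ i ∈ Finset.range n, (X i) ⁻¹' {x | a < |x|} := by
    intro ω hω
    obtain ⟨i, hi⟩ := not_forall.1 hω
    obtain ⟨h1, h2⟩ := Classical.not_imp.1 hi
    exact mem_iUnion₂.2 ⟨i, Finset.mem_range.2 h1, not_le.1 h2⟩
  refine (measure_mono hsub).trans ((measure_biUnion_finset_le _ _).trans (le_of_eq ?_))
  rw [Finset.sum_congr rfl fun i _ => by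
    rw [← Measure.map_apply_of_aemeasurable (hX i).aemeasurable hs, (hX i).map_eq]]
  simp

/-- Asymptotic uniform approximability of the empirical process by its cellwise averages. -/
theorem eventually_measure_gridDev_le (hp : 1 ≤ p) (hL : LorentzCond p μ)
    (hX : ∀ i, HasLaw (X i) μ P) (hind : iIndepFun X P) {ε δ : ℝ≥0∞} (hε : 0 < ε) (hδ : 0 < δ) :
    ∀ᶠ j in atTop, ∀ᶠ n in atTop,
      P {ω | ε < eLpNorm (fun t => normSum X (gridDev μ j t) n ω) (ENNReal.ofReal p) volume} ≤ δ := by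
  have hp0 : 0 < p := by linarith
  wlog hεt : ε ≠ ∞ generalizing ε
  · filter_upwards with j
    filter_upwards with n
    rw [not_not] at hεt
    simp [hεt]
  obtain ⟨γ, hγ, hbound⟩ := exists_lintegral_window_le (p := p) hp hX hind
  -- Half of `ε^p` is allotted to the window, by Markov's inequality, and half to its complement,
  -- where the bound is deterministic once no observation exceeds `n^{p/2}` in absolute value.
  set η : ℝ≥0∞ := ε ^ p / 2 with hη
  have hη0 : η ≠ 0 := (ENNReal.div_pos (ENNReal.rpow_pos hε hεt).ne' (by simp)).ne'
  have hηt : η ≠ ∞ := ENNReal.div_ne_top (ENNReal.rpow_ne_top_of_nonneg hp0.le hεt) (by simp)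
  have hδ2 : 0 < δ / 2 := ENNReal.half_pos hδ.ne'
  have hlim : Tendsto (fun j => γ (∫⁻ t, ENNReal.ofReal (gridVar μ j t) ^ (p / 2)) / η) atTop
      (𝓝 0) := by
    have := ENNReal.Tendsto.div_const (b := η) (hγ.comp (tendsto_lintegral_gridVar hp hL))
      (Or.inr hη0)
    simpa using this
  have htail := tendsto_natCast_mul_tail hp hL
  set T : ℝ≥0∞ := ∫⁻ t, tailProb μ t ^ (p / 2) with hT
  have htailp : Tendsto (fun n : ℕ =>
      ((n : ℝ≥0∞) * μ {x : ℝ | (n : ℝ) ^ (p / 2) < |x|}) ^ (p / 2) * T) atTop (𝓝 0) := by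
    have h1 := ((ENNReal.continuous_rpow_const (y := p / 2)).tendsto 0).comp htail
    rw [ENNReal.zero_rpow_of_pos (by positivity)] at h1
    have := ENNReal.Tendsto.mul_const (b := T) h1 (Or.inr (lintegral_tailProb_ne_top hp hL))
    simpa using this
  have hgrow : Tendsto (fun n : ℕ => (n : ℝ) ^ (p / 2)) atTop atTop :=
    (tendsto_rpow_atTop (by positivity)).comp tendsto_natCast_atTop_atTop
  filter_upwards [ENNReal.tendsto_nhds_zero.1 hlim (δ / 2) hδ2] with j hj
  filter_upwards [eventually_gt_atTop 0, hgrow.eventually (eventually_ge_atTop (j : ℝ)),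
    ENNReal.tendsto_nhds_zero.1 htail (δ / 2) hδ2,
    ENNReal.tendsto_nhds_zero.1 htailp η (pos_iff_ne_zero.2 hη0)] with n hn hjn htn htpn
  set S : Set ℝ := Icc (-window p n) (window p n) with hS
  set A : Ω → ℝ≥0∞ := fun ω => ∫⁻ t in S, ‖normSum X (gridDev μ j t) n ω‖ₑ ^ p with hA
  have hmeas : AEMeasurable (fun z : Ω × ℝ => ‖normSum X (gridDev μ j z.2) n z.1‖ₑ ^ p)
      (P.prod (volume.restrict S)) :=
    (aemeasurable_normSum_process hX (measurable_gridDev μ j) n _).enorm.pow_const p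
  have hAm : AEMeasurable A P := hmeas.lintegral_prod_right'
  have hAint : ∫⁻ ω, A ω ∂P ≤ γ (∫⁻ t, ENNReal.ofReal (gridVar μ j t) ^ (p / 2)) := by
    rw [hA, lintegral_lintegral_swap (f := fun ω t => ‖normSum X (gridDev μ j t) n ω‖ₑ ^ p) hmeas]
    exact hbound j n hn
  have hsub : {ω | ε < eLpNorm (fun t => normSum X (gridDev μ j t) n ω) (ENNReal.ofReal p) volume} ⊆
      {ω | η ≤ A ω} ∪ {ω | ¬ ∀ i < n, |X i ω| ≤ (n : ℝ) ^ (p / 2)} := by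
    intro ω hω
    by_contra hcon
    rw [mem_union, not_or] at hcon
    obtain ⟨h1, h2⟩ := hcon
    have h1 : A ω < η := not_le.1 h1
    have h2 : ∀ i < n, |X i ω| ≤ (n : ℝ) ^ (p / 2) := not_not.1 h2
    have h3 := (lintegral_compl_window_le (μ := μ) hp hjn h2).trans htpn
    have h4 : ε ^ p < eLpNorm (fun t => normSum X (gridDev μ j t) n ω) (ENNReal.ofReal p) volume ^ p :=
      ENNReal.rpow_lt_rpow hω hp0
    rw [eLpNorm_rpow_eq hp, ← lintegral_add_compl _ (measurableSet_Icc : MeasurableSet S)] at h4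
    have h5 : A ω + η < η + η := (ENNReal.add_lt_add_iff_right hηt).2 h1
    rw [hη, ENNReal.add_halves, ← hη] at h5
    exact absurd (h4.trans_le (add_le_add le_rfl h3)) (not_lt.2 h5.le)
  calc _ ≤ P {ω | η ≤ A ω} + P {ω | ¬ ∀ i < n, |X i ω| ≤ (n : ℝ) ^ (p / 2)} :=
        (measure_mono hsub).trans (measure_union_le _ _)
    _ ≤ δ / 2 + δ / 2 := by
        gcongr
        · refine (meas_ge_le_lintegral_div hAm hη0 hηt).trans (le_trans ?_ hj)
          gcongr
        · exact (measure_exists_lt_abs_le hX n _).trans htn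
    _ = δ := ENNReal.add_halves δ

end EmpiricalTightness


/-! ### Linearity of averaging -/

section Averaging

lemma cellAvg_sum {ι : Type*} {s : Finset ι} {j : ℕ} {i : ℤ} {f : ι → ℝ → ℝ} {c : ι → ℝ}
    (hf : ∀ a ∈ s, IntegrableOn (f a) (cell j i)) :
    cellAvg j i (fun t => ∑ a ∈ s, c a * f a t) = ∑ a ∈ s, c a * cellAvg j i (f a) := by
  unfold cellAvg
  rw [integral_finsetSum _ fun a ha => (hf a ha).const_mul (c a), Finset.mul_sum]
  refine Finset.sum_congr rfl fun a _ => ?_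
  rw [integral_const_mul]; ring

lemma averaging_sum {ι : Type*} {s : Finset ι} {j : ℕ} {f : ι → ℝ → ℝ} {c : ι → ℝ}
    (hf : ∀ a ∈ s, ∀ i, IntegrableOn (f a) (cell j i)) (t : ℝ) :
    averaging j (fun t => ∑ a ∈ s, c a * f a t) t = ∑ a ∈ s, c a * averaging j (f a) t := by
  unfold averaging
  rw [Finset.sum_congr rfl fun i _ => by rw [cellAvg_sum fun a ha => hf a ha i]]
  simp_rw [Finset.mul_sum, Finset.sum_mul]
  rw [Finset.sum_comm]
  exact Finset.sum_congr rfl fun a _ => Finset.sum_congr rfl fun i _ => by ring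

end Averaging

/-! ### Norm bounds for linear combinations with coefficients in `ℝᵏ` -/

section Vector

variable {k : ℕ}

lemma abs_apply_le_norm (v : Param k) (i : Fin k) : |v i| ≤ ‖v‖ := by
  simpa using PiLp.norm_apply_le v i

lemma norm_le_sum_abs (v : Param k) : ‖v‖ ≤ ∑ i, |v i| := by
  rw [EuclideanSpace.norm_eq]
  refine Real.sqrt_le_iff.2 ⟨Finset.sum_nonneg fun i _ => abs_nonneg _, ?_⟩
  simpa using Finset.sum_sq_le_sq_sum_of_nonneg (s := Finset.univ) (f := fun i => |v i|)
    fun i _ => abs_nonneg _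

lemma enorm_le_sum_enorm (v : Param k) : ‖v‖ₑ ≤ ∑ i, ‖v i‖ₑ := by
  rw [← ofReal_norm]
  refine (ENNReal.ofReal_le_ofReal (norm_le_sum_abs v)).trans (le_of_eq ?_)
  rw [ENNReal.ofReal_sum_of_nonneg fun i _ => abs_nonneg _]
  exact Finset.sum_congr rfl fun i _ => (Real.enorm_eq_ofReal_abs _).symm

lemma enorm_apply_le_enorm (v : Param k) (i : Fin k) : ‖v i‖ₑ ≤ ‖v‖ₑ := by
  rw [Real.enorm_eq_ofReal_abs, ← ofReal_norm]
  exact ENNReal.ofReal_le_ofReal (abs_apply_le_norm v i)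

/-- The `Lᵖ`-norm of a linear combination of functions. -/
lemma eLpNorm_sum_mul_le {q : ℝ≥0∞} (hq : 1 ≤ q) {f : Fin k → ℝ → ℝ}
    (hf : ∀ i, AEStronglyMeasurable (f i) volume) (v : Param k) :
    eLpNorm (fun t => ∑ i, v i * f i t) q volume ≤ ‖v‖ₑ * ∑ i, eLpNorm (f i) q volume := by
  have e : (fun t => ∑ i, v i * f i t) = ∑ i, v i • f i := by
    funext t; simp
  rw [e, Finset.mul_sum]
  refine (eLpNorm_sum_le (fun i _ => (hf i).const_smul _) hq).trans
    (Finset.sum_le_sum fun i _ => ?_)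
  rw [eLpNorm_const_smul]
  gcongr
  exact enorm_apply_le_enorm v i

variable {p : ℝ} {Q : Param k → Measure ℝ} {θF : Param k} {Gdot : ℝ → Param k}

lemma LpDifferentiable.eLpNorm_inner_le (hp : 1 ≤ p) (hG : LpDifferentiable p Q θF Gdot)
    (v : Param k) :
    eLpNorm (fun t => inner ℝ (Gdot t) v) (ENNReal.ofReal p) volume ≤
      ‖v‖ₑ * ∑ i, eLpNorm (fun t => Gdot t i) (ENNReal.ofReal p) volume := by
  have e : (fun t => inner ℝ (Gdot t) v) = fun t => ∑ i, v i * Gdot t i := by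
    funext t; rw [inner_param]; exact Finset.sum_congr rfl fun i _ => mul_comm _ _
  rw [e]
  exact eLpNorm_sum_mul_le (one_le_ofReal hp) (fun i => (hG.memLp i).1) v

lemma LpDifferentiable.memLp_inner (hp : 1 ≤ p) (hG : LpDifferentiable p Q θF Gdot)
    (v : Param k) : MemLp (fun t => inner ℝ (Gdot t) v) (ENNReal.ofReal p) volume := by
  refine ⟨(hG.aemeasurable.inner aemeasurable_const).aestronglyMeasurable, ?_⟩
  exact (hG.eLpNorm_inner_le hp v).trans_lt (ENNReal.mul_lt_top (by simp)
    (ENNReal.sum_lt_top.2 fun i _ => (hG.memLp i).2))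

lemma LpDifferentiable.eLpNorm_averaging_inner_sub_le (hp : 1 ≤ p)
    (hG : LpDifferentiable p Q θF Gdot) (j : ℕ) (v : Param k) :
    eLpNorm (averaging j (fun t => inner ℝ (Gdot t) v) - fun t => inner ℝ (Gdot t) v)
      (ENNReal.ofReal p) volume ≤
      ‖v‖ₑ * ∑ i, eLpNorm (averaging j (fun t => Gdot t i) - fun t => Gdot t i)
        (ENNReal.ofReal p) volume := by
  have e : (fun t => inner ℝ (Gdot t) v) = fun t => ∑ i, v i * Gdot t i := by
    funext t; rw [inner_param]; exact Finset.sum_congr rfl fun i _ => mul_comm _ _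
  have e2 : (averaging j (fun t => inner ℝ (Gdot t) v) - fun t => inner ℝ (Gdot t) v) =
      fun t => ∑ i, v i * (averaging j (fun t => Gdot t i) - fun t => Gdot t i) t := by
    funext t
    rw [Pi.sub_apply, e, averaging_sum fun i _ m => integrableOn_cell hp (hG.memLp i) j m,
      congrFun e t, ← Finset.sum_sub_distrib]
    exact Finset.sum_congr rfl fun i _ => by rw [Pi.sub_apply]; ring
  rw [e2]
  exact eLpNorm_sum_mul_le (one_le_ofReal hp)
    (fun i => (measurable_averaging j _).aestronglyMeasurable.sub (hG.memLp i).1) v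

end Vector

/-! ### Linearization of the empirical process with estimated parameters -/

section Processes

variable {k : ℕ} {Ω : Type*} [MeasurableSpace Ω] {P : Measure Ω} [IsProbabilityMeasure P]
  {μ : Measure ℝ} [IsProbabilityMeasure μ] {X : ℕ → Ω → ℝ} {p : ℝ}
  {Q : Param k → Measure ℝ} {θF : Param k} {Gdot l : ℝ → Param k} {θhat : ℕ → Ω → Param k}

/-- The normalized sum `n^{-1/2} ∑_{i < n} l(X_i)` of vectors. -/
noncomputable def normSumVec (X : ℕ → Ω → ℝ) (l : ℝ → Param k) (n : ℕ) (ω : Ω) : Param k :=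
  (√(n : ℝ))⁻¹ • ∑ i ∈ Finset.range n, l (X i ω)

/-- The linearized process. -/
noncomputable def linProc (μ : Measure ℝ) (Gdot l : ℝ → Param k) (X : ℕ → Ω → ℝ) (n : ℕ) (ω : Ω)
    (t : ℝ) : ℝ :=
  normSum X (limitSummand μ Gdot l t) n ω

/-- The empirical process with estimated parameters, centered at `F - G(θF)`. -/
noncomputable def estProc (μ : Measure ℝ) (Q : Param k → Measure ℝ) (θF : Param k)
    (X : ℕ → Ω → ℝ) (θhat : ℕ → Ω → Param k) (n : ℕ) (ω : Ω) (t : ℝ) : ℝ :=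
  √(n : ℝ) * ((empCDF X n ω t - cdf (Q (θhat n ω)) t) - (cdf μ t - cdf (Q θF) t))

lemma normSumVec_apply (n : ℕ) (ω : Ω) (i : Fin k) :
    normSumVec X l n ω i = normSum X (fun x => l x i) n ω := by
  simp [normSumVec, normSum]

lemma inner_normSumVec (v : Param k) (n : ℕ) (ω : Ω) :
    inner ℝ v (normSumVec X l n ω) = normSum X (fun x => inner ℝ v (l x)) n ω := by
  rw [normSumVec, normSum, inner_smul_right, inner_sum]

lemma normSum_sub (ξ ζ : ℝ → ℝ) (n : ℕ) (ω : Ω) :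
    normSum X (fun x => ξ x - ζ x) n ω = normSum X ξ n ω - normSum X ζ n ω := by
  simp [normSum, Finset.sum_sub_distrib, mul_sub]

lemma linProc_eq (n : ℕ) (ω : Ω) (t : ℝ) :
    linProc μ Gdot l X n ω t =
      normSum X (centeredInd μ t) n ω - inner ℝ (Gdot t) (normSumVec X l n ω) := by
  rw [inner_normSumVec, ← normSum_sub]
  rfl

lemma sqrt_mul_empCDF_sub {n : ℕ} (hn : 0 < n) (ω : Ω) (t : ℝ) :
    √(n : ℝ) * (empCDF X n ω t - cdf μ t) = normSum X (centeredInd μ t) n ω := by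
  have hn0 : (0 : ℝ) < n := by exact_mod_cast hn
  have hs : 0 < √(n : ℝ) := Real.sqrt_pos.2 hn0
  have hss : √(n : ℝ) * √(n : ℝ) = n := Real.mul_self_sqrt hn0.le
  unfold normSum centeredInd empCDF
  rw [Finset.sum_sub_distrib, Finset.sum_const, Finset.card_range, nsmul_eq_mul]
  set S := ∑ i ∈ Finset.range n, (Iic t).indicator (fun _ => (1 : ℝ)) (X i ω)
  field_simp
  rw [Real.sq_sqrt hn0.le]

lemma estProc_sub_linProc {n : ℕ} (hn : 0 < n) (ω : Ω) (t : ℝ) :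
    estProc μ Q θF X θhat n ω t - linProc μ Gdot l X n ω t =
      -(√(n : ℝ) * modelRemainder Q θF Gdot (θhat n ω - θF) t) -
        inner ℝ (Gdot t) (√(n : ℝ) • (θhat n ω - θF) - normSumVec X l n ω) := by
  rw [linProc_eq, ← sqrt_mul_empCDF_sub hn, estProc, modelRemainder, add_sub_cancel,
    inner_sub_right _ (√(n : ℝ) • (θhat n ω - θF)), inner_smul_right]
  ring

lemma normSum_centeredInd_sub_averaging (j n : ℕ) (ω : Ω) (t : ℝ) :
    normSum X (centeredInd μ t) n ω - averaging j (fun s => normSum X (centeredInd μ s) n ω) t =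
      normSum X (gridDev μ j t) n ω := by
  have e : (fun s => normSum X (centeredInd μ s) n ω) =
      fun s => ∑ i ∈ Finset.range n, (√(n : ℝ))⁻¹ * centeredInd μ s (X i ω) := by
    funext s; rw [normSum, Finset.mul_sum]
  rw [e, averaging_sum fun i _ m => integrableOn_centeredInd _ j m]
  simp only [normSum, gridDev]
  rw [← Finset.mul_sum, Finset.sum_sub_distrib, mul_sub]

lemma integrableOn_normSum_centeredInd (n : ℕ) (ω : Ω) (j : ℕ) (i : ℤ) :
    IntegrableOn (fun s => normSum X (centeredInd μ s) n ω) (cell j i) := by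
  unfold normSum
  exact (integrable_finsetSum _ fun a _ => integrableOn_centeredInd _ j i).const_mul _

/-- There are four sources of error: the remainder in the expansion of the model, the error of
asymptotic linearity, the grid deviation of the empirical process, and the averaging error of `Ġ`
paired with the normalized sum of the influence function. -/
lemma estProc_sub_averaging (hp : 1 ≤ p) (hG : LpDifferentiable p Q θF Gdot) {n : ℕ} (hn : 0 < n)
    (j : ℕ) (ω : Ω) :
    (fun t => estProc μ Q θF X θhat n ω t - averaging j (linProc μ Gdot l X n ω) t) =
      ((fun t => -(√(n : ℝ) * modelRemainder Q θF Gdot (θhat n ω - θF) t)) +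
      ((fun t => -inner ℝ (Gdot t) (√(n : ℝ) • (θhat n ω - θF) - normSumVec X l n ω)) +
      ((fun t => normSum X (gridDev μ j t) n ω) +
      (averaging j (fun t => inner ℝ (Gdot t) (normSumVec X l n ω)) -
        fun t => inner ℝ (Gdot t) (normSumVec X l n ω))))) := by
  funext t
  have e : linProc μ Gdot l X n ω = (fun s => normSum X (centeredInd μ s) n ω) -
      fun s => inner ℝ (Gdot s) (normSumVec X l n ω) := by
    funext s; rw [linProc_eq]; rfl
  have h1 := congrFun (averaging_sub (integrableOn_normSum_centeredInd (μ := μ) (X := X) n ω j)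
    (fun i => integrableOn_cell hp (hG.memLp_inner hp (normSumVec X l n ω)) j i)) t
  have h2 := estProc_sub_linProc (μ := μ) (Q := Q) (θF := θF) (X := X) (θhat := θhat)
    (Gdot := Gdot) (l := l) hn ω t
  have h3 := normSum_centeredInd_sub_averaging (μ := μ) (X := X) j n ω t
  rw [linProc_eq] at h2
  rw [← e] at h1
  simp only [Pi.add_apply, Pi.sub_apply] at h1 ⊢
  rw [h1, ← h3]
  linarith

lemma eLpNorm_estProc_sub_averaging_le (hp : 1 ≤ p) (hG : LpDifferentiable p Q θF Gdot) {n : ℕ}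
    (hn : 0 < n) (j : ℕ) (ω : Ω) :
    eLpNorm (fun t => estProc μ Q θF X θhat n ω t - averaging j (linProc μ Gdot l X n ω) t)
      (ENNReal.ofReal p) volume ≤
      ENNReal.ofReal √(n : ℝ) *
        eLpNorm (modelRemainder Q θF Gdot (θhat n ω - θF)) (ENNReal.ofReal p) volume +
      (‖√(n : ℝ) • (θhat n ω - θF) - normSumVec X l n ω‖ₑ *
        ∑ i, eLpNorm (fun t => Gdot t i) (ENNReal.ofReal p) volume +
      (eLpNorm (fun t => normSum X (gridDev μ j t) n ω) (ENNReal.ofReal p) volume +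
      ‖normSumVec X l n ω‖ₑ * ∑ i, eLpNorm (averaging j (fun t => Gdot t i) - fun t => Gdot t i)
        (ENNReal.ofReal p) volume)) := by
  have hq := one_le_ofReal hp
  have m1 : AEStronglyMeasurable
      (fun t => -(√(n : ℝ) * modelRemainder Q θF Gdot (θhat n ω - θF) t)) volume :=
    ((hG.aemeasurable_remainder _).const_mul _).neg.aestronglyMeasurable
  have m2 : ∀ v, AEStronglyMeasurable (fun t => inner ℝ (Gdot t) v) volume := fun v =>
    (hG.memLp_inner hp v).1
  have m3 : AEStronglyMeasurable (fun t => normSum X (gridDev μ j t) n ω) volume := by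
    unfold normSum
    refine (Measurable.const_mul (Finset.measurable_fun_sum _ fun i _ => ?_) _).aestronglyMeasurable
    exact (measurable_gridDev μ j).comp measurable_prodMk_left
  have m4 := (measurable_averaging j
    (fun t => inner ℝ (Gdot t) (normSumVec X l n ω))).aestronglyMeasurable.sub
      (m2 (normSumVec X l n ω)) (μ := volume)
  rw [estProc_sub_averaging hp hG hn]
  refine (eLpNorm_add_le m1 ((m2 _).neg.add (m3.add m4)) hq).trans (add_le_add (le_of_eq ?_) ?_)
  · have e : (fun t => -(√(n : ℝ) * modelRemainder Q θF Gdot (θhat n ω - θF) t)) =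
        -(√(n : ℝ) • modelRemainder Q θF Gdot (θhat n ω - θF)) := by
      funext t; simp
    rw [e, eLpNorm_neg, eLpNorm_const_smul, Real.enorm_eq_ofReal (Real.sqrt_nonneg _)]
  refine (eLpNorm_add_le (m2 _).neg (m3.add m4) hq).trans (add_le_add ?_ ?_)
  · exact (le_of_eq (eLpNorm_neg _ _ _)).trans (hG.eLpNorm_inner_le hp _)
  refine (eLpNorm_add_le m3 m4 hq).trans (add_le_add le_rfl ?_)
  exact hG.eLpNorm_averaging_inner_sub_le hp j _

lemma lintegral_enorm_normSumVec_le (hX : ∀ i, HasLaw (X i) μ P) (hind : iIndepFun X P)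
    (hl : MemLp l 2 μ) (h0 : ∫ x, l x ∂μ = 0) (n : ℕ) :
    ∫⁻ ω, ‖normSumVec X l n ω‖ₑ ∂P ≤ ∑ i, ENNReal.ofReal √(∫ x, l x i ^ 2 ∂μ) := by
  have hm : ∀ i, AEMeasurable (normSum X (fun x => l x i) n) P := fun i =>
    aemeasurable_normSum hX (memLp_apply hl i).1.aemeasurable n
  calc _ ≤ ∫⁻ ω, ∑ i, ‖normSum X (fun x => l x i) n ω‖ₑ ∂P := lintegral_mono fun ω => by
        refine (enorm_le_sum_enorm _).trans (le_of_eq ?_)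
        exact Finset.sum_congr rfl fun i _ => by rw [normSumVec_apply]
    _ = ∑ i, ∫⁻ ω, ‖normSum X (fun x => l x i) n ω‖ₑ ∂P :=
        lintegral_finsetSum' _ fun i _ => (hm i).enorm
    _ ≤ _ := Finset.sum_le_sum fun i _ => by
        have hi : ∫ x, l x i ∂μ = 0 := by
          rw [← integral_apply (hl.integrable one_le_two), h0]; rfl
        simpa using lintegral_normSum_rpow_le_of_le_two hX hind (memLp_apply hl i) hi le_rfl
          one_le_two n

lemma aemeasurable_normSumVec (hX : ∀ i, HasLaw (X i) μ P) (hl : MemLp l 2 μ) (n : ℕ) :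
    AEMeasurable (normSumVec X l n) P := by
  have h : ∀ i, AEMeasurable (fun ω => l (X i ω)) P := fun i => by
    have : AEMeasurable l (P.map (X i)) := by rw [(hX i).map_eq]; exact hl.1.aemeasurable
    exact this.comp_aemeasurable (hX i).aemeasurable
  exact (Finset.aemeasurable_fun_sum (Finset.range n) fun i _ => h i).const_smul (√(n : ℝ))⁻¹

/-- Normalized sums of square integrable centered vectors are tight. -/
lemma exists_measure_normSumVec_le (hX : ∀ i, HasLaw (X i) μ P) (hind : iIndepFun X P)
    (hl : MemLp l 2 μ) (h0 : ∫ x, l x ∂μ = 0) {δ : ℝ≥0∞} (hδ : 0 < δ) :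
    ∃ K : ℝ, 0 < K ∧ ∀ n, P {ω | K < ‖normSumVec X l n ω‖} ≤ δ := by
  set M : ℝ≥0∞ := ∑ i, ENNReal.ofReal √(∫ x, l x i ^ 2 ∂μ) with hM
  have hMt : M ≠ ∞ := ENNReal.sum_ne_top.2 fun i _ => ENNReal.ofReal_ne_top
  have hlim : Tendsto (fun m : ℕ => M / (m : ℝ≥0∞)) atTop (𝓝 0) := by
    have := ENNReal.Tendsto.const_mul (a := M) ENNReal.tendsto_inv_nat_nhds_zero (Or.inr hMt)
    simpa [div_eq_mul_inv] using this
  obtain ⟨m, hm, hm0⟩ := ((ENNReal.tendsto_nhds_zero.1 hlim δ hδ).and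
    (eventually_gt_atTop 0)).exists
  refine ⟨m, by exact_mod_cast hm0, fun n => le_trans ?_ hm⟩
  have hsub : {ω | (m : ℝ) < ‖normSumVec X l n ω‖} ⊆ {ω | (m : ℝ≥0∞) ≤ ‖normSumVec X l n ω‖ₑ} := by
    intro ω hω
    have hω : (m : ℝ) < ‖normSumVec X l n ω‖ := hω
    show (m : ℝ≥0∞) ≤ ‖normSumVec X l n ω‖ₑ
    rw [← ofReal_norm, ← ENNReal.ofReal_natCast]
    exact ENNReal.ofReal_le_ofReal hω.le
  refine (measure_mono hsub).trans ((meas_ge_le_lintegral_div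
    (aemeasurable_normSumVec hX hl n).enorm (by simpa using hm0.ne') (by simp)).trans ?_)
  gcongr
  exact lintegral_enorm_normSumVec_le hX hind hl h0 n

lemma normSumVec_influence {ψ : Param k → ℝ → Param k} {V : Param k ≃L[ℝ] Param k} (n : ℕ) (ω : Ω) :
    normSumVec X (influence ψ θF V) n ω =
      -V.symm ((√(n : ℝ))⁻¹ • ∑ i ∈ Finset.range n, ψ θF (X i ω)) := by
  simp only [normSumVec, influence]
  rw [Finset.sum_neg_distrib, map_smul, map_sum, smul_neg]

lemma memLp_influence {ψ : Param k → ℝ → Param k} {V : Param k ≃L[ℝ] Param k}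
    (h : MemLp (ψ θF) 2 μ) : MemLp (influence ψ θF V) 2 μ :=
  ((V.symm : Param k →L[ℝ] Param k).comp_memLp' h).neg

lemma integral_influence {ψ : Param k → ℝ → Param k} {V : Param k ≃L[ℝ] Param k}
    (hi : Integrable (ψ θF) μ) (h0 : ∫ x, ψ θF x ∂μ = 0) : ∫ x, influence ψ θF V x ∂μ = 0 := by
  unfold influence
  rw [integral_neg]
  have := (V.symm : Param k →L[ℝ] Param k).integral_comp_comm hi
  simp only [ContinuousLinearEquiv.coe_coe] at this
  rw [this, h0, map_zero, neg_zero]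

/-- The estimated process is approximated by cellwise averages of the linearized process. -/
theorem eventually_measure_estProc_sub_averaging_le {ψ : Param k → ℝ → Param k}
    {V : Param k ≃L[ℝ] Param k} (hp : 1 ≤ p) (hL : LorentzCond p μ)
    (hX : ∀ i, HasLaw (X i) μ P) (hind : iIndepFun X P) (hG : LpDifferentiable p Q θF Gdot)
    (hψ : AsympLinear P ψ μ θF V X θhat) (h0 : ∫ x, ψ θF x ∂μ = 0) {ε δ : ℝ} (hε : 0 < ε)
    (hδ : 0 < δ) :
    ∀ᶠ j in atTop, ∀ᶠ n in atTop,
      P {ω | ENNReal.ofReal ε < eLpNorm (fun t => estProc μ Q θF X θhat n ω t -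
        averaging j (linProc μ Gdot (influence ψ θF V) X n ω) t) (ENNReal.ofReal p) volume} ≤
        ENNReal.ofReal δ := by
  set l := influence ψ θF V with hl
  set q := ENNReal.ofReal p with hq
  have hl2 : MemLp l 2 μ := memLp_influence hψ.memLp_two
  have hl0 : ∫ x, l x ∂μ = 0 := integral_influence (hψ.memLp_two.integrable one_le_two) h0
  have hδ3 : 0 < ENNReal.ofReal (δ / 3) := by rw [ENNReal.ofReal_pos]; positivity
  have hε4 : 0 < ENNReal.ofReal (ε / 4) := by rw [ENNReal.ofReal_pos]; positivity
  obtain ⟨K, hK, hKn⟩ := exists_measure_normSumVec_le hX hind hl2 hl0 hδ3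
  set B : ℝ≥0∞ := ∑ i, eLpNorm (fun t => Gdot t i) q volume with hB
  have hBt : B ≠ ∞ := ENNReal.sum_ne_top.2 fun i _ => (hG.memLp i).2.ne
  -- The tolerance for the linearity error must be small against the norms of `Ġ`; being at most 1,
  -- it also gives `√n ‖θ̂ₙ - θ_F‖ ≤ K + 1` on the good event.
  obtain ⟨η, hη, hη1, hηB⟩ : ∃ η : ℝ, 0 < η ∧ η ≤ 1 ∧
      ENNReal.ofReal η * B ≤ ENNReal.ofReal (ε / 4) := by
    obtain ⟨b, hb, hbB⟩ : ∃ b : ℝ, 0 ≤ b ∧ ENNReal.ofReal b = B :=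
      ⟨B.toReal, ENNReal.toReal_nonneg, ENNReal.ofReal_toReal hBt⟩
    refine ⟨min 1 (ε / 4 / (b + 1)), by positivity, min_le_left _ _, ?_⟩
    rw [← hbB, ← ENNReal.ofReal_mul' hb]
    refine ENNReal.ofReal_le_ofReal ?_
    calc min 1 (ε / 4 / (b + 1)) * b ≤ ε / 4 / (b + 1) * b :=
          mul_le_mul_of_nonneg_right (min_le_right _ _) hb
      _ ≤ ε / 4 := by
        rw [div_mul_eq_mul_div, div_le_iff₀ (by positivity)]
        gcongr; linarith
  -- This is the precision of the model expansion: multiplied by `√n ‖θ̂ₙ - θ_F‖ ≤ K + 1` it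
  -- contributes `ε/4`, one of four equal shares.
  set ε' : ℝ := ε / 4 / (K + 1) with hε'
  have hε'0 : 0 < ε' := by positivity
  obtain ⟨r, hr, hrem⟩ := Metric.eventually_nhds_iff.1 (hG.isLittleO ε' hε'0)
  have hγ : Tendsto (fun j => ENNReal.ofReal K *
      ∑ i, eLpNorm (averaging j (fun t => Gdot t i) - fun t => Gdot t i) q volume) atTop (𝓝 0) := by
    have h1 := tendsto_finsetSum (Finset.univ : Finset (Fin k))
      fun i _ => tendsto_averaging hp (hG.memLp i)
    have := ENNReal.Tendsto.const_mul (a := ENNReal.ofReal K) h1 (Or.inr ENNReal.ofReal_ne_top)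
    simpa using this
  have hexp := hψ.expansion (ENNReal.ofReal η) (by rw [ENNReal.ofReal_pos]; exact hη)
  filter_upwards [eventually_measure_gridDev_le hp hL hX hind hε4 hδ3,
    ENNReal.tendsto_nhds_zero.1 hγ _ hε4] with j hj1 hj2
  -- For such `n` the bound on `√n ‖θ̂ₙ - θ_F‖` places the estimator in the ball where the expansion
  -- is valid.
  have hsq : ∀ᶠ n : ℕ in atTop, (√(n : ℝ))⁻¹ * (K + 1) < r := by
    have := tendsto_inv_sqrt_natCast.mul_const (K + 1)
    rw [zero_mul] at this
    exact this.eventually (gt_mem_nhds hr)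
  filter_upwards [hj1, ENNReal.tendsto_nhds_zero.1 hexp _ hδ3, hsq, eventually_gt_atTop 0]
    with n h1 h2 h3 hn
  have hs : 0 < √(n : ℝ) := Real.sqrt_pos.2 (by exact_mod_cast hn)
  set A1 := {ω | ENNReal.ofReal (ε / 4) < eLpNorm (fun t => normSum X (gridDev μ j t) n ω) q volume}
  set A2 := {ω | ENNReal.ofReal η ≤ edist (√(n : ℝ) • (θhat n ω - θF)
      + V.symm ((√(n : ℝ))⁻¹ • ∑ i ∈ Finset.range n, ψ θF (X i ω))) 0}
  set A3 := {ω | K < ‖normSumVec X l n ω‖}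
  have hsub : {ω | ENNReal.ofReal ε < eLpNorm (fun t => estProc μ Q θF X θhat n ω t -
        averaging j (linProc μ Gdot l X n ω) t) q volume} ⊆ A1 ∪ A2 ∪ A3 := by
    intro ω hω
    by_contra hcon
    simp only [mem_union, not_or] at hcon
    obtain ⟨⟨c1, c2⟩, c3⟩ := hcon
    have c1 : eLpNorm (fun t => normSum X (gridDev μ j t) n ω) q volume ≤
      ENNReal.ofReal (ε / 4) := not_lt.1 c1
    have c3 : ‖normSumVec X l n ω‖ ≤ K := not_lt.1 c3
    have c2 : edist (√(n : ℝ) • (θhat n ω - θF)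
      + V.symm ((√(n : ℝ))⁻¹ • ∑ i ∈ Finset.range n, ψ θF (X i ω))) 0 <
      ENNReal.ofReal η := not_le.1 c2
    set h := θhat n ω - θF with hh
    have e2 : √(n : ℝ) • h + V.symm ((√(n : ℝ))⁻¹ • ∑ i ∈ Finset.range n, ψ θF (X i ω)) =
        √(n : ℝ) • h - normSumVec X l n ω := by
      rw [hl, normSumVec_influence, sub_neg_eq_add]
    rw [e2, edist_zero_right] at c2
    have c2' : ‖√(n : ℝ) • h - normSumVec X l n ω‖ < η := by
      rw [← ofReal_norm] at c2
      exact (ENNReal.ofReal_lt_ofReal_iff hη).1 c2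
    have hsh : √(n : ℝ) * ‖h‖ ≤ K + 1 := by
      have h4 : √(n : ℝ) * ‖h‖ = ‖√(n : ℝ) • h‖ := by
        rw [norm_smul, Real.norm_of_nonneg hs.le]
      have h5 := norm_le_norm_sub_add (√(n : ℝ) • h) (normSumVec X l n ω)
      linarith
    have hhr : dist h 0 < r := by
      rw [dist_zero_right]
      refine lt_of_le_of_lt ?_ h3
      rw [inv_mul_eq_div, le_div_iff₀ hs, mul_comm]
      exact hsh
    have hR : ENNReal.ofReal √(n : ℝ) * eLpNorm (modelRemainder Q θF Gdot h) q volume ≤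
        ENNReal.ofReal (ε / 4) := by
      refine (mul_le_mul_right (hrem hhr) _).trans ?_
      rw [← ENNReal.ofReal_mul hs.le]
      refine ENNReal.ofReal_le_ofReal ?_
      calc √(n : ℝ) * (ε' * ‖h‖) = ε' * (√(n : ℝ) * ‖h‖) := by ring
        _ ≤ ε' * (K + 1) := by gcongr
        _ = ε / 4 := by rw [hε']; field_simp
    have hY : ‖√(n : ℝ) • h - normSumVec X l n ω‖ₑ * B ≤ ENNReal.ofReal (ε / 4) := by
      refine le_trans ?_ hηB
      gcongr
    have hLn : ‖normSumVec X l n ω‖ₑ *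
        ∑ i, eLpNorm (averaging j (fun t => Gdot t i) - fun t => Gdot t i) q volume ≤
        ENNReal.ofReal (ε / 4) := by
      refine le_trans ?_ hj2
      gcongr
      rw [← ofReal_norm]
      exact ENNReal.ofReal_le_ofReal c3
    have htot := (eLpNorm_estProc_sub_averaging_le (μ := μ) (X := X) (θhat := θhat) (l := l) hp hG
      hn j ω).trans (add_le_add hR (add_le_add hY (add_le_add c1 hLn)))
    rw [← ENNReal.ofReal_add (by positivity) (by positivity),
      ← ENNReal.ofReal_add (by positivity) (by positivity),
      ← ENNReal.ofReal_add (by positivity) (by positivity)] at htot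
    have : ε / 4 + (ε / 4 + (ε / 4 + ε / 4)) = ε := by ring
    rw [this] at htot
    exact absurd hω (not_lt.2 htot)
  calc _ ≤ P A1 + P A2 + P A3 := (measure_mono hsub).trans
        ((measure_union_le _ _).trans (add_le_add (measure_union_le _ _) le_rfl))
    _ ≤ ENNReal.ofReal (δ / 3) + ENNReal.ofReal (δ / 3) + ENNReal.ofReal (δ / 3) :=
        add_le_add (add_le_add h1 h2) (hKn n)
    _ = ENNReal.ofReal δ := by
        rw [← ENNReal.ofReal_add (by positivity) (by positivity),
          ← ENNReal.ofReal_add (by positivity) (by positivity)]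
        congr 1; ring

end Processes


/-! ### Measurability and integrability of the limit variance -/

section LinearizedCovariance

variable {k : ℕ} {μ : Measure ℝ} [IsProbabilityMeasure μ] {p : ℝ}
  {Q : Param k → Measure ℝ} {θF : Param k} {Gdot l : ℝ → Param k}

lemma aemeasurable_limitSummand (hGm : AEMeasurable Gdot volume) (hl : MemLp l 2 μ) :
    AEMeasurable (fun z : ℝ × ℝ => limitSummand μ Gdot l z.2 z.1) (μ.prod volume) := by
  unfold limitSummand
  exact (measurable_centeredInd μ).aemeasurable.sub
    ((hGm.comp_snd (μ := μ)).inner (hl.1.aemeasurable.comp_fst (ν := volume)))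

lemma limitCov_self_eq (hl : MemLp l 2 μ) (h0 : ∫ x, l x ∂μ = 0) (t : ℝ) :
    limitCov μ Gdot l t t = ∫ x, limitSummand μ Gdot l t x ^ 2 ∂μ := by
  rw [← integral_limitSummand_mul hl h0]
  simp_rw [sq]

lemma limitCov_self_nonneg (hl : MemLp l 2 μ) (h0 : ∫ x, l x ∂μ = 0) (t : ℝ) :
    0 ≤ limitCov μ Gdot l t t := by
  rw [limitCov_self_eq hl h0]
  exact integral_nonneg fun _ => sq_nonneg _

lemma aemeasurable_limitCov_self (hGm : AEMeasurable Gdot volume) (hl : MemLp l 2 μ)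
    (h0 : ∫ x, l x ∂μ = 0) : AEMeasurable (fun t => limitCov μ Gdot l t t) volume := by
  simp_rw [limitCov_self_eq hl h0]
  have := ((aemeasurable_limitSummand hGm hl).pow_const 2).prod_swap.aestronglyMeasurable
  exact this.integral_prod_right'.aemeasurable

lemma memLp_sqrt_cdf (hp : 1 ≤ p) (hL : LorentzCond p μ) :
    MemLp (fun t => √(cdf μ t * (1 - cdf μ t))) (ENNReal.ofReal p) volume := by
  have hp0 : 0 < p := by linarith
  have hm := measurable_cdf' μ
  refine ⟨(hm.mul (hm.const_sub 1)).sqrt.aestronglyMeasurable, ?_⟩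
  rw [← ENNReal.rpow_lt_top_iff_of_pos hp0, eLpNorm_rpow_eq hp]
  refine lt_of_le_of_lt (lintegral_mono fun t => ?_) (lintegral_tailProb_ne_top hp hL).lt_top
  rw [Real.enorm_eq_ofReal (Real.sqrt_nonneg _), ofReal_sqrt_rpow
    (mul_nonneg (cdf_nonneg μ t) (by linarith [cdf_le_one μ t]))]
  exact ENNReal.rpow_le_rpow (cdf_mul_one_sub_le_tailProb t) (by positivity)

lemma sqrt_add_le {a b : ℝ} (ha : 0 ≤ a) (hb : 0 ≤ b) : √(a + b) ≤ √a + √b := by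
  refine Real.sqrt_le_iff.2 ⟨by positivity, ?_⟩
  rw [add_sq, Real.sq_sqrt ha, Real.sq_sqrt hb]
  have : 0 ≤ 2 * √a * √b := by positivity
  linarith

/-- The standard deviation of the limit process is in `Lᵖ`. -/
theorem memLp_sqrt_limitCov (hp : 1 ≤ p) (hL : LorentzCond p μ) (hG : LpDifferentiable p Q θF Gdot)
    (hl : MemLp l 2 μ) (h0 : ∫ x, l x ∂μ = 0) :
    MemLp (fun t => √(limitCov μ Gdot l t t)) (ENNReal.ofReal p) volume := by
  set c : ℝ := ∫ x, ‖l x‖ ^ 2 ∂μ with hc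
  have hb : MemLp (fun t => √2 * √(cdf μ t * (1 - cdf μ t)) + √(2 * c) * ∑ i, |Gdot t i|)
      (ENNReal.ofReal p) volume :=
    ((memLp_sqrt_cdf hp hL).const_mul _).add
      ((memLp_finsetSum _ fun i _ => (hG.memLp i).abs).const_mul _)
  refine hb.mono (aemeasurable_limitCov_self hG.aemeasurable hl h0).sqrt.aestronglyMeasurable
    (ae_of_all _ fun t => ?_)
  have hc0 : 0 ≤ c := integral_nonneg fun _ => by positivity
  have hF : 0 ≤ cdf μ t * (1 - cdf μ t) :=
    mul_nonneg (cdf_nonneg μ t) (by linarith [cdf_le_one μ t])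
  have hS : 0 ≤ ∑ i, |Gdot t i| := Finset.sum_nonneg fun i _ => abs_nonneg _
  rw [Real.norm_of_nonneg (Real.sqrt_nonneg _), Real.norm_of_nonneg (by positivity),
    ← Real.sqrt_mul zero_le_two]
  calc √(limitCov μ Gdot l t t)
      ≤ √(2 * (cdf μ t * (1 - cdf μ t)) + 2 * (‖Gdot t‖ ^ 2 * c)) :=
        Real.sqrt_le_sqrt (limitCov_self_le hl h0 t)
    _ ≤ √(2 * (cdf μ t * (1 - cdf μ t))) + √(2 * (‖Gdot t‖ ^ 2 * c)) :=
        sqrt_add_le (by positivity) (by positivity)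
    _ ≤ _ := by
        gcongr
        rw [show 2 * (‖Gdot t‖ ^ 2 * c) = 2 * c * ‖Gdot t‖ ^ 2 by ring,
          Real.sqrt_mul (by positivity), Real.sqrt_sq (norm_nonneg _)]
        gcongr
        exact norm_le_sum_abs _

lemma eLpNorm_limitSummand_two (hl : MemLp l 2 μ) (h0 : ∫ x, l x ∂μ = 0) (t : ℝ) :
    eLpNorm (limitSummand μ Gdot l t) 2 μ = ENNReal.ofReal √(limitCov μ Gdot l t t) := by
  have hm := memLp_limitSummand (Gdot := Gdot) hl t
  rw [← ENNReal.ofReal_toReal hm.2.ne, ← Lp.norm_toLp _ hm]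
  congr 1
  refine (Real.sqrt_eq_iff_mul_self_eq (limitCov_self_nonneg hl h0 t) (norm_nonneg _)).2 ?_ |>.symm
  rw [← sq, norm_sq_toLp hm, limitCov_self_eq hl h0]

end LinearizedCovariance

/-! ### Cell averages as vectors and step functions -/

section CellVectors

/-- The vector of cell averages. -/
noncomputable def cellVec (j : ℕ) (f : ℝ → ℝ) : EuclideanSpace ℝ (cells j) :=
  WithLp.toLp 2 fun i => cellAvg j i f

/-- The step function with given values on the cells. -/
noncomputable def stepFun (j : ℕ) (v : EuclideanSpace ℝ (cells j)) (t : ℝ) : ℝ :=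
  ∑ i : cells j, v i * (cell j i).indicator (fun _ => (1 : ℝ)) t

lemma averaging_eq_stepFun (j : ℕ) (f : ℝ → ℝ) : averaging j f = stepFun j (cellVec j f) := by
  funext t
  rw [averaging, stepFun, ← Finset.sum_coe_sort]
  rfl

lemma measurable_stepFun (j : ℕ) (v : EuclideanSpace ℝ (cells j)) : Measurable (stepFun j v) := by
  unfold stepFun
  exact Finset.measurable_fun_sum _ fun i _ =>
    (measurable_const.indicator (measurableSet_cell j i)).const_mul _

lemma memLp_indicator_cell (j : ℕ) (i : ℤ) (q : ℝ≥0∞) :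
    MemLp ((cell j i).indicator fun _ => (1 : ℝ)) q volume :=
  memLp_indicator_const _ (measurableSet_cell j i) (1 : ℝ) (Or.inr (volume_cell_ne_top j i))

lemma memLp_stepFun (j : ℕ) (v : EuclideanSpace ℝ (cells j)) (q : ℝ≥0∞) :
    MemLp (stepFun j v) q volume := by
  unfold stepFun
  exact memLp_finsetSum _ fun i _ => (memLp_indicator_cell j i q).const_mul _

lemma stepFun_sub (j : ℕ) (v w : EuclideanSpace ℝ (cells j)) :
    stepFun j v - stepFun j w = stepFun j (v - w) := by
  funext t
  simp [stepFun, ← Finset.sum_sub_distrib, sub_mul]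

/-- The Lipschitz constant of `stepFun` as a map to `Lᵖ`. -/
noncomputable def stepConst (p : ℝ) (j : ℕ) : ℝ≥0 :=
  (∑ i : cells j, eLpNorm ((cell j i).indicator fun _ => (1 : ℝ)) (ENNReal.ofReal p) volume).toNNReal

lemma lpNormReal_stepFun_le {p : ℝ} (hp : 1 ≤ p) (j : ℕ) (v : EuclideanSpace ℝ (cells j)) :
    lpNormReal p (stepFun j v) ≤ stepConst p j * ‖v‖ := by
  obtain ⟨g, hg⟩ : ∃ g : cells j → ℝ → ℝ, g = fun i : cells j => (cell j i).indicator fun _ => (1 : ℝ) :=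
    ⟨_, rfl⟩
  obtain ⟨S, hS⟩ : ∃ S, S = ∑ i : cells j, eLpNorm (g i) (ENNReal.ofReal p) volume := ⟨_, rfl⟩
  have hgm : ∀ i, MemLp (g i) (ENNReal.ofReal p) volume := fun i => by
    rw [hg]; exact memLp_indicator_cell j i _
  have hSt : S ≠ ∞ := by
    rw [hS]; exact ENNReal.sum_ne_top.2 fun i _ => (hgm i).2.ne
  have hconst : stepConst p j = S.toNNReal := by rw [stepConst, hS, hg]
  have h1 : eLpNorm (stepFun j v) (ENNReal.ofReal p) volume ≤ S * ‖v‖ₑ := by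
    have e : stepFun j v = ∑ i : cells j, v i • g i := by
      funext t
      rw [Finset.sum_apply, hg]
      rfl
    rw [e, hS, Finset.sum_mul]
    refine (eLpNorm_sum_le (fun i _ => ((hgm i).const_smul _).1)
      (one_le_ofReal hp)).trans (Finset.sum_le_sum fun i _ => ?_)
    rw [eLpNorm_const_smul, mul_comm]
    gcongr
    rw [← ofReal_norm, ← ofReal_norm]
    exact ENNReal.ofReal_le_ofReal (PiLp.norm_apply_le v i)
  have h2 := ENNReal.toReal_mono (ENNReal.mul_ne_top hSt enorm_ne_top) h1
  rw [ENNReal.toReal_mul, toReal_enorm] at h2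
  rw [hconst]
  exact h2

/-- The weight representing a linear combination of cell averages as an integral. -/
noncomputable def cellWeight (j : ℕ) (c : EuclideanSpace ℝ (cells j)) (t : ℝ) : ℝ :=
  (j + 1) * stepFun j c t

lemma measurable_cellWeight (j : ℕ) (c : EuclideanSpace ℝ (cells j)) : Measurable (cellWeight j c) :=
  (measurable_stepFun j c).const_mul _

lemma mul_cellWeight (j : ℕ) (c : EuclideanSpace ℝ (cells j)) (z : ℝ → ℝ) (t : ℝ) :
    z t * cellWeight j c t =
      ∑ i : cells j, (c i * (j + 1)) * (cell j i).indicator z t := by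
  rw [cellWeight, stepFun, Finset.mul_sum, Finset.mul_sum]
  refine Finset.sum_congr rfl fun i _ => ?_
  by_cases h : t ∈ cell j i
  · rw [indicator_of_mem h, indicator_of_mem h]; ring
  · rw [indicator_of_notMem h, indicator_of_notMem h]; ring

lemma integrable_mul_cellWeight {j : ℕ} {z : ℝ → ℝ} (hz : ∀ i, IntegrableOn z (cell j i))
    (c : EuclideanSpace ℝ (cells j)) : Integrable (fun t => z t * cellWeight j c t) := by
  simp_rw [mul_cellWeight]
  exact integrable_finsetSum _ fun i _ =>
    ((integrable_indicator_iff (measurableSet_cell j i)).2 (hz i)).const_mul _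

/-- Linear functionals of the cell vector become weighted integrals of the path, so Cramér–Wold
leads to the scalar central limit theorem on one side and to Gaussian integrals on the other. -/
lemma inner_cellVec {j : ℕ} {z : ℝ → ℝ} (hz : ∀ i, IntegrableOn z (cell j i))
    (c : EuclideanSpace ℝ (cells j)) :
    inner ℝ (cellVec j z) c = ∫ t, z t * cellWeight j c t := by
  simp_rw [mul_cellWeight]
  have hint : ∀ i : cells j, Integrable (fun t => (c i * (j + 1)) * (cell j i).indicator z t) :=
    fun i => ((integrable_indicator_iff (measurableSet_cell j i)).2 (hz i)).const_mul _
  rw [integral_finsetSum _ fun i _ => hint i, PiLp.inner_apply]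
  refine Finset.sum_congr rfl fun i _ => ?_
  rw [integral_const_mul, integral_indicator (measurableSet_cell j i)]
  simp [cellVec, cellAvg]
  ring

end CellVectors

/-! ### The scalar central limit theorem and the Cramér–Wold device -/

section CentralLimit

variable {Ω Ω' : Type*} [MeasurableSpace Ω] {P : Measure Ω} [IsProbabilityMeasure P]
  [MeasurableSpace Ω'] {P' : Measure Ω'} [IsProbabilityMeasure P']
  {μ : Measure ℝ} [IsProbabilityMeasure μ] {X : ℕ → Ω → ℝ} {p : ℝ}

lemma tendstoInDistribution_normSum (hX : ∀ i, HasLaw (X i) μ P) (hind : iIndepFun X P)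
    {ξ : ℝ → ℝ} (hξ : MemLp ξ 2 μ) (h0 : ∫ x, ξ x ∂μ = 0) {Y : Ω' → ℝ}
    (hY : HasLaw Y (gaussianReal 0 (∫ x, ξ x ^ 2 ∂μ).toNNReal) P') :
    TendstoInDistribution (normSum X ξ) atTop Y (fun _ => P) P' := by
  have hm := fun i => aemeasurable_comp hX hξ.1.aemeasurable i
  have hmean : ∫ ω, ξ (X 0 ω) ∂P = 0 := by rw [integral_comp_law hX hξ.1.aemeasurable, h0]
  have hvar : Var[fun ω => ξ (X 0 ω); P] = ∫ x, ξ x ^ 2 ∂μ := by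
    rw [variance_eq_integral_sq (hm 0) hmean]
    exact integral_comp_law (ξ := fun x => ξ x ^ 2) hX (hξ.1.aemeasurable.pow_const 2) 0
  have hid : ∀ i, IdentDistrib (fun ω => ξ (X i ω)) (fun ω => ξ (X 0 ω)) P P := fun i => by
    have h : IdentDistrib (X i) (X 0) P P :=
      ⟨(hX i).aemeasurable, (hX 0).aemeasurable, by rw [(hX i).map_eq, (hX 0).map_eq]⟩
    refine h.comp_of_aemeasurable ?_
    rw [(hX i).map_eq]; exact hξ.1.aemeasurable
  have h := tendstoInDistribution_inv_sqrt_mul_sum_sub (P := P) (P' := P')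
    (X := fun i ω => ξ (X i ω)) (Y := Y) (by rw [hvar]; exact hY) (memLp_comp_law hX hξ 0)
    (iIndepFun_comp hX hind hξ.1.aemeasurable) hid
  have e : (fun (n : ℕ) ω => (√(n : ℝ))⁻¹ * (∑ i ∈ Finset.range n, ξ (X i ω) -
      n * ∫ ω, ξ (X 0 ω) ∂P)) = normSum X ξ := by
    funext n ω
    rw [hmean, mul_zero, sub_zero]; rfl
  rwa [e] at h

/-- The frequency vector is absorbed into the linear functional, so scalar convergence is needed
only at frequency 1. -/
lemma charFun_map_inner {A E : Type*} [MeasurableSpace A] [NormedAddCommGroup E]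
    [InnerProductSpace ℝ E] [SecondCountableTopology E] [MeasurableSpace E] [BorelSpace E]
    {ν : Measure A} {U : A → E} (hU : AEMeasurable U ν) (c : E) :
    charFun (ν.map fun a => inner ℝ (U a) c) 1 = charFun (ν.map U) c := by
  have hU' : AEMeasurable (fun a => inner ℝ (U a) c) ν := hU.inner aemeasurable_const
  rw [charFun_apply, charFun_apply, integral_map hU' (by fun_prop), integral_map hU (by fun_prop)]
  simp

/-- The Cramér–Wold device. -/
lemma tendstoInDistribution_of_inner {E : Type*} [NormedAddCommGroup E] [InnerProductSpace ℝ E]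
    [FiniteDimensional ℝ E] [MeasurableSpace E] [BorelSpace E] {V : ℕ → Ω → E} {Z : Ω' → E}
    (hV : ∀ n, AEMeasurable (V n) P) (hZ : AEMeasurable Z P')
    (h : ∀ c : E, TendstoInDistribution (fun n ω => inner ℝ (V n ω) c) atTop
      (fun ω => inner ℝ (Z ω) c) (fun _ => P) P') :
    TendstoInDistribution V atTop Z (fun _ => P) P' := by
  refine ⟨hV, hZ, ProbabilityMeasure.tendsto_iff_tendsto_charFun.2 fun c => ?_⟩
  have h1 := ProbabilityMeasure.tendsto_iff_tendsto_charFun.1 (h c).tendsto 1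
  simp only [ProbabilityMeasure.coe_mk] at h1 ⊢
  rw [charFun_map_inner hZ] at h1
  exact h1.congr fun n => charFun_map_inner (hV n) c

end CentralLimit


/-! ### Equi-Lipschitz mapping and approximation theorems -/

section WeakConvergence

variable {Ω Ω' : Type*} [MeasurableSpace Ω] {P : Measure Ω} [IsProbabilityMeasure P]
  [MeasurableSpace Ω'] {P' : Measure Ω'} [IsProbabilityMeasure P']

lemma tendsto_integral_lipschitz {E : Type*} [PseudoMetricSpace E] [MeasurableSpace E]
    [BorelSpace E] {V : ℕ → Ω → E} {Z : Ω' → E}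
    (h : TendstoInDistribution V atTop Z (fun _ => P) P') {f : E → ℝ} {L : ℝ≥0}
    (hf : LipschitzWith L f) {C : ℝ} (hC : ∀ x y, dist (f x) (f y) ≤ C) :
    Tendsto (fun n => ∫ ω, f (V n ω) ∂P) atTop (𝓝 (∫ ω, f (Z ω) ∂P')) := by
  have h1 := tendsto_iff_forall_lipschitz_integral_tendsto.1 h.tendsto f ⟨C, hC⟩ ⟨L, hf⟩
  simp only [ProbabilityMeasure.coe_mk] at h1
  rw [integral_map h.aemeasurable_limit (hf.continuous.measurable.aestronglyMeasurable)] at h1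
  refine h1.congr fun n => ?_
  rw [integral_map (h.forall_aemeasurable n) hf.continuous.measurable.aestronglyMeasurable]

/-- Equi-Lipschitz functions converging pointwise to zero, evaluated along a sequence converging in
distribution, converge to zero in mean. -/
lemma tendsto_integral_of_lipschitz_zero {E : Type*} [PseudoMetricSpace E] [MeasurableSpace E]
    [BorelSpace E] {V : ℕ → Ω → E} {Z : Ω' → E}
    (h : TendstoInDistribution V atTop Z (fun _ => P) P') {φ : ℕ → E → ℝ} {L : ℝ≥0}
    (hφ : ∀ n, LipschitzWith L (φ n)) (h0 : ∀ n x, 0 ≤ φ n x) (h1 : ∀ n x, φ n x ≤ 1)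
    (hlim : ∀ x, Tendsto (fun n => φ n x) atTop (𝓝 0)) :
    Tendsto (fun n => ∫ ω, φ n (V n ω) ∂P) atTop (𝓝 0) := by
  -- Tail suprema keep the Lipschitz constant and still tend to 0 pointwise. Each fixed `Φ m` is a
  -- bounded Lipschitz test function, so weak convergence applies to it, and dominated convergence
  -- then makes the limiting integral small.
  set Φ : ℕ → E → ℝ := fun m x => ⨆ n, φ (m + n) x with hΦ
  have hbdd : ∀ m x, BddAbove (range fun n => φ (m + n) x) := fun m x =>
    ⟨1, by rintro _ ⟨n, rfl⟩; exact h1 _ _⟩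
  have hle : ∀ m n, m ≤ n → ∀ x, φ n x ≤ Φ m x := by
    intro m n hmn x
    obtain ⟨d, rfl⟩ := Nat.exists_eq_add_of_le hmn
    exact le_ciSup (hbdd m x) d
  have hΦ0 : ∀ m x, 0 ≤ Φ m x := fun m x => (h0 m x).trans (hle m m le_rfl x)
  have hΦ1 : ∀ m x, Φ m x ≤ 1 := fun m x => ciSup_le fun n => h1 _ _
  have hΦL : ∀ m, LipschitzWith L (Φ m) := fun m =>
    LipschitzWith.of_le_add_mul L fun x y => ciSup_le fun n => by
      have h2 := (hφ (m + n)).dist_le_mul x y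
      rw [Real.dist_eq] at h2
      have h3 := le_ciSup (hbdd m y) n
      have h4 := (abs_le.1 h2).2
      show _ ≤ (⨆ n, φ (m + n) y) + _
      linarith
  have hΦlim : ∀ x, Tendsto (fun m => Φ m x) atTop (𝓝 0) := by
    intro x
    rw [Metric.tendsto_atTop]
    intro ε hε
    obtain ⟨N, hN⟩ := Metric.tendsto_atTop.1 (hlim x) (ε / 2) (by positivity)
    refine ⟨N, fun m hm => ?_⟩
    rw [Real.dist_eq, sub_zero, abs_of_nonneg (hΦ0 m x)]
    refine lt_of_le_of_lt (ciSup_le fun n => ?_) (half_lt_self hε)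
    have := hN (m + n) (by omega)
    rw [Real.dist_eq, sub_zero] at this
    exact (le_abs_self _).trans this.le
  have hdist : ∀ m x y, dist (Φ m x) (Φ m y) ≤ 1 := fun m x y => by
    rw [Real.dist_eq, abs_le]
    constructor <;> linarith [hΦ0 m x, hΦ0 m y, hΦ1 m x, hΦ1 m y]
  have hZlim : Tendsto (fun m => ∫ ω, Φ m (Z ω) ∂P') atTop (𝓝 0) := by
    have : (0 : ℝ) = ∫ _, (0 : ℝ) ∂P' := by simp
    rw [this]
    refine tendsto_integral_of_dominated_convergence (fun _ => 1) (fun m =>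
      ((hΦL m).continuous.measurable.comp_aemeasurable h.aemeasurable_limit).aestronglyMeasurable)
      (integrable_const _) (fun m => ae_of_all _ fun ω => ?_) (ae_of_all _ fun ω => hΦlim _)
    rw [Real.norm_of_nonneg (hΦ0 _ _)]
    exact hΦ1 _ _
  have hint : ∀ {g : E → ℝ}, LipschitzWith L g → (∀ x, 0 ≤ g x) → (∀ x, g x ≤ 1) → ∀ n,
      Integrable (fun ω => g (V n ω)) P := fun hg hg0 hg1 n =>
    Integrable.of_bound (hg.continuous.measurable.comp_aemeasurable
      (h.forall_aemeasurable n)).aestronglyMeasurable 1 (ae_of_all _ fun ω => by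
        rw [Real.norm_of_nonneg (hg0 _)]; exact hg1 _)
  rw [Metric.tendsto_atTop]
  intro ε hε
  obtain ⟨m, hm⟩ := (hZlim.eventually (gt_mem_nhds hε)).exists
  have hVm := tendsto_integral_lipschitz h (hΦL m) (hdist m)
  obtain ⟨N, hN⟩ := eventually_atTop.1 (hVm.eventually (gt_mem_nhds hm))
  refine ⟨max N m, fun n hn => ?_⟩
  rw [Real.dist_eq, sub_zero, abs_of_nonneg (integral_nonneg fun ω => h0 _ _)]
  refine lt_of_le_of_lt ?_ (hN n ((le_max_left _ _).trans hn))
  exact integral_mono (hint (hφ n) (h0 n) (h1 n) n) (hint (hΦL m) (hΦ0 m) (hΦ1 m) n)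
    fun ω => hle m n ((le_max_right _ _).trans hn) _

/-- An extended continuous mapping theorem for equi-Lipschitz maps. -/
theorem tendstoInDistribution_of_lipschitz {E : Type*} [PseudoMetricSpace E] [MeasurableSpace E]
    [BorelSpace E] {V : ℕ → Ω → E} {Z : Ω' → E}
    (h : TendstoInDistribution V atTop Z (fun _ => P) P') {g : ℕ → E → ℝ} {g₀ : E → ℝ} {L : ℝ≥0}
    (hg : ∀ n, LipschitzWith L (g n)) (hg₀ : LipschitzWith L g₀)
    (hlim : ∀ x, Tendsto (fun n => g n x) atTop (𝓝 (g₀ x))) :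
    TendstoInDistribution (fun n ω => g n (V n ω)) atTop (fun ω => g₀ (Z ω)) (fun _ => P) P' := by
  have h1 : TendstoInDistribution (fun n ω => g₀ (V n ω)) atTop (fun ω => g₀ (Z ω))
      (fun _ => P) P' := h.continuous_comp hg₀.continuous
  refine tendstoInDistribution_of_tendstoInMeasure_sub _ _ h1 ?_ fun n =>
    (hg n).continuous.measurable.comp_aemeasurable (h.forall_aemeasurable n)
  -- Truncation at 1 makes the test functions bounded without affecting convergence in probability.
  set φ : ℕ → E → ℝ := fun n x => min |g n x - g₀ x| 1 with hφ
  have hφL : ∀ n, LipschitzWith (1 * (L + L)) (φ n) := fun n =>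
    (lipschitzWith_one_norm.comp ((hg n).sub hg₀)).min_const 1
  have hφ0 : ∀ n x, 0 ≤ φ n x := fun n x => le_min (abs_nonneg _) zero_le_one
  have hφ1 : ∀ n x, φ n x ≤ 1 := fun n x => min_le_right _ _
  have hφlim : ∀ x, Tendsto (fun n => φ n x) atTop (𝓝 0) := fun x => by
    have h2 := ((hlim x).sub_const (g₀ x)).abs.min (tendsto_const_nhds (x := (1 : ℝ)))
    simpa using h2
  have hint := tendsto_integral_of_lipschitz_zero h hφL hφ0 hφ1 hφlim
  rw [tendstoInMeasure_iff_norm]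
  intro ε hε
  set c : ℝ := min ε 1 with hc
  have hc0 : 0 < c := lt_min hε one_pos
  have hle : ∀ n, P {ω | ε ≤ ‖((fun n ω => g n (V n ω)) - fun n ω => g₀ (V n ω)) n ω -
      (0 : Ω → ℝ) ω‖} ≤ ENNReal.ofReal ((∫ ω, φ n (V n ω) ∂P) / c) := by
    intro n
    have hsub : {ω | ε ≤ ‖((fun n ω => g n (V n ω)) - fun n ω => g₀ (V n ω)) n ω -
        (0 : Ω → ℝ) ω‖} ⊆ {ω | c ≤ φ n (V n ω)} := by
      intro ω hω
      have hω : ε ≤ |g n (V n ω) - g₀ (V n ω) - 0| := hω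
      rw [sub_zero] at hω
      exact min_le_min_right 1 hω
    have hi : Integrable (fun ω => φ n (V n ω)) P :=
      Integrable.of_bound ((hφL n).continuous.measurable.comp_aemeasurable
        (h.forall_aemeasurable n)).aestronglyMeasurable 1 (ae_of_all _ fun ω => by
          rw [Real.norm_of_nonneg (hφ0 _ _)]; exact hφ1 _ _)
    have h3 := mul_meas_ge_le_integral_of_nonneg (ae_of_all _ fun ω => hφ0 n (V n ω)) hi c
    refine (measure_mono hsub).trans ?_
    rw [← ofReal_measureReal]
    refine ENNReal.ofReal_le_ofReal ?_
    rw [le_div_iff₀ hc0, mul_comm]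
    exact h3
  refine tendsto_of_tendsto_of_tendsto_of_le_of_le tendsto_const_nhds ?_ (fun _ => zero_le) hle
  have h4 := (ENNReal.continuous_ofReal.tendsto _).comp (hint.div_const c)
  rw [zero_div, ENNReal.ofReal_zero] at h4
  exact h4

/-- Convergence in distribution through approximations. -/
theorem tendstoInDistribution_of_approx {T : ℕ → Ω → ℝ} {T' : ℕ → ℕ → Ω → ℝ} {S' : ℕ → Ω' → ℝ}
    {S : Ω' → ℝ} (hT : ∀ n, AEMeasurable (T n) P)
    (h1 : ∀ j, TendstoInDistribution (T' j) atTop (S' j) (fun _ => P) P')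
    (h2 : ∀ᵐ ω ∂P', Tendsto (fun j => S' j ω) atTop (𝓝 (S ω)))
    (h3 : ∀ ε : ℝ, 0 < ε → ∀ δ : ℝ, 0 < δ → ∀ᶠ j in atTop, ∀ᶠ n in atTop,
      P {ω | ε < |T n ω - T' j n ω|} ≤ ENNReal.ofReal δ) :
    TendstoInDistribution T atTop S (fun _ => P) P' := by
  have hS' : ∀ j, AEMeasurable (S' j) P' := fun j => (h1 j).aemeasurable_limit
  have hS : AEMeasurable S P' := aemeasurable_of_tendsto_metrizable_ae atTop hS' h2
  refine ⟨hT, hS, tendsto_iff_forall_lipschitz_integral_tendsto.2 ?_⟩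
  rintro f ⟨C, hC⟩ ⟨L, hf⟩
  have hfm : Measurable f := hf.continuous.measurable
  simp only [ProbabilityMeasure.coe_mk]
  rw [integral_map hS hfm.aestronglyMeasurable]
  simp_rw [integral_map (hT _) hfm.aestronglyMeasurable]
  have hC0 : 0 ≤ C := (dist_nonneg).trans (hC 0 0)
  have hfb : ∀ x, ‖f x‖ ≤ ‖f 0‖ + C := fun x => by
    have := hC x 0
    rw [dist_eq_norm] at this
    linarith [norm_le_norm_sub_add (f x) (f 0)]
  have hint : ∀ {U : Ω → ℝ}, AEMeasurable U P → Integrable (fun ω => f (U ω)) P := fun hU =>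
    Integrable.of_bound (hfm.comp_aemeasurable hU).aestronglyMeasurable _
      (ae_of_all _ fun ω => hfb _)
  rw [Metric.tendsto_atTop]
  intro η hη
  -- Four errors of `η/4`: the Lipschitz part, the exceptional event, and the two weak limits, the
  -- last strictly below. The added 1 avoids division by zero.
  set ε : ℝ := η / 4 / (L + 1) with hε
  have hε0 : 0 < ε := by positivity
  set δ : ℝ := η / 4 / (C + 1) with hδ
  have hδ0 : 0 < δ := by positivity
  have hlim2 := tendsto_integral_lipschitz (tendstoInDistribution_of_ae_tendsto hS' hS h2) hf hC
  obtain ⟨j, hj1, hj2⟩ := ((h3 ε hε0 δ hδ0).and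
    (Metric.tendsto_nhds.1 hlim2 (η / 4) (by positivity))).exists
  have hlim1 := Metric.tendsto_nhds.1 (tendsto_integral_lipschitz (h1 j) hf hC) (η / 4)
    (by positivity)
  obtain ⟨N, hN⟩ := eventually_atTop.1 (hj1.and hlim1)
  refine ⟨N, fun n hn => ?_⟩
  obtain ⟨hn1, hn2⟩ := hN n hn
  have hT' := (h1 j).forall_aemeasurable n
  -- The approximating variables are only almost everywhere measurable, so the exceptional event is
  -- replaced by a measurable hull of the same probability.
  set A := toMeasurable P {ω | ε < |T n ω - T' j n ω|} with hA
  have hAm : MeasurableSet A := measurableSet_toMeasurable _ _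
  have hAP : P.real A ≤ δ := by
    rw [measureReal_def, hA, measure_toMeasurable]
    exact ENNReal.toReal_le_of_le_ofReal hδ0.le hn1
  have hpt : ∀ ω, ‖f (T n ω) - f (T' j n ω)‖ ≤ L * ε + C * A.indicator (fun _ => (1 : ℝ)) ω := by
    intro ω
    by_cases hω : ω ∈ A
    · rw [indicator_of_mem hω, ← dist_eq_norm]
      have := hC (T n ω) (T' j n ω)
      have h5 : 0 ≤ (L : ℝ) * ε := by positivity
      linarith
    · rw [indicator_of_notMem hω, ← dist_eq_norm, mul_zero, add_zero]
      refine (hf.dist_le_mul _ _).trans ?_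
      have h6 : ¬ ε < |T n ω - T' j n ω| := fun h => hω (subset_toMeasurable _ _ h)
      gcongr
      exact not_lt.1 h6
  have hd1 : dist (∫ ω, f (T n ω) ∂P) (∫ ω, f (T' j n ω) ∂P) ≤ η / 2 := by
    rw [dist_eq_norm, ← integral_sub (hint (hT n)) (hint hT')]
    have hAi : Integrable (A.indicator fun _ => (1 : ℝ)) P := (integrable_const 1).indicator hAm
    have hb : Integrable (fun ω => L * ε + C * A.indicator (fun _ => (1 : ℝ)) ω) P :=
      (integrable_const _).add (hAi.const_mul C)
    refine (norm_integral_le_of_norm_le hb (ae_of_all _ hpt)).trans ?_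
    rw [integral_add (integrable_const _) (hAi.const_mul C),
      integral_const_mul C (A.indicator fun _ => (1 : ℝ)), integral_indicator_const _ hAm]
    simp only [integral_const, probReal_univ, smul_eq_mul, one_mul, mul_one]
    have h7 : L * ε ≤ η / 4 := by
      rw [hε, mul_div_assoc', div_le_iff₀ (by positivity)]
      nlinarith [L.coe_nonneg]
    have h8 : C * P.real A ≤ η / 4 := by
      refine (mul_le_mul_of_nonneg_left hAP hC0).trans ?_
      rw [hδ, mul_div_assoc', div_le_iff₀ (by positivity)]
      nlinarith
    linarith
  calc dist (∫ ω, f (T n ω) ∂P) (∫ ω, f (S ω) ∂P')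
      ≤ dist (∫ ω, f (T n ω) ∂P) (∫ ω, f (T' j n ω) ∂P) +
        dist (∫ ω, f (T' j n ω) ∂P) (∫ ω, f (S' j ω) ∂P') +
        dist (∫ ω, f (S' j ω) ∂P') (∫ ω, f (S ω) ∂P') := dist_triangle4 _ _ _ _
    _ < η := by linarith

end WeakConvergence


/-! ### Central limit theorem for the cell averages -/

section CellCentralLimit

lemma aemeasurable_of_inner {A ι : Type*} [MeasurableSpace A] [Fintype ι] {ν : Measure A}
    {U : A → EuclideanSpace ℝ ι} (h : ∀ c, AEMeasurable (fun a => inner ℝ (U a) c) ν) :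
    AEMeasurable U ν := by
  classical
  have h1 : AEMeasurable (fun a => WithLp.ofLp (U a)) ν := aemeasurable_pi_iff.2 fun i => by
    simpa [EuclideanSpace.inner_single_right] using h (EuclideanSpace.single i 1)
  exact (PiLp.continuous_toLp 2 (fun _ : ι => ℝ)).measurable.comp_aemeasurable h1

variable {k : ℕ} {Ω Ω' : Type*} [MeasurableSpace Ω] {P : Measure Ω} [IsProbabilityMeasure P]
  [MeasurableSpace Ω'] {P' : Measure Ω'} [IsProbabilityMeasure P']
  {μ : Measure ℝ} [IsProbabilityMeasure μ] {X : ℕ → Ω → ℝ} {p : ℝ}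
  {Q : Param k → Measure ℝ} {θF : Param k} {Gdot l : ℝ → Param k} {𝔾 : ℝ → Ω' → ℝ}

lemma integrableOn_limitSummand (hp : 1 ≤ p) (hG : LpDifferentiable p Q θF Gdot) (x : ℝ) (j : ℕ)
    (i : ℤ) : IntegrableOn (fun t => limitSummand μ Gdot l t x) (cell j i) :=
  (integrableOn_centeredInd x j i).sub (integrableOn_cell hp (hG.memLp_inner hp (l x)) j i)

lemma integrableOn_linProc (hp : 1 ≤ p) (hG : LpDifferentiable p Q θF Gdot) (n : ℕ) (ω : Ω) (j : ℕ)
    (i : ℤ) : IntegrableOn (linProc μ Gdot l X n ω) (cell j i) := by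
  unfold linProc normSum
  exact (integrable_finsetSum _ fun a _ => integrableOn_limitSummand hp hG _ j i).const_mul _

/-- The summand in the linear combination of cell averages of the linearized process. -/
noncomputable def cellSummand (μ : Measure ℝ) (Gdot l : ℝ → Param k) (j : ℕ)
    (c : EuclideanSpace ℝ (cells j)) (x : ℝ) : ℝ :=
  ∫ t, limitSummand μ Gdot l t x * cellWeight j c t

/-- Exchanging the finite sum with the integral exhibits the linear functional as a normalized sum
of i.i.d. variables. -/
lemma inner_cellVec_linProc (hp : 1 ≤ p) (hG : LpDifferentiable p Q θF Gdot) (j n : ℕ)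
    (c : EuclideanSpace ℝ (cells j)) (ω : Ω) :
    inner ℝ (cellVec j (linProc μ Gdot l X n ω)) c =
      normSum X (cellSummand μ Gdot l j c) n ω := by
  rw [inner_cellVec (integrableOn_linProc hp hG n ω j)]
  unfold linProc normSum cellSummand
  simp_rw [mul_assoc, Finset.sum_mul]
  rw [integral_const_mul, integral_finsetSum _ fun a _ =>
    integrable_mul_cellWeight (integrableOn_limitSummand hp hG (X a ω) j) c]

lemma integrable_sqrt_limitCov_mul_cellWeight (hp : 1 ≤ p) (hL : LorentzCond p μ)
    (hG : LpDifferentiable p Q θF Gdot) (hl : MemLp l 2 μ) (h0 : ∫ x, l x ∂μ = 0)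
    (j : ℕ) (c : EuclideanSpace ℝ (cells j)) :
    Integrable (fun t => √(limitCov μ Gdot l t t) * cellWeight j c t) :=
  integrable_mul_cellWeight (integrableOn_cell hp (memLp_sqrt_limitCov hp hL hG hl h0) j) c

lemma lintegral_limitSummand_mul_cellWeight_ne_top (hp : 1 ≤ p) (hL : LorentzCond p μ)
    (hG : LpDifferentiable p Q θF Gdot) (hl : MemLp l 2 μ) (h0 : ∫ x, l x ∂μ = 0)
    (j : ℕ) (c : EuclideanSpace ℝ (cells j)) :
    ∫⁻ t, eLpNorm (limitSummand μ Gdot l t) 2 μ * ‖cellWeight j c t‖ₑ ≠ ∞ := by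
  have := (integrable_sqrt_limitCov_mul_cellWeight hp hL hG hl h0 j c).2
  rw [hasFiniteIntegral_iff_enorm] at this
  refine ne_of_lt (lt_of_le_of_lt (le_of_eq (lintegral_congr fun t => ?_)) this)
  rw [eLpNorm_limitSummand_two hl h0, enorm_mul, Real.enorm_eq_ofReal (Real.sqrt_nonneg _)]

lemma memLp_cellSummand (hp : 1 ≤ p) (hL : LorentzCond p μ)
    (hG : LpDifferentiable p Q θF Gdot) (hl : MemLp l 2 μ) (h0 : ∫ x, l x ∂μ = 0)
    (j : ℕ) (c : EuclideanSpace ℝ (cells j)) :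
    MemLp (cellSummand μ Gdot l j c) 2 μ :=
  memLp_two_integral (aemeasurable_limitSummand hG.aemeasurable hl)
    (measurable_cellWeight j c).aemeasurable
    (lintegral_limitSummand_mul_cellWeight_ne_top hp hL hG hl h0 j c)

lemma integral_cellSummand (hp : 1 ≤ p) (hL : LorentzCond p μ)
    (hG : LpDifferentiable p Q θF Gdot) (hl : MemLp l 2 μ) (h0 : ∫ x, l x ∂μ = 0)
    (j : ℕ) (c : EuclideanSpace ℝ (cells j)) :
    ∫ x, cellSummand μ Gdot l j c x ∂μ = 0 := by
  have h := integral_mul_integral_process (aemeasurable_limitSummand hG.aemeasurable hl)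
    (fun t => (memLp_limitSummand hl t).1.aemeasurable) (measurable_cellWeight j c).aemeasurable
    (lintegral_limitSummand_mul_cellWeight_ne_top hp hL hG hl h0 j c)
    (R := fun _ => 1) (memLp_const 1)
  simp only [one_mul, integral_limitSummand hl h0, zero_mul, integral_zero] at h
  exact h

lemma integral_cellSummand_sq (hp : 1 ≤ p) (hL : LorentzCond p μ)
    (hG : LpDifferentiable p Q θF Gdot) (hl : MemLp l 2 μ) (h0 : ∫ x, l x ∂μ = 0)
    (j : ℕ) (c : EuclideanSpace ℝ (cells j)) :
    ∫ x, cellSummand μ Gdot l j c x ^ 2 ∂μ =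
      ∫ t, (∫ s, limitCov μ Gdot l t s * cellWeight j c s) * cellWeight j c t :=
  integral_sq_integral_process (aemeasurable_limitSummand hG.aemeasurable hl)
    (fun t => memLp_limitSummand hl t) (measurable_cellWeight j c).aemeasurable
    (lintegral_limitSummand_mul_cellWeight_ne_top hp hL hG hl h0 j c)
    fun s t => integral_limitSummand_mul hl h0 s t

/-- The central limit theorem for cell averages. -/
theorem tendstoInDistribution_cellVec (hp : 1 ≤ p) (hL : LorentzCond p μ)
    (hG : LpDifferentiable p Q θF Gdot) (hl : MemLp l 2 μ) (h0 : ∫ x, l x ∂μ = 0)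
    (hX : ∀ i, HasLaw (X i) μ P) (hind : iIndepFun X P)
    (h𝔾 : IsCenteredGaussian P' (limitCov μ Gdot l) 𝔾) (j : ℕ) :
    TendstoInDistribution (fun n ω => cellVec j (linProc μ Gdot l X n ω)) atTop
      (fun ω => cellVec j fun t => 𝔾 t ω) (fun _ => P) P' := by
  have hK := memLp_sqrt_limitCov hp hL hG hl h0
  have hlaw := fun c => h𝔾.hasLaw_integral (measurable_cellWeight j c).aemeasurable
    (integrable_sqrt_limitCov_mul_cellWeight hp hL hG hl h0 j c)
  -- The representation of the functional needs paths integrable on the cells, which is known only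
  -- for almost every `ω`.
  have hae : ∀ c, (fun ω => ∫ t, 𝔾 t ω * cellWeight j c t) =ᵐ[P'] fun ω =>
      inner ℝ (cellVec j fun t => 𝔾 t ω) c := fun c => by
    filter_upwards [h𝔾.ae_memLp hp hK] with ω hω
    rw [inner_cellVec fun i => integrableOn_cell hp hω j i]
  refine tendstoInDistribution_of_inner (fun n => ?_) ?_ fun c => ?_
  · refine aemeasurable_of_inner fun c => ?_
    simp_rw [inner_cellVec_linProc hp hG]
    exact aemeasurable_normSum hX (memLp_cellSummand hp hL hG hl h0 j c).1.aemeasurable n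
  · exact aemeasurable_of_inner fun c => (hlaw c).aemeasurable.congr (hae c)
  · simp_rw [inner_cellVec_linProc hp hG]
    refine TendstoInDistribution.congr (fun _ => ae_eq_rfl) (hae c)
      (tendstoInDistribution_normSum hX hind (memLp_cellSummand hp hL hG hl h0 j c)
        (integral_cellSummand hp hL hG hl h0 j c) ?_)
    -- Summand and Gaussian integral have the same variance because the same second-moment formula,
    -- with kernel `limitCov`, applies to both.
    rw [integral_cellSummand_sq hp hL hG hl h0]
    exact hlaw c

end CellCentralLimit

/-! ### Weak convergence of the statistic -/

section Statistic

variable {k : ℕ} {Ω Ω' : Type*} [MeasurableSpace Ω] {P : Measure Ω} [IsProbabilityMeasure P]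
  [MeasurableSpace Ω'] {P' : Measure Ω'} [IsProbabilityMeasure P']
  {μ : Measure ℝ} [IsProbabilityMeasure μ] {X : ℕ → Ω → ℝ} {p : ℝ}
  {Q : Param k → Measure ℝ} {θF : Param k} {Gdot l : ℝ → Param k} {𝔾 : ℝ → Ω' → ℝ}
  {θhat : ℕ → Ω → Param k}

/-- Distribution functions that agree almost everywhere agree. -/
lemma cdf_eq_of_ae_eq {μ ν : Measure ℝ} (h : (cdf μ : ℝ → ℝ) =ᵐ[volume] cdf ν) :
    (cdf μ : ℝ → ℝ) = cdf ν := by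
  funext t
  have hd : Dense {s | cdf μ s = cdf ν s} := Measure.dense_of_ae h
  have h1 : ∃ u : ℕ → ℝ, (∀ n, u n ∈ {s | cdf μ s = cdf ν s}) ∧ (∀ n, t ≤ u n) ∧
      Tendsto u atTop (𝓝 t) := by
    have : ∀ n : ℕ, ∃ s ∈ {s | cdf μ s = cdf ν s}, s ∈ Ioo t (t + 1 / ((n : ℝ) + 1)) := fun n =>
      hd.exists_between (by
        have : (0 : ℝ) < 1 / ((n : ℝ) + 1) := by positivity
        linarith)
    choose u hu1 hu2 using this
    refine ⟨u, hu1, fun n => (hu2 n).1.le, ?_⟩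
    refine tendsto_of_tendsto_of_tendsto_of_le_of_le tendsto_const_nhds
      (by simpa using tendsto_one_div_add_atTop_nhds_zero_nat.const_add t)
      (fun n => (hu2 n).1.le) fun n => (hu2 n).2.le
  obtain ⟨u, hu1, hu2, hu3⟩ := h1
  have hut : Tendsto u atTop (𝓝[≥] t) :=
    tendsto_nhdsWithin_iff.2 ⟨hu3, Eventually.of_forall hu2⟩
  have l1 := ((cdf μ).right_continuous t).tendsto.comp hut
  have l2 := ((cdf ν).right_continuous t).tendsto.comp hut
  refine tendsto_nhds_unique l1 (l2.congr fun n => ?_)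
  exact (hu1 n).symm

/-- The estimated process is normalized so that adding `z/√n` to `F - G(θ_F)` gives `𝔽ₙ - G(θ̂ₙ)`.
At `n = 0` both sides vanish with the factor `√0`. -/
lemma testStat_eq (n : ℕ) (ω : Ω) :
    testStat p μ Q θF X θhat n ω =
      normQuotient p (cdf μ) (cdf (Q θF)) n (estProc μ Q θF X θhat n ω) := by
  rcases Nat.eq_zero_or_pos n with rfl | hn
  · simp [testStat, normQuotient]
  have hs : √(n : ℝ) ≠ 0 := (Real.sqrt_pos.2 (by exact_mod_cast hn)).ne'
  unfold testStat normQuotient lpDist lpNormReal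
  congr 5
  funext t
  simp only [Pi.add_apply, Pi.sub_apply, Pi.smul_apply, smul_eq_mul, estProc]
  rw [← mul_assoc, inv_mul_cancel₀ hs]
  ring

lemma measurable_empCDF (n : ℕ) (ω : Ω) : Measurable (empCDF X n ω) := by
  unfold empCDF
  exact (Finset.measurable_fun_sum _ fun i _ => measurable_indicator_Iic _).const_mul _

lemma measurable_estProc (n : ℕ) (ω : Ω) : Measurable (estProc μ Q θF X θhat n ω) := by
  unfold estProc
  exact (((measurable_empCDF n ω).sub (measurable_cdf' _)).sub
    ((measurable_cdf' _).sub (measurable_cdf' _))).const_mul _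

/-- Weak convergence of the goodness-of-fit statistic. -/
theorem tendstoInDistribution_testStat {ψ : Param k → ℝ → Param k} {V : Param k ≃L[ℝ] Param k}
    (hp : 1 ≤ p) (hL : LorentzCond p μ)
    (hFG : MemLp (fun t => cdf μ t - cdf (Q θF) t) (ENNReal.ofReal p) volume)
    (hX : ∀ i, HasLaw (X i) μ P) (hind : iIndepFun X P) (hG : LpDifferentiable p Q θF Gdot)
    (hψ : AsympLinear P ψ μ θF V X θhat) (h0 : ∫ x, ψ θF x ∂μ = 0)
    (h𝔾 : IsCenteredGaussian P' (limitCov μ Gdot (influence ψ θF V)) 𝔾)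
    (hT : ∀ n, AEMeasurable (testStat p μ Q θF X θhat n) P) :
    TendstoInDistribution (testStat p μ Q θF X θhat) atTop
      (limitVar p (cdf μ) (cdf (Q θF)) 𝔾) (fun _ => P) P' := by
  set l := influence ψ θF V with hl
  set F : ℝ → ℝ := ⇑(cdf μ) with hF
  set G : ℝ → ℝ := ⇑(cdf (Q θF)) with hGdef
  have hl2 : MemLp l 2 μ := memLp_influence hψ.memLp_two
  have hl0 : ∫ x, l x ∂μ = 0 := integral_influence (hψ.memLp_two.integrable one_le_two) h0
  have hFm : Measurable F := measurable_cdf' _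
  have hGm : Measurable G := measurable_cdf' _
  have hEq : F =ᵐ[volume] G → F = G := cdf_eq_of_ae_eq
  have hD : MemLp (F - G) (ENNReal.ofReal p) volume := hFG
  have hK := memLp_sqrt_limitCov hp hL hG hl2 hl0
  have hstep : ∀ j v, MemLp (stepFun j v) (ENNReal.ofReal p) volume := fun j v =>
    memLp_stepFun j v _
  have hlip : ∀ {j : ℕ} {g : EuclideanSpace ℝ (cells j) → ℝ},
      (∀ v w, |g v - g w| ≤ lpNormReal p (stepFun j v - stepFun j w)) →
      LipschitzWith (stepConst p j) g := fun {j g} h =>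
    LipschitzWith.of_dist_le_mul fun v w => by
      rw [Real.dist_eq, dist_eq_norm]
      refine (h v w).trans ?_
      rw [stepFun_sub]
      exact lpNormReal_stepFun_le hp j _
  have happrox : ∀ j, TendstoInDistribution
      (fun n ω => normQuotient p F G n (averaging j (linProc μ Gdot l X n ω))) atTop
      (fun ω => normDirDeriv p F G (averaging j fun t => 𝔾 t ω)) (fun _ => P) P' := by
    intro j
    simp_rw [averaging_eq_stepFun]
    exact tendstoInDistribution_of_lipschitz
      (tendstoInDistribution_cellVec hp hL hG hl2 hl0 hX hind h𝔾 j)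
      (g := fun n v => normQuotient p F G n (stepFun j v))
      (g₀ := fun v => normDirDeriv p F G (stepFun j v))
      (fun n => hlip fun v w => abs_normQuotient_sub_le hp hD (hstep j v) (hstep j w) n)
      (hlip fun v w => abs_normDirDeriv_sub_le hp hFm hGm hEq hD (hstep j v) (hstep j w))
      (fun v => tendsto_normQuotient hp hFm hGm hEq hD (hstep j v))
  refine tendstoInDistribution_of_approx hT happrox ?_ ?_
  · filter_upwards [h𝔾.ae_memLp hp hK] with ω hω
    rw [limitVar_eq, tendsto_iff_dist_tendsto_zero]
    have h1 := (ENNReal.tendsto_toReal ENNReal.zero_ne_top).comp (tendsto_averaging hp hω)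
    refine squeeze_zero (fun _ => dist_nonneg) (fun j => ?_) h1
    rw [Real.dist_eq]
    exact abs_normDirDeriv_sub_le hp hFm hGm hEq hD (memLp_averaging j _) hω
  · intro ε hε δ hδ
    filter_upwards [eventually_measure_estProc_sub_averaging_le hp hL hX hind hG hψ h0 hε hδ]
      with j hj
    filter_upwards [hj] with n hn
    refine (measure_mono fun ω hω => ?_).trans hn
    by_contra hcon
    have hcon : eLpNorm (fun t => estProc μ Q θF X θhat n ω t - averaging j (linProc μ Gdot l X n ω) t)
      (ENNReal.ofReal p) volume ≤ ENNReal.ofReal ε := not_lt.1 hcon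
    have hA : MemLp (averaging j (linProc μ Gdot l X n ω)) (ENNReal.ofReal p) volume :=
      memLp_averaging j _
    have hd : MemLp (estProc μ Q θF X θhat n ω - averaging j (linProc μ Gdot l X n ω))
        (ENNReal.ofReal p) volume :=
      ⟨((measurable_estProc n ω).sub (measurable_averaging j _)).aestronglyMeasurable,
        hcon.trans_lt ENNReal.ofReal_lt_top⟩
    -- No assumption puts the estimated process in `Lᵖ`. On the good event it follows from finite
    -- distance to a step function.
    have hE : MemLp (estProc μ Q θF X θhat n ω) (ENNReal.ofReal p) volume := by
      simpa using hd.add hA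
    have hω : ε < |testStat p μ Q θF X θhat n ω -
      normQuotient p F G n (averaging j (linProc μ Gdot l X n ω))| := hω
    rw [testStat_eq] at hω
    refine absurd hω (not_lt.2 ((abs_normQuotient_sub_le hp hD hE hA n).trans ?_))
    exact ENNReal.toReal_le_of_le_ofReal hε.le hcon

end Statistic


/-! ### Measurability of the statistic -/

section Measurability

variable {k : ℕ} {Ω : Type*} [MeasurableSpace Ω] {P : Measure Ω} [IsProbabilityMeasure P]
  {μ : Measure ℝ} [IsProbabilityMeasure μ] {X : ℕ → Ω → ℝ} {p : ℝ}
  {Q : Param k → Measure ℝ} {θF : Param k} {θhat : ℕ → Ω → Param k}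

/-- The right endpoint takes countably many values and approaches `t` from the right, which suits
the right-continuity of distribution functions. -/
lemma tendsto_right_endpoint (t : ℝ) :
    Tendsto (fun j : ℕ => (cellIndex j t + 1 : ℝ) / (j + 1)) atTop (𝓝[≥] t) := by
  have hcell : ∀ j : ℕ, t ∈ cell j (cellIndex j t) := fun j => mem_cell_cellIndex j t
  refine tendsto_nhdsWithin_iff.2 ⟨?_, Eventually.of_forall fun j => (hcell j).2⟩
  have h1 : Tendsto (fun j : ℕ => t + 1 / ((j : ℝ) + 1)) atTop (𝓝 t) := by
    simpa using tendsto_one_div_add_atTop_nhds_zero_nat.const_add t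
  refine tendsto_of_tendsto_of_tendsto_of_le_of_le tendsto_const_nhds h1 (fun j => (hcell j).2)
    fun j => ?_
  have h2 := (hcell j).1
  have e : ((cellIndex j t + 1 : ℝ) / (j + 1)) =
      (cellIndex j t : ℝ) / (j + 1) + 1 / (j + 1) := by ring
  simp only [e]
  linarith

/-- Processes with measurable sections and right-continuous paths are jointly measurable. -/
lemma measurable_of_rightContinuous {H : Ω → ℝ → ℝ} (hm : ∀ t, Measurable fun ω => H ω t)
    (hc : ∀ ω t, ContinuousWithinAt (H ω) (Ici t) t) :
    Measurable fun z : Ω × ℝ => H z.1 z.2 := by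
  refine measurable_of_tendsto_metrizable
    (f := fun (j : ℕ) (z : Ω × ℝ) => H z.1 ((cellIndex j z.2 + 1 : ℝ) / (j + 1))) (fun j => ?_) ?_
  · have h1 : Measurable fun z : Ω × ℤ => H z.1 ((z.2 + 1 : ℝ) / (j + 1)) :=
      measurable_from_prod_countable_left fun i => hm ((i + 1 : ℝ) / (j + 1))
    exact h1.comp (measurable_fst.prodMk ((measurable_cellIndex j).comp measurable_snd))
  · rw [tendsto_pi_nhds]
    exact fun z => (hc z.1 z.2).tendsto.comp (tendsto_right_endpoint z.2)

/-- The distribution functions at a random parameter are jointly measurable. -/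
lemma aemeasurable_cdf_estimator {Θ : Set (Param k)}
    (hQ : ∀ t : ℝ, Measurable fun θ : Θ => cdf (Q (θ : Param k)) t) {θ : Ω → Param k}
    (hθ : AEMeasurable θ P) (hmem : ∀ᵐ ω ∂P, θ ω ∈ Θ) :
    AEMeasurable (fun z : Ω × ℝ => cdf (Q (θ z.1)) z.2) (P.prod volume) := by
  have hae : ∀ᵐ ω ∂P, θ ω = hθ.mk θ ω ∧ θ ω ∈ Θ := hθ.ae_eq_mk.and hmem
  -- Measurability in the parameter is assumed on `Θ` only. Off a measurable null set the estimator
  -- lies in `Θ` and equals a measurable map; on the null set the process is replaced by 0.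
  obtain ⟨N, hsub, hNm, hN0⟩ := exists_measurable_superset_of_null (ae_iff.1 hae)
  have hS : ∀ ω ∈ Nᶜ, θ ω = hθ.mk θ ω ∧ θ ω ∈ Θ := fun ω hω => by
    by_contra h
    exact hω (hsub h)
  set H : Ω → ℝ → ℝ := fun ω t => Nᶜ.indicator (fun ω => cdf (Q (θ ω)) t) ω with hH
  have hHm : ∀ t, Measurable fun ω => H ω t := by
    intro t
    refine measurable_of_restrict_of_restrict_compl hNm.compl ?_ ?_
    · have hmk : Measurable fun ω : (Nᶜ : Set Ω) =>
          (⟨hθ.mk θ ω, by rw [← (hS ω ω.2).1]; exact (hS ω ω.2).2⟩ : Θ) :=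
        (hθ.measurable_mk.comp measurable_subtype_coe).subtype_mk
      have := (hQ t).comp hmk
      convert this using 1
      funext ω
      simp only [hH, Set.domRestrict_apply, Function.comp]
      rw [indicator_of_mem ω.2, (hS ω ω.2).1]
    · have : (Nᶜᶜ).domRestrict (fun ω => H ω t) = fun _ => 0 := by
        funext ω
        simp only [hH, Set.domRestrict_apply]
        exact indicator_of_notMem ω.2 _
      rw [this]; exact measurable_const
  have hHc : ∀ ω t, ContinuousWithinAt (H ω) (Ici t) t := by
    intro ω t
    by_cases hω : ω ∈ Nᶜ
    · have : H ω = ⇑(cdf (Q (θ ω))) := by funext s; simp only [hH]; rw [indicator_of_mem hω]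
      rw [this]; exact (cdf (Q (θ ω))).right_continuous t
    · have : H ω = fun _ => 0 := by funext s; simp only [hH]; rw [indicator_of_notMem hω]
      rw [this]; exact continuousWithinAt_const
  refine ⟨fun z => H z.1 z.2, measurable_of_rightContinuous hHm hHc, ?_⟩
  have hN : ∀ᵐ z : Ω × ℝ ∂P.prod volume, z.1 ∈ Nᶜ :=
    Measure.quasiMeasurePreserving_fst.ae (measure_eq_zero_iff_ae_notMem.1 hN0)
  filter_upwards [hN] with z hz
  simp only [hH]
  rw [indicator_of_mem hz]

theorem aemeasurable_testStat (hp : 1 ≤ p) {Θ : Set (Param k)}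
    (hQ : ∀ t : ℝ, Measurable fun θ : Θ => cdf (Q (θ : Param k)) t)
    (hX : ∀ i, HasLaw (X i) μ P) (hθ : ∀ n, AEMeasurable (θhat n) P)
    (hmem : ∀ n, ∀ᵐ ω ∂P, θhat n ω ∈ Θ) (n : ℕ) :
    AEMeasurable (testStat p μ Q θF X θhat n) P := by
  have hp0 : 0 < p := by linarith
  have hE : AEMeasurable (fun z : Ω × ℝ => empCDF X n z.1 z.2) (P.prod volume) := by
    unfold empCDF
    refine AEMeasurable.const_mul (Finset.aemeasurable_fun_sum _ fun i _ => ?_) _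
    have hm : Measurable fun z : ℝ × ℝ => (Iic z.2).indicator (fun _ => (1 : ℝ)) z.1 := by
      have : (fun z : ℝ × ℝ => (Iic z.2).indicator (fun _ => (1 : ℝ)) z.1) =
          {z : ℝ × ℝ | z.1 ≤ z.2}.indicator fun _ => (1 : ℝ) := by
        funext z; simp [indicator]
      rw [this]
      exact measurable_const.indicator (measurableSet_le measurable_fst measurable_snd)
    exact hm.comp_aemeasurable
      (((hX i).aemeasurable.comp_fst (ν := volume)).prodMk measurable_snd.aemeasurable)
  have hd := ((hE.sub (aemeasurable_cdf_estimator hQ (hθ n) (hmem n))).enorm.pow_const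
    p).lintegral_prod_right'
  have e : ∀ ω, lpDist p (empCDF X n ω) (cdf (Q (θhat n ω))) =
      ((∫⁻ t, ‖empCDF X n ω t - cdf (Q (θhat n ω)) t‖ₑ ^ p) ^ p⁻¹).toReal := fun ω => by
    rw [lpDist, ← eLpNorm_rpow_eq hp, ← ENNReal.rpow_mul, mul_inv_cancel₀ hp0.ne',
      ENNReal.rpow_one]
  unfold testStat
  simp_rw [e]
  exact (((hd.pow_const _).ennreal_toReal).sub_const _).const_mul _

end Measurability


/-! ### When the limit law is normal -/

section LimitLaw

variable {Ω' : Type*} [MeasurableSpace Ω'] {P' : Measure Ω'} [IsProbabilityMeasure P']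
  {K : ℝ → ℝ → ℝ} {𝔾 : ℝ → Ω' → ℝ} {p : ℝ}

lemma IsCenteredGaussian.lintegral_enorm_eq_zero_iff (h : IsCenteredGaussian P' K 𝔾) (t : ℝ) :
    ∫⁻ ω, ‖𝔾 t ω‖ₑ ∂P' = 0 ↔ K t t = 0 := by
  have hm := h.memLp_two t
  have h1 : ∫⁻ ω, ‖𝔾 t ω‖ₑ ∂P' = 0 ↔ eLpNorm (𝔾 t) 2 P' = 0 := by
    rw [← eLpNorm_one_eq_lintegral_enorm, eLpNorm_eq_zero_iff hm.1 one_ne_zero,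
      eLpNorm_eq_zero_iff hm.1 two_ne_zero]
  rw [h1, h.eLpNorm_two, ENNReal.ofReal_eq_zero]
  constructor
  · intro h2
    exact (Real.sqrt_eq_zero (h.nonneg t)).1 (le_antisymm h2 (Real.sqrt_nonneg _))
  · intro h2
    rw [h2, Real.sqrt_zero]

/-- A Gaussian process vanishes on a set if and only if its variance does. -/
lemma IsCenteredGaussian.ae_ae_eq_zero_iff (h : IsCenteredGaussian P' K 𝔾) {C : Set ℝ}
    (hC : MeasurableSet C) :
    (∀ᵐ ω ∂P', ∀ᵐ t : ℝ, t ∈ C → 𝔾 t ω = 0) ↔ ∀ᵐ t : ℝ, t ∈ C → K t t = 0 := by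
  have hm : AEMeasurable (fun z : Ω' × ℝ => C.indicator (fun t => ‖𝔾 t z.1‖ₑ) z.2)
      (P'.prod volume) := by
    have e : (fun z : Ω' × ℝ => C.indicator (fun t => ‖𝔾 t z.1‖ₑ) z.2) =
        (Prod.snd ⁻¹' C).indicator fun z : Ω' × ℝ => ‖𝔾 z.2 z.1‖ₑ := by
      funext z
      by_cases hz : z.2 ∈ C
      · rw [indicator_of_mem hz, indicator_of_mem (show z ∈ Prod.snd ⁻¹' C from hz)]
      · rw [indicator_of_notMem hz, indicator_of_notMem (show z ∉ Prod.snd ⁻¹' C from hz)]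
    rw [e]
    exact h.aemeasurable.enorm.indicator (measurable_snd hC)
  -- Both conditions express the vanishing of `E ∫_C |𝔾|`, integrated in one order or the other.
  have h1 : (∀ᵐ ω ∂P', ∀ᵐ t : ℝ, t ∈ C → 𝔾 t ω = 0) ↔
      ∫⁻ ω, (∫⁻ t, C.indicator (fun t => ‖𝔾 t ω‖ₑ) t) ∂P' = 0 := by
    rw [lintegral_eq_zero_iff' hm.lintegral_prod_right']
    have hsec : ∀ᵐ ω ∂P', AEMeasurable (fun t => C.indicator (fun t => ‖𝔾 t ω‖ₑ) t) volume := by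
      filter_upwards [Measure.ae_ae_of_ae_prod hm.ae_eq_mk] with ω hω
      exact ⟨fun t => hm.mk _ (ω, t), hm.measurable_mk.comp measurable_prodMk_left, hω⟩
    constructor
    · intro h2
      filter_upwards [h2, hsec] with ω hω hs
      show ∫⁻ t, C.indicator (fun t => ‖𝔾 t ω‖ₑ) t = 0
      rw [lintegral_eq_zero_iff' hs]
      filter_upwards [hω] with t ht
      by_cases htC : t ∈ C
      · simp [ht htC]
      · simp [htC]
    · intro h2
      filter_upwards [h2, hsec] with ω hω hs
      have hω : ∫⁻ t, C.indicator (fun t => ‖𝔾 t ω‖ₑ) t = 0 := hω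
      rw [lintegral_eq_zero_iff' hs] at hω
      filter_upwards [hω] with t ht htC
      have ht : C.indicator (fun t => ‖𝔾 t ω‖ₑ) t = 0 := ht
      rw [indicator_of_mem htC] at ht
      simpa using ht
  have h2 : (∀ᵐ t : ℝ, t ∈ C → K t t = 0) ↔
      ∫⁻ t, (∫⁻ ω, C.indicator (fun t => ‖𝔾 t ω‖ₑ) t ∂P') = 0 := by
    have hpt : ∀ t, ∫⁻ ω, C.indicator (fun t => ‖𝔾 t ω‖ₑ) t ∂P' = 0 ↔ (t ∈ C → K t t = 0) := by
      intro t
      by_cases htC : t ∈ C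
      · simp only [htC, indicator_of_mem, true_implies]
        exact h.lintegral_enorm_eq_zero_iff t
      · simp [htC]
    have hm2 : AEMeasurable (fun t => ∫⁻ ω, C.indicator (fun t => ‖𝔾 t ω‖ₑ) t ∂P') volume :=
      hm.prod_swap.lintegral_prod_right'
    rw [lintegral_eq_zero_iff' hm2]
    exact eventually_congr (Eventually.of_forall fun t => (hpt t).symm)
  rw [h1, h2, lintegral_lintegral_swap (f := fun ω t => C.indicator (fun t => ‖𝔾 t ω‖ₑ) t) hm]

lemma IsZeroMeanNormal.integral_eq_zero {T : Ω' → ℝ} (h : IsZeroMeanNormal P' T) :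
    ∫ ω, T ω ∂P' = 0 := by
  obtain ⟨v, hv⟩ := h
  rw [hv.integral_eq, integral_id_gaussianReal]

lemma IsZeroMeanNormal.integrable {T : Ω' → ℝ} (h : IsZeroMeanNormal P' T) : Integrable T P' := by
  obtain ⟨v, hv⟩ := h
  have h1 : Integrable id (gaussianReal 0 v) := (memLp_id_gaussianReal 1).integrable le_rfl
  rw [← hv.map_eq] at h1
  exact (integrable_map_measure measurable_id.aestronglyMeasurable hv.aemeasurable).1 h1

lemma IsCenteredGaussian.isZeroMeanNormal_integral (h : IsCenteredGaussian P' K 𝔾) {f : ℝ → ℝ}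
    (hf : AEMeasurable f volume) (hfin : Integrable fun t => √(K t t) * f t) :
    IsZeroMeanNormal P' fun ω => ∫ t, 𝔾 t ω * f t :=
  ⟨_, h.hasLaw_integral hf hfin⟩

lemma IsZeroMeanNormal.congr {T S : Ω' → ℝ} (h : IsZeroMeanNormal P' T) (hS : S =ᵐ[P'] T) :
    IsZeroMeanNormal P' S := by
  obtain ⟨v, hv⟩ := h
  exact ⟨v, hv.congr hS⟩

lemma abs_sign_le_one (x : ℝ) : |Real.sign x| ≤ 1 := by
  rcases Real.sign_apply_eq x with h | h | h <;> simp [h]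

lemma measurable_sign : Measurable Real.sign := by
  unfold Real.sign
  exact Measurable.ite measurableSet_Iio measurable_const
    (Measurable.ite measurableSet_Ioi measurable_const measurable_const)

lemma limitVar_one (F G : ℝ → ℝ) (hC : MeasurableSet (contactSet F G)) (ω : Ω') :
    limitVar 1 F G 𝔾 ω = (∫ t in contactSet F G, |𝔾 t ω|) +
      ∫ t, 𝔾 t ω * (contactSet F G)ᶜ.indicator (fun t => Real.sign (F t - G t)) t := by
  rw [limitVar, if_pos rfl, ← integral_indicator hC.compl]
  congr 2
  funext t
  by_cases ht : t ∈ (contactSet F G)ᶜ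
  · rw [indicator_of_mem ht, indicator_of_mem ht]
  · rw [indicator_of_notMem ht, indicator_of_notMem ht, mul_zero]

/-- For `p = 1`, the limit law is normal exactly when the variance vanishes on the contact set. -/
theorem isZeroMeanNormal_limitVar_one_iff (h : IsCenteredGaussian P' K 𝔾) {F G : ℝ → ℝ}
    (hF : Measurable F) (hG : Measurable G)
    (hK : MemLp (fun t => √(K t t)) (ENNReal.ofReal 1) volume) :
    IsZeroMeanNormal P' (limitVar 1 F G 𝔾) ↔ ∀ᵐ t : ℝ, t ∈ contactSet F G → K t t = 0 := by
  have hC := measurableSet_contactSet hF hG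
  set C := contactSet F G with hCdef
  set f : ℝ → ℝ := Cᶜ.indicator fun t => Real.sign (F t - G t) with hf
  have hfm : Measurable f := (measurable_sign.comp (hF.sub hG)).indicator hC.compl
  have hfb : ∀ t, ‖f t‖ ≤ 1 := fun t => by
    by_cases ht : t ∈ Cᶜ
    · rw [hf, indicator_of_mem ht]; exact abs_sign_le_one _
    · rw [hf, indicator_of_notMem ht]; simp
  have hfin : Integrable fun t => √(K t t) * f t := by
    rw [ENNReal.ofReal_one, memLp_one_iff_integrable] at hK
    exact hK.mul_bdd hfm.aestronglyMeasurable (ae_of_all _ hfb)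
  have hN := h.isZeroMeanNormal_integral hfm.aemeasurable hfin
  have hT : ∀ ω, limitVar 1 F G 𝔾 ω = (∫ t in C, |𝔾 t ω|) + ∫ t, 𝔾 t ω * f t := fun ω =>
    limitVar_one F G hC ω
  rw [← h.ae_ae_eq_zero_iff hC]
  constructor
  · intro hT0
    -- The contact integral is a difference of two centered variables, so it has mean zero; no joint
    -- normality is needed. Being nonnegative, it vanishes almost surely.
    have hI : ∀ ω, ∫ t in C, |𝔾 t ω| = limitVar 1 F G 𝔾 ω - ∫ t, 𝔾 t ω * f t := fun ω => by
      rw [hT]; ring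
    have hInt : Integrable (fun ω => ∫ t in C, |𝔾 t ω|) P' := by
      simp_rw [hI]; exact hT0.integrable.sub hN.integrable
    have hzero : ∫ ω, (∫ t in C, |𝔾 t ω|) ∂P' = 0 := by
      simp_rw [hI]
      rw [integral_sub hT0.integrable hN.integrable, hT0.integral_eq_zero, hN.integral_eq_zero,
        sub_zero]
    have hae := (integral_eq_zero_iff_of_nonneg
      (fun ω => integral_nonneg fun t => abs_nonneg _) hInt).1 hzero
    filter_upwards [hae, h.ae_memLp le_rfl hK] with ω hω hLp
    rw [ENNReal.ofReal_one, memLp_one_iff_integrable] at hLp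
    have h1 := (integral_eq_zero_iff_of_nonneg (fun t => abs_nonneg _) hLp.abs.integrableOn).1 hω
    rw [EventuallyEq, ae_restrict_iff' hC] at h1
    filter_upwards [h1] with t ht htC
    exact abs_eq_zero.1 (ht htC)
  · intro h0
    refine hN.congr ?_
    filter_upwards [h0] with ω hω
    rw [hT, setIntegral_eq_zero_of_ae_eq_zero, zero_add]
    filter_upwards [hω] with t ht htC
    rw [ht htC, abs_zero]

/-- For `p > 1` and `F ≠ G`, the limit law is normal. -/
theorem isZeroMeanNormal_limitVar_of_ne (h : IsCenteredGaussian P' K 𝔾) (hp : 1 < p)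
    {F G : ℝ → ℝ} (hF : Measurable F) (hG : Measurable G) (hne : F ≠ G)
    (hD : MemLp (fun t => F t - G t) (ENNReal.ofReal p) volume)
    (hK : MemLp (fun t => √(K t t)) (ENNReal.ofReal p) volume) :
    IsZeroMeanNormal P' (limitVar p F G 𝔾) := by
  have hp0 : 0 < p := by linarith
  set c := (lpDist p F G ^ (p - 1))⁻¹ with hc
  set w : ℝ → ℝ := fun t => |F t - G t| ^ (p - 1) * Real.sign (F t - G t) with hw
  have hDm : Measurable fun t => F t - G t := hF.sub hG
  have hwm : Measurable w := ((hDm.abs).pow_const _).mul (measurable_sign.comp hDm)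
  have hpow : ∀ {f : ℝ → ℝ}, MemLp f (ENNReal.ofReal p) volume →
      Integrable (fun t => |f t| ^ p) volume := by
    intro f hf
    have := hf.integrable_norm_rpow (by simpa using hp0) (by simp)
    simpa [ENNReal.toReal_ofReal hp0.le] using this
  have hfin : Integrable fun t => √(K t t) * (c * w t) := by
    have h1 : Integrable fun t => √(K t t) * w t := by
      refine ((hpow hD).add (hpow hK)).mono (hK.1.mul hwm.aestronglyMeasurable)
        (ae_of_all _ fun t => ?_)
      have ha := abs_nonneg (F t - G t)
      have hb := abs_nonneg (√(K t t))
      set a := |F t - G t|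
      set b := |√(K t t)|
      have hw1 : |w t| ≤ a ^ (p - 1) := by
        rw [hw, abs_mul, abs_of_nonneg (Real.rpow_nonneg ha _)]
        exact mul_le_of_le_one_right (Real.rpow_nonneg ha _) (abs_sign_le_one _)
      -- A crude form of Young's inequality that shows the weighted standard deviation to be
      -- integrable.
      have hab : b * a ^ (p - 1) ≤ max a b ^ p := by
        have hm0 : 0 ≤ max a b := le_max_of_le_left ha
        calc b * a ^ (p - 1) ≤ max a b * max a b ^ (p - 1) := by
              gcongr
              · exact le_max_right _ _
              · exact le_max_left _ _
          _ = max a b ^ p := by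
              nth_rewrite 1 [← Real.rpow_one (max a b)]
              rw [← Real.rpow_add' hm0 (by linarith)]
              congr 1; ring
      have hmax : max a b ^ p ≤ a ^ p + b ^ p := by
        rcases max_cases a b with ⟨h2, _⟩ | ⟨h2, _⟩ <;> rw [h2]
        · exact le_add_of_nonneg_right (Real.rpow_nonneg hb _)
        · exact le_add_of_nonneg_left (Real.rpow_nonneg ha _)
      rw [Real.norm_eq_abs, abs_mul, Pi.add_apply, Real.norm_of_nonneg
        (add_nonneg (Real.rpow_nonneg ha _) (Real.rpow_nonneg hb _))]
      calc b * |w t| ≤ b * a ^ (p - 1) := by gcongr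
        _ ≤ _ := hab.trans hmax
    refine (h1.const_mul c).congr (ae_of_all _ fun t => ?_)
    simp only
    ring
  refine (h.isZeroMeanNormal_integral (hwm.const_mul c).aemeasurable hfin).congr
    (ae_of_all _ fun ω => ?_)
  rw [limitVar, if_neg hp.ne', if_neg hne, ← integral_const_mul]
  refine integral_congr_ae (ae_of_all _ fun t => ?_)
  simp only [hw]
  ring

/-- For `p > 1` and `F = G`, a normal limit law is degenerate. -/
theorem ae_eq_zero_of_isZeroMeanNormal_limitVar (h : IsCenteredGaussian P' K 𝔾) (hp : 1 < p)
    {F : ℝ → ℝ} (hK : MemLp (fun t => √(K t t)) (ENNReal.ofReal p) volume)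
    (hN : IsZeroMeanNormal P' (limitVar p F F 𝔾)) : ∀ᵐ t : ℝ, K t t = 0 := by
  have hp0 : 0 < p := by linarith
  have hT : ∀ ω, limitVar p F F 𝔾 ω = (∫ t, |𝔾 t ω| ^ p) ^ (1 / p) := fun ω => by
    rw [limitVar, if_neg hp.ne', if_pos rfl]
  have hnn : ∀ ω, 0 ≤ ∫ t, |𝔾 t ω| ^ p := fun ω =>
    integral_nonneg fun t => Real.rpow_nonneg (abs_nonneg _) _
  -- Here the limit variable is a norm, and a nonnegative variable of mean zero vanishes almost
  -- surely.
  have hae := (integral_eq_zero_iff_of_nonneg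
    (fun ω => by rw [hT]; exact Real.rpow_nonneg (hnn ω) _) hN.integrable).1 hN.integral_eq_zero
  have h1 : ∀ᵐ ω ∂P', ∀ᵐ t : ℝ, t ∈ (univ : Set ℝ) → 𝔾 t ω = 0 := by
    filter_upwards [hae, h.ae_memLp hp.le hK] with ω hω hLp
    have hω : limitVar p F F 𝔾 ω = 0 := hω
    rw [hT, Real.rpow_eq_zero (hnn ω) (by positivity)] at hω
    have hi : Integrable (fun t => |𝔾 t ω| ^ p) volume := by
      have := hLp.integrable_norm_rpow (by simpa using hp0) (by simp)
      simpa [ENNReal.toReal_ofReal hp0.le] using this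
    have h2 := (integral_eq_zero_iff_of_nonneg
      (fun t => Real.rpow_nonneg (abs_nonneg _) _) hi).1 hω
    filter_upwards [h2] with t ht _
    exact abs_eq_zero.1 ((Real.rpow_eq_zero (abs_nonneg _) hp0.ne').1 ht)
  have h2 := (h.ae_ae_eq_zero_iff MeasurableSet.univ).1 h1
  filter_upwards [h2] with t ht
  exact ht (mem_univ t)

end LimitLaw

/-! ### Distribution functions of the model -/

section Model

variable {k : ℕ} {μ : Measure ℝ} [IsProbabilityMeasure μ]

/-- Right-continuity extends `F < 1` to an interval `[t, u)`, and monotonicity keeps `F > 0` there.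
-/
lemma volume_cdf_ne_zero (hμ : ∃ t : ℝ, 0 < cdf μ t ∧ cdf μ t < 1) :
    volume {t : ℝ | 0 < cdf μ t ∧ cdf μ t < 1} ≠ 0 := by
  obtain ⟨t, h0, h1⟩ := hμ
  have hev : ∀ᶠ s in 𝓝[≥] t, cdf μ s < 1 :=
    ((cdf μ).right_continuous t).tendsto.eventually (gt_mem_nhds h1)
  obtain ⟨u, hu, hsub⟩ := mem_nhdsGE_iff_exists_Ico_subset.1 hev
  have hle : Ico t u ⊆ {t : ℝ | 0 < cdf μ t ∧ cdf μ t < 1} := fun s hs =>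
    ⟨h0.trans_le (monotone_cdf μ hs.1), hsub hs⟩
  refine ne_of_gt (lt_of_lt_of_le ?_ (measure_mono hle))
  rw [Real.volume_Ico, ENNReal.ofReal_pos, sub_pos]
  exact hu

/-- If `F = G(θ)`, unbiasedness makes `θ` a root of `E_F ψ_θ = 0`, so `θ = θ_F` by uniqueness:
membership in the family can only occur at `θ_F`. -/
lemma Model.cdf_ne_iff {Θ : Set (Param k)} {Q : Param k → Measure ℝ} {ψ : Param k → ℝ → Param k}
    {θF : Param k} (h : Model Θ Q ψ μ θF) :
    (cdf μ : ℝ → ℝ) ≠ cdf (Q θF) ↔ ¬ ∃ θ ∈ Θ, (cdf μ : ℝ → ℝ) = cdf (Q θ) := by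
  rw [Ne, not_iff_not]
  constructor
  · exact fun hEq => ⟨θF, interior_subset h.interior, hEq⟩
  · rintro ⟨θ, hθ, hEq⟩
    have := h.isProb θ hθ
    have hQ : μ = Q θ := Measure.eq_of_cdf _ _ (StieltjesFunction.ext fun t => congrFun hEq t)
    obtain ⟨hi, h0⟩ := h.unbiased θ hθ
    rw [← hQ] at hi h0
    rwa [← h.unique θ hθ hi h0]

end Model

end AGoF

theorem corollary1 {k : ℕ} {Ω Ω' : Type*} [MeasurableSpace Ω] [MeasurableSpace Ω']
    (P : Measure Ω) [IsProbabilityMeasure P] (P' : Measure Ω') [IsProbabilityMeasure P']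
    (p : ℝ) (hp : 1 ≤ p)
    -- the law of the observations (not a point mass) and the parametric model
    (μ : Measure ℝ) [IsProbabilityMeasure μ] (hμ : ∃ t : ℝ, 0 < cdf μ t ∧ cdf μ t < 1)
    (Θ : Set (AGoF.Param k)) (Q : AGoF.Param k → Measure ℝ)
    (ψ : AGoF.Param k → ℝ → AGoF.Param k) (θF : AGoF.Param k)
    (hmodel : AGoF.Model Θ Q ψ μ θF)
    (hFG : MemLp (fun t => cdf μ t - cdf (Q θF) t) (ENNReal.ofReal p) volume)
    -- the sample and the estimators
    (X : ℕ → Ω → ℝ) (hXlaw : ∀ i, HasLaw (X i) μ P) (hXindep : iIndepFun X P)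
    (θhat : ℕ → Ω → AGoF.Param k) (hθmeas : ∀ n, AEMeasurable (θhat n) P)
    (hθmem : ∀ n, ∀ᵐ ω ∂P, θhat n ω ∈ Θ)
    -- differentiability of the model, asymptotic linearity, integrability
    (Gdot : ℝ → AGoF.Param k) (hG : AGoF.LpDifferentiable p Q θF Gdot)
    (V : AGoF.Param k ≃L[ℝ] AGoF.Param k) (hψ : AGoF.AsympLinear P ψ μ θF V X θhat)
    (hX : AGoF.LorentzCond p μ)
    -- the limit process
    (𝔾 : ℝ → Ω' → ℝ)
    (h𝔾 : AGoF.IsCenteredGaussian P' (AGoF.limitCov μ Gdot (AGoF.influence ψ θF V)) 𝔾)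
    -- its variance does not vanish where `F` is locally constant and in contact with `G(θF)`
    (hnd : ∀ᵐ t : ℝ, t ∈ AGoF.contactSet (cdf μ) (cdf (Q θF)) → 0 < cdf μ t → cdf μ t < 1 →
      (∀ᶠ s in 𝓝 t, cdf μ s = cdf μ t) →
      0 < AGoF.limitCov μ Gdot (AGoF.influence ψ θF V) t t) :
    TendstoInDistribution (AGoF.testStat p μ Q θF X θhat) atTop
        (AGoF.limitVar p (cdf μ) (cdf (Q θF)) 𝔾) (fun _ => P) P' ∧
      (p = 1 →
        (AGoF.IsZeroMeanNormal P' (AGoF.limitVar p (cdf μ) (cdf (Q θF)) 𝔾) ↔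
          volume (AGoF.contactSet (cdf μ) (cdf (Q θF)) ∩ {t | 0 < cdf μ t ∧ cdf μ t < 1}) = 0)) ∧
      (1 < p →
        (AGoF.IsZeroMeanNormal P' (AGoF.limitVar p (cdf μ) (cdf (Q θF)) 𝔾) ↔
          (cdf μ : ℝ → ℝ) ≠ cdf (Q θF)) ∧
        ((cdf μ : ℝ → ℝ) ≠ cdf (Q θF) ↔ ¬ ∃ θ ∈ Θ, (cdf μ : ℝ → ℝ) = cdf (Q θ))) := by
  have hl2 : MemLp (AGoF.influence ψ θF V) 2 μ := AGoF.memLp_influence hψ.memLp_two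
  have hl0 := AGoF.integral_influence (V := V) hmodel.root.1 hmodel.root.2
  have hK := AGoF.memLp_sqrt_limitCov hp hX hG hl2 hl0
  have hFm := AGoF.measurable_cdf' μ
  have hGm := AGoF.measurable_cdf' (Q θF)
  refine ⟨AGoF.tendstoInDistribution_testStat hp hX hFG hXlaw hXindep hG hψ hmodel.root.2 h𝔾
    (AGoF.aemeasurable_testStat hp hmodel.measurable_cdf hXlaw hθmeas hθmem), ?_,
    fun hp1 => ⟨⟨?_, fun hne => AGoF.isZeroMeanNormal_limitVar_of_ne h𝔾 hp1 hFm hGm hne hFG hK⟩,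
      hmodel.cdf_ne_iff⟩⟩
  · rintro rfl
    rw [AGoF.isZeroMeanNormal_limitVar_one_iff h𝔾 hFm hGm hK]
    refine ⟨AGoF.measure_contact_eq_zero hl2 hl0 hnd, fun h0 => ?_⟩
    -- Almost every contact point has `F = G(θ_F) ∈ {0, 1}`, where `Ġ` vanishes almost everywhere
    -- and both parts of the variance disappear.
    filter_upwards [hG.ae_eq_zero hp, measure_eq_zero_iff_ae_notMem.1 h0] with t hGt ht htC
    have hFt : cdf μ t = 0 ∨ cdf μ t = 1 := by
      by_contra hcon
      rw [not_or] at hcon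
      exact ht ⟨htC, lt_of_le_of_ne (cdf_nonneg μ t) (Ne.symm hcon.1),
        lt_of_le_of_ne (cdf_le_one μ t) hcon.2⟩
    have htC : cdf μ t = cdf (Q θF) t := htC
    exact AGoF.limitCov_self_of_Gdot_eq_zero (hGt (htC ▸ hFt)) hFt
  · intro hN hEq
    -- With `F = G(θ_F)` the contact set is the whole line. Normality would make the variance vanish
    -- almost everywhere and hence `{0 < F < 1}` null, which is impossible as `F` is not a point
    -- mass.
    rw [← hEq] at hN hnd
    have h0 := AGoF.ae_eq_zero_of_isZeroMeanNormal_limitVar h𝔾 hp1 hK hN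
    have h1 := AGoF.measure_contact_eq_zero hl2 hl0 hnd (h0.mono fun t ht _ => ht)
    have hC : AGoF.contactSet (cdf μ) (cdf μ) = univ := eq_univ_of_forall fun t => rfl
    rw [hC, univ_inter] at h1
    exact AGoF.volume_cdf_ne_zero hμ h1
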